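/- **Theorem (soundness of the node lock implementation).** The ticket-lock implementation $I_{NL}$ is a well-defined and sound implementation of the node lock library NLOCK using the set of libraries $\{\mathrm{RDMA}\}$, where all notions are as follows. *Setting.* Fix a set $\mathsf{Val}$ of values with elements $0$, $1$, $()$ and an addition such that $0,\ 0+1,\ (0+1)+1,\dots$ are pairwise distinct; a set $\mathsf{Loc}\subseteq\mathsf{Val}$ of locations; a finite set $\mathsf{Tid}$ of threads; a set of nodes; a set of work identifiers; and maps assigning a node $n(t)$ to each thread $t$ and a node $n(x)$ to each location $x$. *Programs.* Sequential programs are $p ::= v \mid m(\vec v) \mid \mathsf{let}\ p\ f \mid \mathsf{loop}\ p\mid \mathsf{break}_k\,v$ with $f:\mathsf{Val}\to$ programs and $k\ge 1$. A concurrent program $P$ gives a sequential program for each thread. An event is $\langle t,\iota,\langle m,\vec v,v'\rangle\rangle$ (thread, identifier, call, output). The plain semantics $[\![P]\!]$ is the set of pairs of an output tuple and a pair $\langle E,po\rangle$ of the events and program order, over all terminating unfoldings of all threads, with arbitrary outputs of calls. *Stamps.* The stamps are $aCR,aCW,aCAS,aMF,aWT$ and, for each node $n$, $nLR_n,nRW_n,nARR_n,nRR_n,nLW_n,nF_n,GF_n$.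 The stamp order $sto$ contains all pairs $(a,b)$ with $a\in\{aCR,aCW,aCAS,aMF,aWT,GF_n\}$, except $(aCW,aCR)$ and $(aCW,aWT)$; and, with the same $n$ on both sides, the pairs from $nLR_n$ and $nF_n$ to all of $nLR_n,nRW_n,nARR_n,nRR_n,nLW_n,nF_n,GF_n$; from $nRW_n$ to $nRW_n,nARR_n,nRR_n,nLW_n,GF_n$; from $nARR_n$ to $nRW_n,nARR_n,nRR_n,nLW_n,nF_n,GF_n$; from $nRR_n$ to $nLW_n,nF_n,GF_n$; from $nLW_n$ to $nLW_n,GF_n$; and nothing else. *Executions and libraries.* An execution is $\mathcal G=\langle E,po,stmp,so,hb\rangle$: $po$ is a disjoint union of strict total orders, one on the events of each thread; $stmp(e)$ is a nonempty set of stamps; subevents are the pairs $(e,a)$ with $a\in stmp(e)$; $so$ and $hb$ are relations on subevents; $hb$ is a strict partial order containing $so$ and $ppo=\{((e_1,a_1),(e_2,a_2)) : (e_1,e_2)\in po,\ (a_1,a_2)\in sto\}$. A library is a triple of a set of method calls, a function giving the locations of each call, and a set of consistent executions. $\mathcal G$ is $\Lambda$-consistent if its restriction to the calls of each $L\in\Lambda$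 is $L$-consistent, every event calls a library of $\Lambda$, and $so$ is the union of its restrictions to the libraries of $\Lambda$. $\mathrm{outcome}_\Lambda(P)$ is the set of tuples $\vec v$ with $(\vec v,\langle E,po\rangle)\in[\![P]\!]$ for some $\Lambda$-consistent $\mathcal G=\langle E,po,\dots\rangle$. *Implementations.* An implementation $I$ of $L$ using $\Lambda$ maps each thread and each call of $L$ to a program. It is *well defined* if $L\notin\Lambda$, its programs only call methods of $\Lambda$, never end with a nonzero break number, and perform at least one call whenever they terminate. It is *sound* if, for every concurrent program $P$ whose accessed locations (those of the events in $[\![P]\!]$) are disjoint from those accessed by $I$, $\mathrm{outcome}_\Lambda(I(P))\subseteq \mathrm{outcome}_{\Lambda\uplus\{L\}}(P)$, where $I(P)$ is $P$ with each call of $L$ replaced by its implementation. *The library RDMA.* Its methods are $\mathtt{Write}(x,v)$, $\mathtt{Read}(x)$, $\mathtt{CAS}(x,v_1,v_2)$, $\mathtt{Mfence}()$, $\mathtt{Get}(x,y,d)$, $\mathtt{Put}(x,y,d)$, $\mathtt{Wait}(d)$, $\mathtt{Rfence}(n)$, $\mathtt{RCAS}(x,y,v_1,v_2,d)$, $\mathtt{RFAA}(x,y,v,d)$.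 An execution is consistent iff: - every event has its local location ($y$ for $\mathtt{Put}$, $x$ otherwise) on the node of its thread; methods other than $\mathtt{Read}$, $\mathtt{CAS}$ return $()$; - stamp sets are $\{aCW\}$, $\{aCR\}$, $\{aMF\}$, $\{aWT\}$, $\{nF_n\}$ for $\mathtt{Write},\mathtt{Read},\mathtt{Mfence},\mathtt{Wait},\mathtt{Rfence}(n)$; $\{aCAS\}$ for a $\mathtt{CAS}$ with output $v_1$ and $\{aMF,aCR\}$ for one with another output; $\{nRR_n,nLW_n\}$ for $\mathtt{Get}$; $\{nLR_n,nRW_n\}$ for $\mathtt{Put}$; $\{nARR_n,nRW_n,nLW_n\}$ for $\mathtt{RFAA}$; and either this set or $\{nARR_n,nLW_n\}$ for $\mathtt{RCAS}$; here $n$ is the node of the remote location; - there are value functions $v_R,v_W$ on read subevents (stamps $aCR,aCAS,nLR,nARR,nRR$) and write subevents (stamps $aCW,aCAS,nLW,nRW$) and relations $rf,mo,nfo,rao$ on subevents such that: $v_R$, $v_W$ agree with the outputs and arguments of $\mathtt{Read}$, $\mathtt{Write}$, $\mathtt{CAS}$; within an event, the value read by $nLR_n$ is written by $nRW_n$, and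 the one read by $nRR_n$ or $nARR_n$ is written by $nLW_n$; an $\mathtt{RFAA}$ writes remotely the value read plus $v$; an $\mathtt{RCAS}$ has stamp $nRW_n$ only if it reads $v_1$ (and then it writes $v_2$), and lacks it only if it reads another value; $rf$ relates writes to reads of the same location and value, each read has at most one source, and reads without source return $0$; $mo$ is a union of strict total orders on the writes to each location; subevents of one thread with stamps $(nLR_n,nLW_n)$, $(nRR_n,nRW_n)$ or $(nARR_n,nRW_n)$ are related by $nfo$ in one direction or the other; $rao$ is a union, over nodes $n$, of strict total orders on the $nARR_n$ subevents of remote read-modify-writes towards $n$; - with $rb$ = pairs $(r,w)$, $r\ne w$, of a read and a write of the same location with $(r,w)\in rf^{-1};mo$ or $r$ without $rf$-source; $rb_i$ = its restriction to $aCR\times aCW$ pairs of one thread; $rf_i$ = restriction of $rf\cap po$ to $aCW\times aCR$; $rf_e=rf\setminus rf_i$; $pfg$ (resp. $pfp$) = pairs of an $nLW$ (resp. $nRW$) subevent and a $po$-later $aWT$ subevent with the same work identifier; $iso$ = pairs in one event from $aMF$ to $aCR$ ($\mathtt{CAS}$), $nRR$ to $nLW$ ($\mathtt{Get}$), $nLR$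 to $nRW$ ($\mathtt{Put}$), $nARR$ to $nLW$ and to $nRW$ ($\mathtt{RCAS},\mathtt{RFAA}$); $ippo = ppo\cup[aCW];po;[aCR\cup aWT]\cup\bigcup_n[nRW_n\cup nLW_n];po;[nF_n]$; and $ib=(ippo\cup iso\cup rf\cup pfg\cup pfp\cup nfo\cup rb_i)^+$: the relation $ib$ is irreflexive and $$so=iso\cup rf_e\cup pfg\cup nfo\cup rb\cup mo\cup rao\cup([nRW];iso^{-1};rao)\cup([Inst];ib),$$ where $Inst$ is the set of subevents whose stamp is not $aCW$, $nLW_n$ or $nRW_n$. *The library NLOCK.* Let $\mathsf{Lk}\subseteq\mathsf{Loc}$ be a set of node locks. The methods are $\mathtt{Acq}(x)$ and $\mathtt{Rel}(x)$ for $x\in\mathsf{Lk}$, both with set of locations $\{x\}$. An execution is lock-well-formed if, for each $x$, in the program order $po_x$ restricted to the events on $x$, every $\mathtt{Acq}(x)$ is immediately followed by a $\mathtt{Rel}(x)$ and every $\mathtt{Rel}(x)$ immediately preceded by an $\mathtt{Acq}(x)$. A lock-well-formed execution is consistent iff all outputs are $()$, $stmp(e)=\{aMF\}$ for $e$ calling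 $\mathtt{Acq}(x)$, $stmp(e)=\{nF_{n(x)},nRW_{n(x)}\}$ for $e$ calling $\mathtt{Rel}(x)$, and there are strict total orders $lo_x$ on the $\mathtt{Acq}(x)$ events such that $so$ consists exactly of the pairs $((e,nF_{n(x)}),(e,nRW_{n(x)}))$ for $e$ calling $\mathtt{Rel}(x)$ and the pairs $((e_1,nRW_{n(x)}),(e_2,aMF))$ for which some $e_0$ is immediately $po_x$-before $e_1$ and $lo_x$-before $e_2$. Executions that are not lock-well-formed are unconstrained (all are consistent). *The implementation $I_{NL}$.* For $x\in\mathsf{Lk}$ and each thread $t$ choose locations $x_a,x_r$ on node $n(x)$ and $p^t_x$ on node $n(t)$, all of these (over all $x$ and $t$) pairwise distinct, and arbitrary work identifiers $d=d^t_x$, $d'=d'^t_x$. Then $$I_{NL}(t,\mathtt{Acq}(x)) = \mathtt{RFAA}(p^t_x,x_a,1,d);\ \mathtt{Wait}(d);\ \mathsf{let}\ v=\mathtt{Read}(p^t_x)\ \mathsf{in}\ \mathsf{loop}\{\mathtt{Get}(p^t_x,x_r,d);\ \mathtt{Wait}(d);\ \mathsf{if}\ \mathtt{Read}(p^t_x)=v\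 \mathsf{then}\ \mathsf{break}\};\ \mathtt{Write}(p^t_x,v+1),$$ $$I_{NL}(t,\mathtt{Rel}(x)) = \mathtt{Rfence}(n(x));\ \mathtt{Put}(x_r,p^t_x,d').$$ -/

import Mathlib

/-! ## Relations -/

/-- `r` is a strict total order on the set `S` (and relates only elements of `S`). -/
structure StrictTotalOn {α : Type*} (S : Set α) (r : α → α → Prop) : Prop where
  sub : ∀ a b, r a b → a ∈ S ∧ b ∈ S
  irrefl : ∀ a, ¬ r a a
  trans : ∀ a b c, r a b → r b c → r a c
  total : ∀ a ∈ S, ∀ b ∈ S, a ≠ b → r a b ∨ r b a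

/-- The restriction `[S]; r; [S]`. -/
def relOn {α : Type*} (S : Set α) (r : α → α → Prop) (a b : α) : Prop :=
  a ∈ S ∧ b ∈ S ∧ r a b

/-- The immediate edges `r \ (r; r)` of `r`. -/
def immEdge {α : Type*} (r : α → α → Prop) (a b : α) : Prop :=
  r a b ∧ ¬ ∃ c, r a c ∧ r c b

/-! ## Stamps and the stamp order -/

/-- Stamps: CPU read, CPU write, CPU compare-and-swap, memory fence, wait; and, for each node,
NIC local read, NIC remote write, NIC atomic remote read, NIC remote read, NIC local write,
NIC (remote) fence, global fence. -/
inductive Stamp (Node : Type*)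
  | aCR | aCW | aCAS | aMF | aWT
  | nLR (n : Node) | nRW (n : Node) | nARR (n : Node) | nRR (n : Node) | nLW (n : Node)
  | nF (n : Node) | GF (n : Node)

namespace Stamp

variable {Node : Type*}

/-- The stamp belongs to one of the families, at the node `n`. -/
def At : Stamp Node → Node → Prop
  | nLR m, n | nRW m, n | nARR m, n | nRR m, n | nLW m, n | nF m, n | GF m, n => m = n
  | _, _ => False

/-- The stamp order: `sto a b` says that program order from a subevent stamped `a` to a later
one stamped `b` is preserved. -/
def sto : Stamp Node → Stamp Node → Prop
  | aCW, aCR | aCW, aWT => False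
  | aCR, _ | aCW, _ | aCAS, _ | aMF, _ | aWT, _ | GF _, _ => True
  | nLR n, b => b.At n
  | nRW _, nLR _ | nRW _, nF _ => False
  | nRW n, b => b.At n
  | nARR _, nLR _ => False
  | nARR n, b => b.At n
  | nRR n, nLW m | nRR n, nF m | nRR n, GF m => n = m
  | nRR _, _ => False
  | nLW n, nLW m | nLW n, GF m => n = m
  | nLW _, _ => False
  | nF n, b => b.At n

/-- Stamps of read subevents. -/
def IsRead : Stamp Node → Prop
  | aCR | aCAS | nLR _ | nARR _ | nRR _ => True
  | _ => False

/-- Stamps of write subevents. -/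
def IsWrite : Stamp Node → Prop
  | aCW | aCAS | nLW _ | nRW _ => True
  | _ => False

/-- Stamps of instantaneous subevents. -/
def IsInst : Stamp Node → Prop
  | aCW | nLW _ | nRW _ => False
  | _ => True

end Stamp

/-! ## Programs, events, plain executions

Everything here is generic in the type `Call` of method calls `m(v₁,…,vₖ)`. -/

/-- Sequential programs: a value, a method call, `let`, `loop`, and `break_k v`. -/
inductive SeqProg (Call Val : Type*)
  | val (v : Val)
  | call (c : Call)
  | bind (p : SeqProg Call Val) (f : Val → SeqProg Call Val)
  | loop (p : SeqProg Call Val)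
  | brk (k : ℕ+) (v : Val)

namespace SeqProg

variable {Call Val : Type*}

/-- `p ; q` -/
def seq (p q : SeqProg Call Val) : SeqProg Call Val := bind p fun _ => q

/-- All method calls written in the program belong to `S`. -/
def CallsIn (S : Set Call) : SeqProg Call Val → Prop
  | val _ => True
  | call c => c ∈ S
  | bind p f => p.CallsIn S ∧ ∀ v, (f v).CallsIn S
  | loop p => p.CallsIn S
  | brk _ _ => True

open Classical in
/-- Replace each call `c` with `c ∈ M` by the program `I c`. -/
noncomputable def inline (M : Set Call) (I : Call → SeqProg Call Val) :
    SeqProg Call Val → SeqProg Call Val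
  | val v => val v
  | call c => if c ∈ M then I c else call c
  | bind p f => bind (p.inline M I) fun v => (f v).inline M I
  | loop p => loop (p.inline M I)
  | brk k v => brk k v

end SeqProg

/-- An event: thread, identifier, method call, output. -/
structure Event (Tid Call Val : Type*) where
  tid : Tid
  ident : ℕ
  call : Call
  out : Val

/-- A set of events with a program order. -/
structure Plain (Tid Call Val : Type*) where
  E : Set (Event Tid Call Val)
  po : Event Tid Call Val → Event Tid Call Val → Prop

namespace Plain

variable {Tid Call Val : Type*}

/-- The empty execution. -/
def empty : Plain Tid Call Val := ⟨∅, fun _ _ => False⟩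

/-- The execution with a single event. -/
def single (e : Event Tid Call Val) : Plain Tid Call Val := ⟨{e}, fun _ _ => False⟩

/-- Sequential composition. -/
def seq (G H : Plain Tid Call Val) : Plain Tid Call Val :=
  ⟨G.E ∪ H.E, fun a b => G.po a b ∨ H.po a b ∨ (a ∈ G.E ∧ b ∈ H.E)⟩

/-- Parallel composition over all threads. -/
def par (G : Tid → Plain Tid Call Val) : Plain Tid Call Val :=
  ⟨⋃ t, (G t).E, fun a b => ∃ t, (G t).po a b⟩

end Plain

/-- `Unfolds t p (v, k) G`: the pair of the output `(v, k)` (value and break number) and the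
plain execution `G` belongs to the plain semantics of `p` run by thread `t`. -/
inductive Unfolds {Tid Call Val : Type*} (t : Tid) :
    SeqProg Call Val → Val × ℕ → Plain Tid Call Val → Prop
  | val (v : Val) : Unfolds t (.val v) (v, 0) Plain.empty
  | brk (k : ℕ+) (v : Val) : Unfolds t (.brk k v) (v, k) Plain.empty
  | call (c : Call) (i : ℕ) (w : Val) : Unfolds t (.call c) (w, 0) (Plain.single ⟨t, i, c, w⟩)
  | bind (p : SeqProg Call Val) (f : Val → SeqProg Call Val) (v : Val) (r : Val × ℕ)
      (G H : Plain Tid Call Val) : Unfolds t p (v, 0) G → Unfolds t (f v) r H →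
      Disjoint G.E H.E → Unfolds t (.bind p f) r (G.seq H)
  | bindBrk (p : SeqProg Call Val) (f : Val → SeqProg Call Val) (v : Val) (k : ℕ)
      (G : Plain Tid Call Val) : Unfolds t p (v, k) G → k ≠ 0 → Unfolds t (.bind p f) (v, k) G
  | loopExit (p : SeqProg Call Val) (v : Val) (k : ℕ) (G : Plain Tid Call Val) :
      Unfolds t p (v, k + 1) G → Unfolds t (.loop p) (v, k) G
  | loopNext (p : SeqProg Call Val) (v : Val) (r : Val × ℕ) (G H : Plain Tid Call Val) :
      Unfolds t p (v, 0) G → Unfolds t (.loop p) r H → Disjoint G.E H.E →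
      Unfolds t (.loop p) r (G.seq H)

/-- Plain semantics of a concurrent program: all threads terminate with break number `0`. -/
def ProgUnfolds {Tid Call Val : Type*} (P : Tid → SeqProg Call Val) (v : Tid → Val)
    (G : Plain Tid Call Val) : Prop :=
  ∃ H : Tid → Plain Tid Call Val, (∀ t, Unfolds t (P t) (v t, 0) (H t)) ∧ G = Plain.par H

/-! ## Executions, libraries, consistency -/

/-- A subevent: an event together with a stamp. -/
abbrev SubEvent (Tid Call Val Node : Type*) := Event Tid Call Val × Stamp Node

/-- The data of an execution. Only the values of `stmp` on `E` matter. -/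
structure Exec (Tid Call Val Node : Type*) where
  E : Set (Event Tid Call Val)
  po : Event Tid Call Val → Event Tid Call Val → Prop
  stmp : Event Tid Call Val → Set (Stamp Node)
  so : SubEvent Tid Call Val Node → SubEvent Tid Call Val Node → Prop
  hb : SubEvent Tid Call Val Node → SubEvent Tid Call Val Node → Prop

namespace Exec

variable {Tid Call Val Node : Type*}

/-- The subevents of an execution. -/
def SEvent (G : Exec Tid Call Val Node) : Set (SubEvent Tid Call Val Node) :=
  {s | s.1 ∈ G.E ∧ s.2 ∈ G.stmp s.1}

/-- Preserved program order. -/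
def ppo (G : Exec Tid Call Val Node) (s s' : SubEvent Tid Call Val Node) : Prop :=
  s ∈ G.SEvent ∧ s' ∈ G.SEvent ∧ G.po s.1 s'.1 ∧ s.2.sto s'.2

/-- The conditions that make the data an execution. -/
structure IsExecution (G : Exec Tid Call Val Node) : Prop where
  po_thread : ∀ a b, G.po a b → a.tid = b.tid
  po_sub : ∀ a b, G.po a b → a ∈ G.E ∧ b ∈ G.E
  po_total : ∀ t, StrictTotalOn {e ∈ G.E | e.tid = t} (relOn {e | e.tid = t} G.po)
  stmp_nonempty : ∀ e ∈ G.E, (G.stmp e).Nonempty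
  so_sub : ∀ s s', G.so s s' → s ∈ G.SEvent ∧ s' ∈ G.SEvent
  hb_sub : ∀ s s', G.hb s s' → s ∈ G.SEvent ∧ s' ∈ G.SEvent
  hb_irrefl : ∀ s, ¬ G.hb s s
  hb_trans : ∀ s₁ s₂ s₃, G.hb s₁ s₂ → G.hb s₂ s₃ → G.hb s₁ s₃
  so_hb : ∀ s s', G.so s s' → G.hb s s'
  ppo_hb : ∀ s s', G.ppo s s' → G.hb s s'

/-- The restriction of an execution to the events whose calls are in `M`. -/
def restrict (G : Exec Tid Call Val Node) (M : Set Call) : Exec Tid Call Val Node where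
  E := {e ∈ G.E | e.call ∈ M}
  po := relOn {e ∈ G.E | e.call ∈ M} G.po
  stmp := G.stmp
  so := relOn {s | s.1 ∈ G.E ∧ s.1.call ∈ M} G.so
  hb := relOn {s | s.1 ∈ G.E ∧ s.1.call ∈ M} G.hb

/-- The underlying plain execution. -/
def plain (G : Exec Tid Call Val Node) : Plain Tid Call Val := ⟨G.E, G.po⟩

end Exec

/-- A library: the calls of its methods, their locations, and its consistent executions. -/
structure Library (Tid Call Val Node Loc : Type*) where
  M : Set Call
  loc : Call → Set Loc
  C : Set (Exec Tid Call Val Node)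

section Framework

variable {Tid Call Val Node Loc : Type*}

/-- Consistency of an execution with respect to a set of libraries. -/
structure Consistent (Λ : Set (Library Tid Call Val Node Loc)) (G : Exec Tid Call Val Node) :
    Prop where
  isExecution : G.IsExecution
  lib : ∀ L ∈ Λ, G.restrict L.M ∈ L.C
  events : ∀ e ∈ G.E, ∃ L ∈ Λ, e.call ∈ L.M
  so_eq : ∀ s s', G.so s s' ↔ ∃ L ∈ Λ, (G.restrict L.M).so s s'

/-- The output tuples of the `Λ`-consistent executions of a concurrent program. -/
def outcome (Λ : Set (Library Tid Call Val Node Loc)) (P : Tid → SeqProg Call Val) :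
    Set (Tid → Val) :=
  {v | ∃ G : Exec Tid Call Val Node, Consistent Λ G ∧ ProgUnfolds P v G.plain}

/-- The locations accessed by the events of a plain execution that call libraries of `Λ`. -/
def Plain.locs (Λ : Set (Library Tid Call Val Node Loc)) (G : Plain Tid Call Val) : Set Loc :=
  {x | ∃ e ∈ G.E, ∃ L ∈ Λ, e.call ∈ L.M ∧ x ∈ L.loc e.call}

/-- The locations a concurrent program can access. -/
def progLocs (Λ : Set (Library Tid Call Val Node Loc)) (P : Tid → SeqProg Call Val) : Set Loc :=
  {x | ∃ v G, ProgUnfolds P v G ∧ x ∈ G.locs Λ}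

/-- An implementation of a library assigns a program to each thread and each call of the
library; its values on other calls are never used. -/
abbrev Implementation (Tid Call Val : Type*) := Tid → Call → SeqProg Call Val

/-- The locations an implementation of `L` using `Λ` can access. -/
def implLocs (L : Library Tid Call Val Node Loc) (Λ : Set (Library Tid Call Val Node Loc))
    (I : Implementation Tid Call Val) : Set Loc :=
  {x | ∃ t, ∃ c ∈ L.M, ∃ r G, Unfolds t (I t c) r G ∧ x ∈ G.locs Λ}

/-- `I` is a well-defined implementation of `L` using `Λ`. -/
structure WellDefinedImpl (L : Library Tid Call Val Node Loc)
    (Λ : Set (Library Tid Call Val Node Loc)) (I : Implementation Tid Call Val) : Prop where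
  not_mem : L ∉ Λ
  calls : ∀ t, ∀ c ∈ L.M, (I t c).CallsIn {c' | ∃ L' ∈ Λ, c' ∈ L'.M}
  no_break : ∀ t, ∀ c ∈ L.M, ∀ v k G, ¬ Unfolds t (I t c) (v, k + 1) G
  nonempty : ∀ t, ∀ c ∈ L.M, ∀ v G, Unfolds t (I t c) (v, 0) G → G.E.Nonempty

/-- `I` is a sound implementation of `L` using `Λ`: for every client program that does not use
the locations of `I`, inlining `I` yields no new outcomes. -/
def SoundImpl (L : Library Tid Call Val Node Loc) (Λ : Set (Library Tid Call Val Node Loc))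
    (I : Implementation Tid Call Val) : Prop :=
  ∀ P : Tid → SeqProg Call Val,
    Disjoint (implLocs L Λ I) (progLocs (insert L Λ) P) →
      outcome Λ (fun t => (P t).inline L.M (I t)) ⊆ outcome (insert L Λ) P

end Framework

/-! ## The method calls -/

/-- Calls of the RDMA library with remote read-modify-writes. In `get x y d`, `rcas x y _ _ d`
and `rfaa x y _ d` the local location is `x` and the remote one `y`; in `put x y d` the remote
location is `x` and the local one `y`. -/
inductive RdmaCall (Val Loc Node Wid : Type*)
  | write (x : Loc) (v : Val)
  | read (x : Loc)
  | cas (x : Loc) (v₁ v₂ : Val)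
  | mfence
  | get (x y : Loc) (d : Wid)
  | put (x y : Loc) (d : Wid)
  | wait (d : Wid)
  | rfence (n : Node)
  | rcas (x y : Loc) (v₁ v₂ : Val) (d : Wid)
  | rfaa (x y : Loc) (v : Val) (d : Wid)

/-- Calls of the RDMA library, and acquire and release of a node lock. -/
inductive Call (Val Loc Node Wid : Type*)
  | rdma (c : RdmaCall Val Loc Node Wid)
  | acq (x : Loc)
  | rel (x : Loc)

/-- The static data of the system: the node of each thread and of each location, and the
value `()` returned by methods without a result. -/
structure Config (Val Loc Tid Node : Type*) where
  unit : Val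
  nodeT : Tid → Node
  nodeL : Loc → Node

namespace RdmaCall

variable {Val Loc Tid Node Wid : Type*}

/-- The locations of a call. -/
def loc : RdmaCall Val Loc Node Wid → Set Loc
  | write x _ | read x | cas x _ _ => {x}
  | get x y _ | put x y _ | rcas x y _ _ _ | rfaa x y _ _ => {x, y}
  | mfence | wait _ | rfence _ => ∅

/-- The location of the subevent of a call with a given stamp. -/
def sloc : RdmaCall Val Loc Node Wid → Stamp Node → Set Loc
  | get _ y _, .nRR _ => {y}
  | get x _ _, .nLW _ => {x}
  | put _ y _, .nLR _ => {y}
  | put x _ _, .nRW _ => {x}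
  | rcas _ y _ _ _, .nARR _ | rcas _ y _ _ _, .nRW _ => {y}
  | rcas x _ _ _ _, .nLW _ => {x}
  | rfaa _ y _ _, .nARR _ | rfaa _ y _ _, .nRW _ => {y}
  | rfaa x _ _ _, .nLW _ => {x}
  | c, _ => c.loc

/-- The work identifier of a call, if any. -/
def wid : RdmaCall Val Loc Node Wid → Option Wid
  | get _ _ d | put _ _ d | wait d | rcas _ _ _ _ d | rfaa _ _ _ d => some d
  | _ => none

/-- The local location of a call is on the node of the calling thread. -/
def WellAddressed (K : Config Val Loc Tid Node) (t : Tid) : RdmaCall Val Loc Node Wid → Prop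
  | write x _ | read x | cas x _ _ => K.nodeL x = K.nodeT t
  | get x _ _ | rcas x _ _ _ _ | rfaa x _ _ _ => K.nodeL x = K.nodeT t
  | put _ y _ => K.nodeL y = K.nodeT t
  | mfence | wait _ | rfence _ => True

/-- Only `read` and `cas` return a proper value; all other methods return `()`. -/
def WellTyped (K : Config Val Loc Tid Node) (w : Val) : RdmaCall Val Loc Node Wid → Prop
  | read _ | cas _ _ _ => True
  | _ => w = K.unit

/-- The admissible sets of stamps of a call with output `w`. -/
def stamps (K : Config Val Loc Tid Node) (w : Val) :
    RdmaCall Val Loc Node Wid → Set (Set (Stamp Node))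
  | write _ _ => {{.aCW}}
  | read _ => {{.aCR}}
  | cas _ v₁ _ => {S | (v₁ ≠ w ∧ S = {.aMF, .aCR}) ∨ (v₁ = w ∧ S = {.aCAS})}
  | mfence => {{.aMF}}
  | get _ y _ => {{.nRR (K.nodeL y), .nLW (K.nodeL y)}}
  | put x _ _ => {{.nLR (K.nodeL x), .nRW (K.nodeL x)}}
  | wait _ => {{.aWT}}
  | rfence n => {{.nF n}}
  | rcas _ y _ _ _ => {{.nARR (K.nodeL y), .nLW (K.nodeL y)},
      {.nARR (K.nodeL y), .nRW (K.nodeL y), .nLW (K.nodeL y)}}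
  | rfaa _ y _ _ => {{.nARR (K.nodeL y), .nRW (K.nodeL y), .nLW (K.nodeL y)}}

/-- Remote read-modify-writes towards node `n`. -/
def IsRmwTo (K : Config Val Loc Tid Node) (n : Node) : RdmaCall Val Loc Node Wid → Prop
  | rcas _ y _ _ _ | rfaa _ y _ _ => K.nodeL y = n
  | _ => False

end RdmaCall

namespace Call

variable {Val Loc Node Wid : Type*}

/-- The locations of a call. -/
def loc : Call Val Loc Node Wid → Set Loc
  | rdma c => c.loc
  | acq x | rel x => {x}

/-- The location of the subevent of a call with a given stamp. -/
def sloc : Call Val Loc Node Wid → Stamp Node → Set Loc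
  | rdma c, a => c.sloc a
  | acq x, _ | rel x, _ => {x}

/-- The work identifier of a call, if any. -/
def wid : Call Val Loc Node Wid → Option Wid
  | rdma c => c.wid
  | _ => none

end Call

/-! ## The RDMA library -/

/-- Values read and written, reads-from, modification order of each location, NIC flush order,
and remote atomic order of each node. -/
structure Witness (Val Loc Tid Node Wid : Type*) where
  vR : SubEvent Tid (Call Val Loc Node Wid) Val Node → Val
  vW : SubEvent Tid (Call Val Loc Node Wid) Val Node → Val
  rf : SubEvent Tid (Call Val Loc Node Wid) Val Node →
    SubEvent Tid (Call Val Loc Node Wid) Val Node → Prop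
  mo : Loc → SubEvent Tid (Call Val Loc Node Wid) Val Node →
    SubEvent Tid (Call Val Loc Node Wid) Val Node → Prop
  nfo : SubEvent Tid (Call Val Loc Node Wid) Val Node →
    SubEvent Tid (Call Val Loc Node Wid) Val Node → Prop
  rao : Node → SubEvent Tid (Call Val Loc Node Wid) Val Node →
    SubEvent Tid (Call Val Loc Node Wid) Val Node → Prop

section Rdma

variable {Val Loc Tid Node Wid : Type*}

/-- Subevents of the combined library. -/
abbrev SEv (Val Loc Tid Node Wid : Type*) := SubEvent Tid (Call Val Loc Node Wid) Val Node

/-- Executions over the combined library. -/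
abbrev Exe (Val Loc Tid Node Wid : Type*) := Exec Tid (Call Val Loc Node Wid) Val Node

/-- The location of a subevent. -/
def SubEvent.loc (s : SEv Val Loc Tid Node Wid) : Set Loc := s.1.call.sloc s.2

/-- Read subevents. -/
def Exec.Reads (G : Exe Val Loc Tid Node Wid) : Set (SEv Val Loc Tid Node Wid) :=
  {s ∈ G.SEvent | s.2.IsRead}

/-- Write subevents. -/
def Exec.Writes (G : Exe Val Loc Tid Node Wid) : Set (SEv Val Loc Tid Node Wid) :=
  {s ∈ G.SEvent | s.2.IsWrite}

/-- Pairs of a NIC local read and a NIC local write, or of a NIC (atomic) remote read and a NIC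
remote write, towards the same node. -/
inductive FlushPair : Stamp Node → Stamp Node → Prop
  | loc (n : Node) : FlushPair (.nLR n) (.nLW n)
  | rem (n : Node) : FlushPair (.nRR n) (.nRW n)
  | atom (n : Node) : FlushPair (.nARR n) (.nRW n)

/-- Pairs of the read stamp and the write stamp through which an operation copies a value. -/
inductive CopyPair : Stamp Node → Stamp Node → Prop
  | put (n : Node) : CopyPair (.nLR n) (.nRW n)
  | get (n : Node) : CopyPair (.nRR n) (.nLW n)
  | rmw (n : Node) : CopyPair (.nARR n) (.nLW n)

/-- Well-formedness of the witnesses for an execution. -/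
structure Witness.WellFormed [Zero Val] [Add Val] (K : Config Val Loc Tid Node)
    (G : Exe Val Loc Tid Node Wid) (W : Witness Val Loc Tid Node Wid) : Prop where
  vR_read : ∀ s ∈ G.Reads, ∀ x, s.1.call = .rdma (.read x) → W.vR s = s.1.out
  vR_cas : ∀ s ∈ G.Reads, ∀ x v₁ v₂, s.1.call = .rdma (.cas x v₁ v₂) → W.vR s = s.1.out
  vW_write : ∀ s ∈ G.Writes, ∀ x v, s.1.call = .rdma (.write x v) → W.vW s = v
  vW_cas : ∀ s ∈ G.Writes, ∀ x v₁ v₂, s.1.call = .rdma (.cas x v₁ v₂) → s.1.out = v₁ →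
    W.vW s = v₂
  copy : ∀ e a b, CopyPair a b → (e, a) ∈ G.SEvent → (e, b) ∈ G.SEvent →
    W.vR (e, a) = W.vW (e, b)
  rf_sub : ∀ s s', W.rf s s' → s ∈ G.Writes ∧ s' ∈ G.Reads
  rf_loc : ∀ s s', W.rf s s' → SubEvent.loc s = SubEvent.loc s'
  rf_val : ∀ s s', W.rf s s' → W.vW s = W.vR s'
  rf_fun : ∀ s₁ s₂ s', W.rf s₁ s' → W.rf s₂ s' → s₁ = s₂
  rf_init : ∀ s' ∈ G.Reads, (¬ ∃ s, W.rf s s') → W.vR s' = 0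
  mo_total : ∀ x, StrictTotalOn {s ∈ G.Writes | SubEvent.loc s = {x}} (W.mo x)
  nfo_sub : ∀ s s', W.nfo s s' → s ∈ G.SEvent ∧ s' ∈ G.SEvent
  nfo_total : ∀ s ∈ G.SEvent, ∀ s' ∈ G.SEvent, FlushPair s.2 s'.2 → s.1.tid = s'.1.tid →
    W.nfo s s' ∨ W.nfo s' s
  rcas_fail : ∀ e ∈ G.E, ∀ x y v₁ v₂ d, e.call = .rdma (.rcas x y v₁ v₂ d) →
    G.stmp e = {.nARR (K.nodeL y), .nLW (K.nodeL y)} → W.vR (e, .nARR (K.nodeL y)) ≠ v₁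
  rcas_succ : ∀ e ∈ G.E, ∀ x y v₁ v₂ d, e.call = .rdma (.rcas x y v₁ v₂ d) →
    G.stmp e = {.nARR (K.nodeL y), .nRW (K.nodeL y), .nLW (K.nodeL y)} →
    W.vR (e, .nARR (K.nodeL y)) = v₁ ∧ W.vW (e, .nRW (K.nodeL y)) = v₂
  rfaa_add : ∀ e ∈ G.E, ∀ x y v d, e.call = .rdma (.rfaa x y v d) →
    W.vW (e, .nRW (K.nodeL y)) = W.vR (e, .nARR (K.nodeL y)) + v
  rao_total : ∀ n, StrictTotalOn
    {s ∈ G.SEvent | s.2 = .nARR n ∧ ∃ c, s.1.call = .rdma c ∧ c.IsRmwTo K n} (W.rao n)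

namespace Witness

variable (W : Witness Val Loc Tid Node Wid) (G : Exe Val Loc Tid Node Wid)
  (s s' : SEv Val Loc Tid Node Wid)

/-- Modification order, over all locations. -/
def moAll : Prop := ∃ x, W.mo x s s'

/-- Remote atomic order, over all nodes. -/
def raoAll : Prop := ∃ n, W.rao n s s'

/-- Reads-before. -/
def rb : Prop :=
  s ∈ G.Reads ∧ s' ∈ G.Writes ∧ ((∃ w, W.rf w s ∧ W.moAll w s') ∨ ¬ ∃ w, W.rf w s) ∧
    SubEvent.loc s = SubEvent.loc s' ∧ s ≠ s'

/-- Internal reads-before. -/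
def rbi : Prop :=
  s.2 = .aCR ∧ s'.2 = .aCW ∧ (G.po s.1 s'.1 ∨ G.po s'.1 s.1) ∧ W.rb G s s'

/-- Internal reads-from. -/
def rfi : Prop := s.2 = .aCW ∧ s'.2 = .aCR ∧ G.po s.1 s'.1 ∧ W.rf s s'

/-- External reads-from. -/
def rfe : Prop := W.rf s s' ∧ ¬ W.rfi G s s'

end Witness

namespace Exec

variable (G : Exe Val Loc Tid Node Wid) (s s' : SEv Val Loc Tid Node Wid)

/-- `s'` is a wait on the work identifier of the (program-order earlier) operation of `s`. -/
def polls : Prop :=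
  s ∈ G.SEvent ∧ s' ∈ G.SEvent ∧ s'.2 = .aWT ∧ G.po s.1 s'.1 ∧
    ∃ d, s.1.call.wid = some d ∧ s'.1.call.wid = some d

/-- From NIC local writes to waits. -/
def pfg : Prop := G.polls s s' ∧ ∃ n, s.2 = .nLW n

/-- From NIC remote writes to waits. -/
def pfp : Prop := G.polls s s' ∧ ∃ n, s.2 = .nRW n

/-- Internal synchronisation order, between subevents of one event. -/
def iso : Prop :=
  s ∈ G.SEvent ∧ s' ∈ G.SEvent ∧ s.1 = s'.1 ∧
    ((∃ x v₁ v₂, s.1.call = .rdma (.cas x v₁ v₂) ∧ s.2 = .aMF ∧ s'.2 = .aCR) ∨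
     (∃ x y d n, s.1.call = .rdma (.get x y d) ∧ s.2 = .nRR n ∧ s'.2 = .nLW n) ∨
     (∃ x y d n, s.1.call = .rdma (.put x y d) ∧ s.2 = .nLR n ∧ s'.2 = .nRW n) ∨
     (((∃ x y v₁ v₂ d, s.1.call = .rdma (.rcas x y v₁ v₂ d)) ∨
        ∃ x y v d, s.1.call = .rdma (.rfaa x y v d)) ∧
       ∃ n, s.2 = .nARR n ∧ (s'.2 = .nLW n ∨ s'.2 = .nRW n)))

/-- The extension of preserved program order to the starts of subevents. -/
def ippo : Prop :=
  G.ppo s s' ∨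
    (s ∈ G.SEvent ∧ s' ∈ G.SEvent ∧ G.po s.1 s'.1 ∧
      ((s.2 = .aCW ∧ (s'.2 = .aCR ∨ s'.2 = .aWT)) ∨
       ∃ n, (s.2 = .nRW n ∨ s.2 = .nLW n) ∧ s'.2 = .nF n))

end Exec

/-- Issued-before. -/
def Witness.ib (W : Witness Val Loc Tid Node Wid) (G : Exe Val Loc Tid Node Wid) :
    SEv Val Loc Tid Node Wid → SEv Val Loc Tid Node Wid → Prop :=
  Relation.TransGen fun s s' =>
    G.ippo s s' ∨ G.iso s s' ∨ W.rf s s' ∨ G.pfg s s' ∨ G.pfp s s' ∨ W.nfo s s' ∨ W.rbi G s s'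

/-- The synchronisation order that the RDMA library exports. -/
def Witness.rdmaSo (W : Witness Val Loc Tid Node Wid) (G : Exe Val Loc Tid Node Wid)
    (s s' : SEv Val Loc Tid Node Wid) : Prop :=
  G.iso s s' ∨ W.rfe G s s' ∨ G.pfg s s' ∨ W.nfo s s' ∨ W.rb G s s' ∨ W.moAll s s' ∨
    W.raoAll s s' ∨ ((∃ n, s.2 = .nRW n) ∧ ∃ r, G.iso r s ∧ W.raoAll r s') ∨
    (s.2.IsInst ∧ W.ib G s s')

/-- Consistency for the RDMA library. -/
def Exec.RdmaConsistent [Zero Val] [Add Val] (K : Config Val Loc Tid Node)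
    (G : Exe Val Loc Tid Node Wid) : Prop :=
  (∀ e ∈ G.E, ∃ c, e.call = .rdma c ∧ c.WellAddressed K e.tid ∧ c.WellTyped K e.out ∧
    G.stmp e ∈ c.stamps K e.out) ∧
  ∃ W : Witness Val Loc Tid Node Wid, W.WellFormed K G ∧ (∀ s, ¬ W.ib G s s) ∧
    ∀ s s', G.so s s' ↔ W.rdmaSo G s s'

/-- The RDMA library with remote read-modify-writes. -/
def rdmaLib [Zero Val] [Add Val] (K : Config Val Loc Tid Node) :
    Library Tid (Call Val Loc Node Wid) Val Node Loc where
  M := Set.range Call.rdma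
  loc := Call.loc
  C := {G | G.RdmaConsistent K}

end Rdma

/-! ## The node lock library -/

section NLock

variable {Val Loc Tid Node Wid : Type*}

/-- The events on location `x`. -/
def Exec.EvAt (G : Exe Val Loc Tid Node Wid) (x : Loc) :
    Set (Event Tid (Call Val Loc Node Wid) Val) :=
  {e ∈ G.E | x ∈ e.call.loc}

/-- Immediate program order on the events on location `x`. -/
def Exec.immPoAt (G : Exe Val Loc Tid Node Wid) (x : Loc) :
    Event Tid (Call Val Loc Node Wid) Val → Event Tid (Call Val Loc Node Wid) Val → Prop :=
  immEdge (relOn (G.EvAt x) G.po)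

/-- Each acquire is immediately followed by a release of the same lock, and each release is
immediately preceded by an acquire of the same lock, among the events on that lock. -/
def Exec.LockWellFormed (G : Exe Val Loc Tid Node Wid) : Prop :=
  ∀ x, (∀ a ∈ G.EvAt x, a.call = .acq x → ∃ r ∈ G.EvAt x, r.call = .rel x ∧ G.immPoAt x a r) ∧
    ∀ r ∈ G.EvAt x, r.call = .rel x → ∃ a ∈ G.EvAt x, a.call = .acq x ∧ G.immPoAt x a r

/-- Stamps of node lock calls. -/
def stmpNL (K : Config Val Loc Tid Node) : Call Val Loc Node Wid → Set (Stamp Node)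
  | .acq _ => {.aMF}
  | .rel x => {.nF (K.nodeL x), .nRW (K.nodeL x)}
  | .rdma _ => ∅

/-- Consistency for the node lock library: no guarantee is given for an execution that is not
lock-well-formed. -/
def Exec.NLockConsistent (K : Config Val Loc Tid Node) (G : Exe Val Loc Tid Node Wid) : Prop :=
  G.LockWellFormed →
    (∀ e ∈ G.E, e.out = K.unit ∧ G.stmp e = stmpNL K e.call) ∧
    ∃ lo : Loc → Event Tid (Call Val Loc Node Wid) Val →
        Event Tid (Call Val Loc Node Wid) Val → Prop,
      (∀ x, StrictTotalOn {e ∈ G.EvAt x | e.call = .acq x} (lo x)) ∧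
      ∀ s s', G.so s s' ↔
        (∃ e ∈ G.E, ∃ x, e.call = .rel x ∧ s = (e, .nF (K.nodeL x)) ∧ s' = (e, .nRW (K.nodeL x)))
        ∨ ∃ x e₁ e₂, s = (e₁, .nRW (K.nodeL x)) ∧ s' = (e₂, .aMF) ∧
            ∃ e₀, G.immPoAt x e₀ e₁ ∧ lo x e₀ e₂

/-- The node lock library, for the set `Lk` of node locks. -/
def nlockLib (K : Config Val Loc Tid Node) (Lk : Set Loc) :
    Library Tid (Call Val Loc Node Wid) Val Node Loc where
  M := {c | ∃ x ∈ Lk, c = .acq x ∨ c = .rel x}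
  loc := Call.loc
  C := {G | G.NLockConsistent K}

/-- The locations created for each node lock: the ticket dispenser, the release counter, and a
temporary location for each thread. -/
inductive Cell (Tid : Type*)
  | ticket
  | release
  | temp (t : Tid)

/-- The names used by the node lock implementation: its locations and its work identifiers. -/
structure NLockLayout (Loc Tid Wid : Type*) where
  cell : Loc → Cell Tid → Loc
  wid : Tid → Loc → Wid
  putWid : Tid → Loc → Wid

/-- The locations created for the locks in `Lk` are pairwise distinct; dispenser and counter are
on the node of the lock, temporaries on the node of their thread. -/
structure NLockLayout.Valid (K : Config Val Loc Tid Node) (Lk : Set Loc)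
    (A : NLockLayout Loc Tid Wid) : Prop where
  distinct : ∀ x ∈ Lk, ∀ y ∈ Lk, ∀ c c', A.cell x c = A.cell y c' → x = y ∧ c = c'
  ticket_node : ∀ x ∈ Lk, K.nodeL (A.cell x .ticket) = K.nodeL x
  release_node : ∀ x ∈ Lk, K.nodeL (A.cell x .release) = K.nodeL x
  temp_node : ∀ x ∈ Lk, ∀ t, K.nodeL (A.cell x (.temp t)) = K.nodeT t

open Classical in
/-- Acquire: fetch a ticket, poll the release counter until it equals the ticket, and store the
next ticket in the temporary location. -/
noncomputable def nlockAcq [One Val] [Add Val] (K : Config Val Loc Tid Node)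
    (A : NLockLayout Loc Tid Wid) (t : Tid) (x : Loc) : SeqProg (Call Val Loc Node Wid) Val :=
  .seq (.call (.rdma (.rfaa (A.cell x (.temp t)) (A.cell x .ticket) 1 (A.wid t x)))) <|
  .seq (.call (.rdma (.wait (A.wid t x)))) <|
  .bind (.call (.rdma (.read (A.cell x (.temp t))))) fun v =>
  .seq
    (.loop <|
      .seq (.call (.rdma (.get (A.cell x (.temp t)) (A.cell x .release) (A.wid t x)))) <|
      .seq (.call (.rdma (.wait (A.wid t x)))) <|
      .bind (.call (.rdma (.read (A.cell x (.temp t))))) fun u =>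
      if u = v then .brk 1 K.unit else .val K.unit) <|
  .call (.rdma (.write (A.cell x (.temp t)) (v + 1)))

/-- Release: remote fence, then put the next ticket into the release counter. -/
def nlockRel (K : Config Val Loc Tid Node) (A : NLockLayout Loc Tid Wid) (t : Tid) (x : Loc) :
    SeqProg (Call Val Loc Node Wid) Val :=
  .seq (.call (.rdma (.rfence (K.nodeL x)))) <|
  .call (.rdma (.put (A.cell x .release) (A.cell x (.temp t)) (A.putWid t x)))

/-- The centralised ticket-lock implementation of node locks. -/
noncomputable def nlockImpl [One Val] [Add Val] (K : Config Val Loc Tid Node)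
    (A : NLockLayout Loc Tid Wid) : Implementation Tid (Call Val Loc Node Wid) Val
  | t, .acq x => nlockAcq K A t x
  | t, .rel x => nlockRel K A t x
  | _, .rdma c => .call (.rdma c)

end NLock

/-! Take an RDMA-consistent execution of the inlined program. Each thread runs a concatenation of
blocks: a client event, a complete acquire run or a complete release run (`exists_blocks`).
Collapsing every block to one event gives an unfolding of the client with the same outputs. It
remains to equip it with `so` and `hb` and to prove consistency.

Happens-before is pulled back from the concrete execution: s precedes s' if the exit of s happens
before the entry of s'. An acquire is entered at the remote read of its successful `get` and left at
the CPU read that finds its ticket; a release is represented by its fence and by the remote write of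
its `put`. The entry of a subevent equals or precedes its exit, so the pulled-back relation is a
strict partial order, and these points are chosen so that it contains preserved program order
(`client_isExecution`).

For the RDMA part, the client never touches the cells of the implementation, so client reads see
only client writes. The witness can therefore be restricted, and every synchronisation edge it then
yields is already an edge of the concrete execution (`Exec.IsPart`).

For the lock part, the lock order is the remote atomic order of the fetch-and-adds. Atomicity makes
each of them read what its immediate predecessor wrote, so in this order the tickets are 0, 1, 2,
... (`exists_ticket_number`). Each temporary location serves a single thread, whose waits order its
accesses; hence the values move as intended through it: a run's ticket is what its fetch-and-add and
its successful `get` read, and the release paired with it stores the ticket plus one (`vR_faa`,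
`vR_get`, `vW_put`).

The key step is `put_hb_get`: a release happens before the successful poll of every later ticket
holder. That poll reads a nonzero n from the counter, hence from the release of holder n-1. Either
this is the release in question, or induction applies to holder n-1, whose poll precedes its own
release. Distinctness of the iterated successors of 0 is what lets values identify holders. -/

/-! ### Plain executions given by lists of events -/

namespace Plain

variable {Tid Call Val : Type*}

/-- The plain execution whose program order is the order of a list. -/
def ofList (l : List (Event Tid Call Val)) : Plain Tid Call Val :=
  ⟨{e | e ∈ l}, fun a b => [a, b].Sublist l⟩

theorem ofList_nil : (ofList [] : Plain Tid Call Val) = empty := by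
  simp [ofList, empty]

theorem ofList_singleton (e : Event Tid Call Val) : ofList [e] = single e := by
  simp only [ofList, single, Plain.mk.injEq]
  refine ⟨by ext; simp, ?_⟩
  funext a b
  refine propext ⟨fun h => ?_, False.elim⟩
  have := h.length_le
  simp at this

theorem pair_sublist_append {α : Type*} {a b : α} {l l' : List α} :
    [a, b].Sublist (l ++ l') ↔ [a, b].Sublist l ∨ [a, b].Sublist l' ∨ a ∈ l ∧ b ∈ l' := by
  constructor
  · intro h
    obtain ⟨l₁, l₂, h₁, h₂, h₃⟩ := List.sublist_append_iff.1 h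
    rcases l₁ with _ | ⟨c, _ | ⟨d, l₁⟩⟩
    · right; left; simpa using h₁ ▸ h₃
    · right; right
      simp only [List.singleton_append, List.cons.injEq] at h₁
      obtain ⟨rfl, rfl⟩ := h₁
      exact ⟨by simpa using h₂, by simpa using h₃⟩
    · left
      simp only [List.cons_append, List.cons.injEq] at h₁
      obtain ⟨rfl, rfl, h₁⟩ := h₁
      simp only [List.nil_eq, List.append_eq_nil_iff] at h₁
      simpa [h₁.1] using h₂
  · rintro (h | h | ⟨h, h'⟩)
    · exact h.trans (List.sublist_append_left _ _)
    · exact h.trans (List.sublist_append_right _ _)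
    · exact (List.singleton_sublist.2 h).append (List.singleton_sublist.2 h')

theorem ofList_append (l l' : List (Event Tid Call Val)) :
    ofList (l ++ l') = (ofList l).seq (ofList l') := by
  simp only [ofList, seq, Plain.mk.injEq]
  refine ⟨by ext; simp, ?_⟩
  funext a b
  exact propext pair_sublist_append

theorem ofList_cons (e : Event Tid Call Val) (l : List (Event Tid Call Val)) :
    ofList (e :: l) = (single e).seq (ofList l) := by
  rw [← ofList_singleton, ← ofList_append]; rfl

theorem mem_ofList {e : Event Tid Call Val} {l : List (Event Tid Call Val)} :
    e ∈ (ofList l).E ↔ e ∈ l := Iff.rfl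

end Plain

/-! ### Unfoldings that start with a call -/

section Unfolding

variable {Tid Call Val : Type*} {t : Tid}

open Plain

theorem Unfolds.call_inv {c : Call} {r : Val × ℕ} {G : Plain Tid Call Val}
    (h : Unfolds t (.call c) r G) : ∃ i w, r = (w, 0) ∧ G = ofList [⟨t, i, c, w⟩] := by
  cases h with
  | call c i w => exact ⟨i, w, rfl, (ofList_singleton _).symm⟩

theorem Unfolds.bind_call_inv {c : Call} {f : Val → SeqProg Call Val} {r : Val × ℕ}
    {G : Plain Tid Call Val} (h : Unfolds t (.bind (.call c) f) r G) :
    ∃ i w H, Unfolds t (f w) r H ∧ G = (single ⟨t, i, c, w⟩).seq H := by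
  cases h with
  | bind _ _ v r G H h₁ h₂ h₃ =>
    cases h₁ with
    | call c i w => exact ⟨i, _, H, h₂, rfl⟩
  | bindBrk _ _ v k G h₁ hk =>
    cases h₁ with
    | call c i w => exact absurd rfl hk

theorem Unfolds.bind_call {c : Call} {f : Val → SeqProg Call Val} {r : Val × ℕ} {w : Val} {i : ℕ}
    {l : List (Event Tid Call Val)} (h : Unfolds t (f w) r (ofList l))
    (hl : (⟨t, i, c, w⟩ : Event Tid Call Val) ∉ l) :
    Unfolds t (.bind (.call c) f) r (ofList (⟨t, i, c, w⟩ :: l)) := by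
  rw [ofList_cons]
  refine .bind _ _ w _ _ _ (.call c i w) h ?_
  rw [Set.disjoint_left]
  rintro e he he'
  obtain rfl : e = _ := he
  exact hl he'

end Unfolding

/-! ### Blocks: runs of lock operations inside an inlined thread -/

section Blocks

variable {Val Loc Tid Node Wid : Type*}

/-- Events of the combined library. -/
abbrev Ev (Val Loc Tid Node Wid : Type*) := Event Tid (Call Val Loc Node Wid) Val

/-- The data of a run of the acquire program: thread, lock, ticket, identifiers, and the events of
the unsuccessful iterations of the polling loop. -/
structure AcqRun (Val Loc Tid Node Wid : Type*) where
  tid : Tid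
  lock : Loc
  ticket : Val
  iFaa : ℕ
  iWait : ℕ
  iRead : ℕ
  polling : List (Ev Val Loc Tid Node Wid)
  iGet : ℕ
  iWait' : ℕ
  iRead' : ℕ
  iWrite : ℕ

/-- The data of a run of the release program. -/
structure RelRun (Loc Tid : Type*) where
  tid : Tid
  lock : Loc
  iFence : ℕ
  iPut : ℕ

/-- A piece of an inlined execution: an event of the client, or a run of a lock operation. -/
inductive Block (Val Loc Tid Node Wid : Type*)
  | client (e : Ev Val Loc Tid Node Wid)
  | acq (d : AcqRun Val Loc Tid Node Wid)
  | rel (d : RelRun Loc Tid)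

variable (K : Config Val Loc Tid Node) (A : NLockLayout Loc Tid Wid)

namespace AcqRun

variable (d : AcqRun Val Loc Tid Node Wid)

/-- The temporary location of the run. -/
abbrev temp : Loc := A.cell d.lock (.temp d.tid)

/-- The event that fetches the ticket. -/
def faa [One Val] : Ev Val Loc Tid Node Wid :=
  ⟨d.tid, d.iFaa, .rdma (.rfaa (d.temp A) (A.cell d.lock .ticket) 1 (A.wid d.tid d.lock)), K.unit⟩

/-- The wait for the ticket. -/
def wait : Ev Val Loc Tid Node Wid := ⟨d.tid, d.iWait, .rdma (.wait (A.wid d.tid d.lock)), K.unit⟩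

/-- The read of the ticket. -/
def read : Ev Val Loc Tid Node Wid := ⟨d.tid, d.iRead, .rdma (.read (d.temp A)), d.ticket⟩

/-- The successful fetch of the release counter. -/
def get : Ev Val Loc Tid Node Wid :=
  ⟨d.tid, d.iGet, .rdma (.get (d.temp A) (A.cell d.lock .release) (A.wid d.tid d.lock)), K.unit⟩

/-- The wait for the successful fetch. -/
def wait' : Ev Val Loc Tid Node Wid := ⟨d.tid, d.iWait', .rdma (.wait (A.wid d.tid d.lock)), K.unit⟩

/-- The read of the result of the successful fetch. -/
def read' : Ev Val Loc Tid Node Wid := ⟨d.tid, d.iRead', .rdma (.read (d.temp A)), d.ticket⟩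

/-- The write of the next ticket. -/
def write [One Val] [Add Val] : Ev Val Loc Tid Node Wid :=
  ⟨d.tid, d.iWrite, .rdma (.write (d.temp A) (d.ticket + 1)), K.unit⟩

/-- All events of the run in program order. -/
def events [One Val] [Add Val] : List (Ev Val Loc Tid Node Wid) :=
  [d.faa K A, d.wait K A, d.read A] ++
    (d.polling ++ [d.get K A, d.wait' K A, d.read' A, d.write K A])

/-- The form of the events of the unsuccessful iterations of the loop. -/
def IsPoll (t : Tid) (x : Loc) (e : Ev Val Loc Tid Node Wid) : Prop :=
  e.tid = t ∧ (e.call = .rdma (.get (A.cell x (.temp t)) (A.cell x .release) (A.wid t x)) ∨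
    e.call = .rdma (.wait (A.wid t x)) ∨ e.call = .rdma (.read (A.cell x (.temp t))))

end AcqRun

namespace RelRun

variable (d : RelRun Loc Tid)

/-- The remote fence. -/
def fence : Ev Val Loc Tid Node Wid := ⟨d.tid, d.iFence, .rdma (.rfence (K.nodeL d.lock)), K.unit⟩

/-- The update of the release counter. -/
def put : Ev Val Loc Tid Node Wid :=
  ⟨d.tid, d.iPut, .rdma (.put (A.cell d.lock .release) (A.cell d.lock (.temp d.tid))
    (A.putWid d.tid d.lock)), K.unit⟩

end RelRun

namespace Block

/-- The event of the client execution that the block implements. -/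
def abs : Block Val Loc Tid Node Wid → Ev Val Loc Tid Node Wid
  | client e => e
  | acq d => ⟨d.tid, d.iFaa, .acq d.lock, K.unit⟩
  | rel d => ⟨d.tid, d.iPut, .rel d.lock, K.unit⟩

/-- The events of a block in program order. -/
def conc [One Val] [Add Val] : Block Val Loc Tid Node Wid → List (Ev Val Loc Tid Node Wid)
  | client e => [e]
  | acq d => d.events K A
  | rel d => [d.fence K, d.put K A]

/-- Well-formedness of a block of thread `t`, for the set `Lk` of locks. -/
def Ok (Lk : Set Loc) (t : Tid) : Block Val Loc Tid Node Wid → Prop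
  | client e => e.tid = t ∧ ∃ c, e.call = .rdma c
  | acq d => d.tid = t ∧ d.lock ∈ Lk ∧ ∀ e ∈ d.polling, AcqRun.IsPoll A t d.lock e
  | rel d => d.tid = t ∧ d.lock ∈ Lk

end Block

/-- An event of the implementation that identifies the client event it belongs to. -/
def Event.rep [One Val] (e : Ev Val Loc Tid Node Wid) : Ev Val Loc Tid Node Wid :=
  match e.call with
  | .rdma _ => e
  | .acq x => ⟨e.tid, e.ident,
      .rdma (.rfaa (A.cell x (.temp e.tid)) (A.cell x .ticket) 1 (A.wid e.tid x)), K.unit⟩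
  | .rel x => ⟨e.tid, e.ident,
      .rdma (.put (A.cell x .release) (A.cell x (.temp e.tid)) (A.putWid e.tid x)), K.unit⟩

variable {K A}

/-- The client event inherits its identifier from the `rfaa` or the `put` of its block, so this
concrete event can be recovered from the client event alone. Distinctness of client events thus
reduces to disjointness of blocks. -/
theorem Block.rep_abs_mem [One Val] [Add Val] {Lk : Set Loc} {t : Tid}
    {b : Block Val Loc Tid Node Wid} (hb : b.Ok A Lk t) : (b.abs K).rep K A ∈ b.conc K A := by
  cases b with
  | client e =>
    obtain ⟨-, c, hc⟩ := hb
    simp [Block.abs, Block.conc, Event.rep, hc]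
  | acq d => simp [Block.abs, Block.conc, Event.rep, AcqRun.events, AcqRun.faa]
  | rel d => simp [Block.abs, Block.conc, Event.rep, RelRun.put]

theorem Block.tid_of_mem [One Val] [Add Val] {Lk : Set Loc} {t : Tid}
    {b : Block Val Loc Tid Node Wid} (hb : b.Ok A Lk t) {e : Ev Val Loc Tid Node Wid}
    (he : e ∈ b.conc K A) : e.tid = t := by
  cases b with
  | client e' =>
    obtain rfl : e = e' := by simpa [Block.conc] using he
    exact hb.1
  | acq d =>
    obtain ⟨rfl, -, hp⟩ := hb
    simp only [conc, AcqRun.events, List.cons_append, List.nil_append, List.mem_cons,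
      List.mem_append, List.not_mem_nil, or_false] at he
    rcases he with rfl | rfl | rfl | h | rfl | rfl | rfl | rfl
    any_goals rfl
    exact (hp _ h).1
  | rel d =>
    obtain ⟨rfl, -⟩ := hb
    simp only [conc, List.mem_cons, List.not_mem_nil, or_false] at he
    rcases he with rfl | rfl <;> rfl

theorem Block.abs_tid {Lk : Set Loc} {t : Tid}
    {b : Block Val Loc Tid Node Wid} (hb : b.Ok A Lk t) : (b.abs K).tid = t := by
  cases b with
  | client e' => exact hb.1
  | acq d => exact hb.1
  | rel d => exact hb.1

open Plain in
-- Induction on the unfolding needs a variable program `p`, tied to the loop by `hp`; the comparison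
-- with the ticket is abstracted to `f`. Failed passes accumulate in `l`, and the only exit is
-- `break` from level 1, which the loop turns into break number 0.
theorem unfolds_poll [One Val] [Add Val] {t : Tid} {x : Loc} {v : Val} {p} {r : Val × ℕ}
    {G : Plain Tid (Call Val Loc Node Wid) Val} (h : Unfolds t p r G)
    (f : Val → SeqProg (Call Val Loc Node Wid) Val)
    (hf : ∀ u, u = v ∧ f u = .brk 1 K.unit ∨ u ≠ v ∧ f u = .val K.unit)
    (hp : p = .loop (.seq
      (.call (.rdma (.get (A.cell x (.temp t)) (A.cell x .release) (A.wid t x)))) <|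
      .seq (.call (.rdma (.wait (A.wid t x)))) <|
      .bind (.call (.rdma (.read (A.cell x (.temp t))))) f)) :
    r.2 = 0 ∧ ∃ l i o j o' k, (∀ e ∈ l, AcqRun.IsPoll A t x e) ∧ G = ofList (l ++
      [⟨t, i, .rdma (.get (A.cell x (.temp t)) (A.cell x .release) (A.wid t x)), o⟩,
       ⟨t, j, .rdma (.wait (A.wid t x)), o'⟩, ⟨t, k, .rdma (.read (A.cell x (.temp t))), v⟩]) := by
  -- One pass through the body: it breaks exactly when the value read is `v`.
  have body : ∀ {w n G}, Unfolds t (.seq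
      (.call (.rdma (.get (A.cell x (.temp t)) (A.cell x .release) (A.wid t x)))) <|
      .seq (.call (.rdma (.wait (A.wid t x)))) <|
      .bind (.call (.rdma (.read (A.cell x (.temp t))))) f) (w, n) G →
      ∃ i o j o' k u, (u = v ∧ n = 1 ∨ u ≠ v ∧ n = 0) ∧ G = ofList 
        [⟨t, i, .rdma (.get (A.cell x (.temp t)) (A.cell x .release) (A.wid t x)), o⟩,
         ⟨t, j, .rdma (.wait (A.wid t x)), o'⟩,
         ⟨t, k, .rdma (.read (A.cell x (.temp t))), u⟩] := by
    intro w n G h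
    obtain ⟨i, o, G₁, h₁, rfl⟩ := h.bind_call_inv
    obtain ⟨j, o', G₂, h₂, rfl⟩ := h₁.bind_call_inv
    obtain ⟨k, u, G₃, h₃, rfl⟩ := h₂.bind_call_inv
    refine ⟨i, o, j, o', k, u, ?_⟩
    rcases hf u with ⟨hu, e⟩ | ⟨hu, e⟩
    · rw [e] at h₃
      cases h₃
      exact ⟨.inl ⟨hu, rfl⟩, by simp [ofList_cons, ofList_nil]⟩
    · rw [e] at h₃
      cases h₃
      exact ⟨.inr ⟨hu, rfl⟩, by simp [ofList_cons, ofList_nil]⟩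
  induction h with
  | loopExit q v' n G h ih =>
    obtain rfl := SeqProg.loop.inj hp
    obtain ⟨i, o, j, o', k, u, hu | hu, rfl⟩ := body h
    · obtain ⟨rfl, hn⟩ := hu
      exact ⟨by simpa using hn, [], i, o, j, o', k, by simp, rfl⟩
    · omega
  | loopNext q v' r G H h h' hd ih ih' =>
    obtain ⟨hr, l, i, o, j, o', k, hl, rfl⟩ := ih' hp
    obtain rfl := SeqProg.loop.inj hp
    obtain ⟨i₁, o₁, j₁, o₁', k₁, u, -, rfl⟩ := body h
    refine ⟨hr, _, i, o, j, o', k, ?_, by rw [← ofList_append, ← List.append_assoc]⟩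
    intro e he
    simp only [List.cons_append, List.nil_append, List.mem_cons] at he
    rcases he with rfl | rfl | rfl | he
    · exact ⟨rfl, .inl rfl⟩
    · exact ⟨rfl, .inr (.inl rfl)⟩
    · exact ⟨rfl, .inr (.inr rfl)⟩
    · exact hl e he
  | _ => cases hp

open Plain in
theorem unfolds_nlockAcq [One Val] [Add Val] {t : Tid} {x : Loc} {r : Val × ℕ}
    {G : Plain Tid (Call Val Loc Node Wid) Val} (h : Unfolds t (nlockAcq K A t x) r G) :
    r.2 = 0 ∧ ∃ v i₁ o₁ i₂ o₂ i₃ l i₄ o₄ i₅ o₅ i₆ i₇, (∀ e ∈ l, AcqRun.IsPoll A t x e) ∧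
      G = ofList ([⟨t, i₁, .rdma (.rfaa (A.cell x (.temp t)) (A.cell x .ticket) 1 (A.wid t x)), o₁⟩,
        ⟨t, i₂, .rdma (.wait (A.wid t x)), o₂⟩, ⟨t, i₃, .rdma (.read (A.cell x (.temp t))), v⟩] ++
        (l ++
        [⟨t, i₄, .rdma (.get (A.cell x (.temp t)) (A.cell x .release) (A.wid t x)), o₄⟩,
        ⟨t, i₅, .rdma (.wait (A.wid t x)), o₅⟩, ⟨t, i₆, .rdma (.read (A.cell x (.temp t))), v⟩,
        ⟨t, i₇, .rdma (.write (A.cell x (.temp t)) (v + 1)), r.1⟩])) := by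
  unfold nlockAcq at h
  obtain ⟨i₁, o₁, G₁, h₁, rfl⟩ := h.bind_call_inv
  obtain ⟨i₂, o₂, G₂, h₂, rfl⟩ := h₁.bind_call_inv
  obtain ⟨i₃, v, G₃, h₃, rfl⟩ := h₂.bind_call_inv
  have key {r G} (h : Unfolds t _ r G) := unfolds_poll (K := K) (A := A) (t := t) (x := x) (v := v) h
    (fun u => open Classical in if u = v then .brk 1 K.unit else .val K.unit)
    (by intro u; by_cases hu : u = v <;> simp [hu]) rfl
  cases h₃ with
  | bind _ _ v' r G H h₄ h₅ h₆ =>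
    obtain ⟨-, l, i₄, o₄, i₅, o₅, i₆, hl, rfl⟩ := key h₄
    obtain ⟨i₇, o₇, rfl, rfl⟩ := h₅.call_inv
    refine ⟨rfl, v, i₁, o₁, i₂, o₂, i₃, l, i₄, o₄, i₅, o₅, i₆, i₇, hl, ?_⟩
    rw [← ofList_append]
    simp only [List.append_assoc, List.cons_append, List.nil_append, ofList_cons]
  | bindBrk _ _ v' k G h₄ hk =>
    exact absurd (key h₄).1 hk

open Plain in
theorem unfolds_nlockRel {t : Tid} {x : Loc} {r : Val × ℕ}
    {G : Plain Tid (Call Val Loc Node Wid) Val} (h : Unfolds t (nlockRel K A t x) r G) :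
    r.2 = 0 ∧ ∃ i₁ o₁ i₂, G = ofList [⟨t, i₁, .rdma (.rfence (K.nodeL x)), o₁⟩,
      ⟨t, i₂, .rdma (.put (A.cell x .release) (A.cell x (.temp t)) (A.putWid t x)), r.1⟩] := by
  obtain ⟨i₁, o₁, G₁, h₁, rfl⟩ := h.bind_call_inv
  obtain ⟨i₂, o₂, rfl, rfl⟩ := h₁.call_inv
  exact ⟨rfl, i₁, o₁, i₂, by simp only [ofList_cons]⟩

open Plain in
/-- An unfolding of an inlined program is a sequence of blocks, and the events that these blocks
implement form an unfolding of the original program. -/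
theorem exists_blocks [Zero Val] [One Val] [Add Val] {Lk : Set Loc} {t : Tid}
    {p : SeqProg (Call Val Loc Node Wid) Val} {r : Val × ℕ}
    {G : Plain Tid (Call Val Loc Node Wid) Val}
    (h : Unfolds t (p.inline (nlockLib K Lk).M (nlockImpl K A t)) r G)
    (hG : ∀ e ∈ G.E, ∃ c, e.call = .rdma c ∧ c.WellTyped K e.out) :
    ∃ l : List (Block Val Loc Tid Node Wid), G = ofList (l.flatMap (Block.conc K A)) ∧
      Unfolds t p r (ofList (l.map (Block.abs K))) ∧ ∀ b ∈ l, b.Ok A Lk t := by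
  -- Two lists of blocks sharing a client event would share its representative among the concrete
  -- events.
  have disj : ∀ {l l' : List (Block Val Loc Tid Node Wid)}, (∀ b ∈ l, b.Ok A Lk t) →
      (∀ b ∈ l', b.Ok A Lk t) → Disjoint (ofList (l.flatMap (Block.conc K A))).E
        (ofList (l'.flatMap (Block.conc K A))).E →
      Disjoint (ofList (l.map (Block.abs K))).E (ofList (l'.map (Block.abs K))).E := by
    intro l l' hl hl' hd
    rw [Set.disjoint_left] at hd ⊢
    intro e he he'
    obtain ⟨b, hb, rfl⟩ := List.mem_map.1 he
    obtain ⟨b', hb', e⟩ := List.mem_map.1 he'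
    refine hd (List.mem_flatMap.2 ⟨b, hb, Block.rep_abs_mem (hl b hb)⟩)
      (List.mem_flatMap.2 ⟨b', hb', ?_⟩)
    rw [← e]
    exact Block.rep_abs_mem (hl' b' hb')
  induction p generalizing r G with
  | val v => cases h; exact ⟨[], ofList_nil.symm, by simpa [ofList_nil] using .val v, by simp⟩
  | brk k v => cases h; exact ⟨[], ofList_nil.symm, by simpa [ofList_nil] using .brk k v, by simp⟩
  | call c =>
    by_cases hc : c ∈ (nlockLib (Tid := Tid) (Wid := Wid) K Lk).M
    · rw [SeqProg.inline, if_pos hc] at h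
      obtain ⟨x, hx, rfl | rfl⟩ := hc
      · obtain ⟨hr, v, i₁, o₁, i₂, o₂, i₃, l, i₄, o₄, i₅, o₅, i₆, i₇, hl, rfl⟩ :=
          unfolds_nlockAcq (K := K) h
        obtain ⟨w, k⟩ := r
        obtain rfl : k = 0 := hr
        simp only [mem_ofList, List.cons_append, List.nil_append, List.mem_cons,
          List.mem_append, forall_eq_or_imp, Call.rdma.injEq, ↓existsAndEq, true_and,
          RdmaCall.WellTyped] at hG
        obtain ⟨rfl, rfl, hG⟩ := hG
        -- The plain semantics allows arbitrary outputs; well-typedness in `hG` forces `()` for the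
        -- calls without a result.
        have hu : o₄ = K.unit ∧ o₅ = K.unit ∧ w = K.unit := by
          refine ⟨?_, ?_, ?_⟩
          · have := hG _ (.inr (.inl rfl))
            simpa [RdmaCall.WellTyped] using this
          · have := hG _ (.inr (.inr (.inl rfl)))
            simpa [RdmaCall.WellTyped] using this
          · have := hG _ (.inr (.inr (.inr (.inr (.inl rfl)))))
            simpa [RdmaCall.WellTyped] using this
        obtain ⟨rfl, rfl, rfl⟩ := hu
        refine ⟨[.acq ⟨t, x, v, i₁, i₂, i₃, l, i₄, i₅, i₆, i₇⟩], ?_, ?_, ?_⟩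
        · simp only [List.flatMap_cons, List.flatMap_nil, List.append_nil]
          rfl
        · simpa [Block.abs, ofList_singleton] using Unfolds.call _ _ _
        · simpa [Block.Ok] using ⟨hx, hl⟩
      · obtain ⟨hr, i₁, o₁, i₂, rfl⟩ := unfolds_nlockRel (K := K) h
        obtain ⟨w, k⟩ := r
        obtain rfl : k = 0 := hr
        have h₁ := hG _ (mem_ofList.2 (List.mem_cons_self))
        have h₂ := hG _ (mem_ofList.2 (List.mem_cons_of_mem _ List.mem_cons_self))
        obtain rfl : o₁ = K.unit := by simpa [RdmaCall.WellTyped] using h₁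
        obtain rfl : w = K.unit := by simpa [RdmaCall.WellTyped] using h₂
        refine ⟨[.rel ⟨t, x, i₁, i₂⟩], ?_, ?_, ?_⟩
        · simp only [List.flatMap_cons, List.flatMap_nil, List.append_nil]
          rfl
        · simpa [Block.abs, ofList_singleton] using Unfolds.call _ _ _
        · simpa [Block.Ok] using hx
    · rw [SeqProg.inline, if_neg hc] at h
      cases h with
      | call _ i w =>
        obtain ⟨c', hc', -⟩ := hG ⟨t, i, c, w⟩ rfl
        refine ⟨[.client ⟨t, i, c, w⟩], ?_, ?_, ?_⟩
        · simp [Block.conc, ofList_singleton]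
        · simpa [Block.abs, ofList_singleton] using Unfolds.call _ _ _
        · simpa [Block.Ok] using ⟨c', hc'⟩
  | bind p f ihp ihf =>
    cases h with
    | bind _ _ v r G H h₁ h₂ h₃ =>
      obtain ⟨l, rfl, hl, ok⟩ := ihp h₁ fun e he => hG e (.inl he)
      obtain ⟨l', rfl, hl', ok'⟩ := ihf v h₂ fun e he => hG e (.inr he)
      refine ⟨l ++ l', ?_, ?_, ?_⟩
      · rw [List.flatMap_append, ofList_append]
      · rw [List.map_append, ofList_append]
        exact .bind _ _ v _ _ _ hl hl' (disj ok ok' h₃)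
      · simpa [or_imp, forall_and] using ⟨ok, ok'⟩
    | bindBrk _ _ v k G h₁ hk =>
      obtain ⟨l, rfl, hl, ok⟩ := ihp h₁ hG
      exact ⟨l, rfl, .bindBrk _ _ v k _ hl hk, ok⟩
  | loop p ih =>
    rw [SeqProg.inline] at h
    -- The inner induction runs over the iterations of the loop; `ih` treats a single body.
    generalize hq : SeqProg.loop _ = q at h
    induction h with
    | loopExit q v k G h _ =>
      obtain rfl := SeqProg.loop.inj hq
      obtain ⟨l, rfl, hl, ok⟩ := ih h hG
      exact ⟨l, rfl, .loopExit _ v k _ hl, ok⟩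
    | loopNext q v r G H h h' hd _ ih' =>
      obtain ⟨l', rfl, hl', ok'⟩ := ih' (fun e he => hG e (.inr he)) hq
      obtain rfl := SeqProg.loop.inj hq
      obtain ⟨l, rfl, hl, ok⟩ := ih h fun e he => hG e (.inl he)
      refine ⟨l ++ l', ?_, ?_, ?_⟩
      · rw [List.flatMap_append, ofList_append]
      · rw [List.map_append, ofList_append]
        exact .loopNext _ v _ _ _ hl hl' (disj ok ok' hd)
      · simpa [or_imp, forall_and] using ⟨ok, ok'⟩
    | _ => cases hq

end Blocks

/-! ### Well-definedness, and the locations used by the implementation -/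

section WellDefined

variable {Val Loc Tid Node Wid : Type*} [Zero Val] [One Val] [Add Val]

theorem nlock_wellDefined (K : Config Val Loc Tid Node) (Lk : Set Loc)
    (A : NLockLayout Loc Tid Wid) :
    WellDefinedImpl (nlockLib K Lk) {rdmaLib K} (nlockImpl K A) where
  not_mem h := by
    have h := congrArg Library.M (Set.mem_singleton_iff.1 h)
    -- A fence is a call of RDMA and not of the lock library, so the libraries differ.
    obtain ⟨x, -, hx⟩ : (Call.rdma .mfence : Call Val Loc Node Wid) ∈
        (nlockLib (Tid := Tid) K Lk).M := by
      rw [h]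
      exact ⟨_, rfl⟩
    simp at hx
  calls t c hc := by
    have mem : ∀ c : RdmaCall Val Loc Node Wid, Call.rdma c ∈
        {c' | ∃ L' ∈ ({rdmaLib K} : Set (Library Tid (Call Val Loc Node Wid) Val Node Loc)),
          c' ∈ L'.M} := fun c => ⟨_, rfl, c, rfl⟩
    obtain ⟨x, -, rfl | rfl⟩ := hc
    · refine ⟨mem _, fun _ => ⟨mem _, fun _ => ⟨mem _, fun v => ⟨⟨mem _, fun _ => ⟨mem _, fun _ =>
        ⟨mem _, fun u => ?_⟩⟩⟩, fun _ => mem _⟩⟩⟩⟩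
      dsimp only
      split_ifs <;> trivial
    · exact ⟨mem _, fun _ => mem _⟩
  no_break t c hc v k G h := by
    obtain ⟨x, -, rfl | rfl⟩ := hc
    · exact absurd (unfolds_nlockAcq (K := K) h).1 (by simp)
    · exact absurd (unfolds_nlockRel (K := K) h).1 (by simp)
  nonempty t c hc v G h := by
    obtain ⟨x, -, rfl | rfl⟩ := hc
    · obtain ⟨-, v, i₁, o₁, i₂, o₂, i₃, l, i₄, o₄, i₅, o₅, i₆, i₇, -, rfl⟩ :=
        unfolds_nlockAcq (K := K) h
      exact ⟨_, List.mem_cons_self⟩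
    · obtain ⟨-, i₁, o₁, i₂, rfl⟩ := unfolds_nlockRel (K := K) h
      exact ⟨_, List.mem_cons_self⟩

open Plain in
theorem cell_mem_implLocs (K : Config Val Loc Tid Node) {Lk : Set Loc}
    (A : NLockLayout Loc Tid Wid) {x : Loc} (hx : x ∈ Lk) (t : Tid) {c : Cell Tid}
    (hc : c = .ticket ∨ c = .release ∨ c = .temp t) :
    A.cell x c ∈ implLocs (nlockLib K Lk) {rdmaLib K} (nlockImpl K A) := by
  have poll : Unfolds t (SeqProg.loop (Call := Call Val Loc Node Wid)
      (.seq (.call (Call.rdma (.get (A.cell x (.temp t)) (A.cell x .release) (A.wid t x)))) <|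
      .seq (.call (Call.rdma (.wait (A.wid t x)))) <|
      .bind (.call (Call.rdma (.read (A.cell x (.temp t))))) fun u =>
      open Classical in if u = (0 : Val) then .brk 1 K.unit else .val K.unit)) (K.unit, 0)
      (ofList [⟨t, 0, Call.rdma (.get (A.cell x (.temp t)) (A.cell x .release) (A.wid t x)), K.unit⟩,
        ⟨t, 1, Call.rdma (.wait (A.wid t x)), K.unit⟩,
        ⟨t, 1, Call.rdma (.read (A.cell x (.temp t))), 0⟩]) := by
    refine .loopExit _ _ _ _ (.bind_call (.bind_call (.bind_call (l := []) ?_ ?_) ?_) ?_)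
    · rw [ofList_nil, if_pos rfl]
      exact .brk 1 _
    all_goals simp
  have last : Unfolds t (SeqProg.call (Call.rdma (.write (A.cell x (.temp t)) (0 + 1)))) (K.unit, 0)
      (ofList [(⟨t, 0, Call.rdma (.write (A.cell x (.temp t)) (0 + 1)), K.unit⟩ :
        Ev Val Loc Tid Node Wid)]) := by
    rw [ofList_singleton]
    exact .call _ _ _
  have hacq : Unfolds t (nlockImpl K A t (.acq x)) (K.unit, 0) (ofList
      [⟨t, 0, Call.rdma (.rfaa (A.cell x (.temp t)) (A.cell x .ticket) 1 (A.wid t x)), K.unit⟩,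
        ⟨t, 0, Call.rdma (.wait (A.wid t x)), K.unit⟩,
        ⟨t, 0, Call.rdma (.read (A.cell x (.temp t))), 0⟩,
        ⟨t, 0, Call.rdma (.get (A.cell x (.temp t)) (A.cell x .release) (A.wid t x)), K.unit⟩,
        ⟨t, 1, Call.rdma (.wait (A.wid t x)), K.unit⟩,
        ⟨t, 1, Call.rdma (.read (A.cell x (.temp t))), 0⟩,
        ⟨t, 0, Call.rdma (.write (A.cell x (.temp t)) (0 + 1)), K.unit⟩]) := by
    refine .bind_call (.bind_call (.bind_call ?_ ?_) ?_) ?_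
    · have := Unfolds.bind _ (fun _ => SeqProg.call (Call.rdma (.write (A.cell x (.temp t)) (0 + 1))))
        _ _ _ _ poll last (by
          rw [Set.disjoint_left]
          intro e he he'
          simp only [mem_ofList, List.mem_cons, List.not_mem_nil, or_false] at he he'
          subst he'
          simp at he)
      rw [← ofList_append] at this
      exact this
    all_goals simp
  refine ⟨t, _, ⟨x, hx, .inl rfl⟩, _, _, hacq, ?_⟩
  rcases hc with rfl | rfl | rfl
  · exact ⟨_, List.mem_cons_self, _, rfl, ⟨_, rfl⟩, .inr rfl⟩
  · exact ⟨_, List.mem_cons_of_mem _ (List.mem_cons_of_mem _ (List.mem_cons_of_mem _ List.mem_cons_self)),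
      _, rfl, ⟨_, rfl⟩, .inr rfl⟩
  · exact ⟨_, List.mem_cons_self, _, rfl, ⟨_, rfl⟩, .inl rfl⟩

end WellDefined

/-! ### Pairs of elements in list order -/

theorem pair_sublist_cons {α : Type*} {a b c : α} {l : List α} :
    [a, b].Sublist (c :: l) ↔ a = c ∧ b ∈ l ∨ [a, b].Sublist l := by
  constructor
  · intro h
    rcases h with _ | ⟨_, h⟩ | ⟨_, h⟩
    · exact .inr h
    · exact .inl ⟨rfl, by simpa using h⟩
  · rintro (⟨rfl, h⟩ | h)
    · exact (List.singleton_sublist.2 h).cons_cons _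
    · exact h.cons _

theorem not_pair_sublist_nil {α : Type*} {a b : α} : ¬ [a, b].Sublist ([] : List α) := by
  intro h
  simpa using h.length_le

theorem pair_sublist_trichotomy {α : Type*} {a b : α} {l : List α} (ha : a ∈ l) (hb : b ∈ l) :
    a = b ∨ [a, b].Sublist l ∨ [b, a].Sublist l := by
  induction l with
  | nil => simp at ha
  | cons c l ih =>
    simp only [pair_sublist_cons]
    rcases List.mem_cons.1 ha with rfl | ha' <;> rcases List.mem_cons.1 hb with rfl | hb'
    · exact .inl rfl
    · exact .inr (.inl (.inl ⟨rfl, hb'⟩))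
    · exact .inr (.inr (.inl ⟨rfl, ha'⟩))
    · rcases ih ha' hb' with h | h | h
      · exact .inl h
      · exact .inr (.inl (.inr h))
      · exact .inr (.inr (.inr h))

theorem pair_sublist_flatMap {α β : Type*} {f : α → List β} {l : List α} {a b : α}
    (h : [a, b].Sublist l) {x y : β} (hx : x ∈ f a) (hy : y ∈ f b) :
    [x, y].Sublist (l.flatMap f) := by
  induction l with
  | nil => exact absurd h not_pair_sublist_nil
  | cons c l ih =>
    rw [List.flatMap_cons, Plain.pair_sublist_append]
    rcases pair_sublist_cons.1 h with ⟨rfl, hb⟩ | hab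
    · exact .inr (.inr ⟨hx, List.mem_flatMap.2 ⟨b, hb, hy⟩⟩)
    · exact .inr (.inl (ih hab))

theorem pair_sublist_flatMap_of_mem {α β : Type*} {f : α → List β} {l : List α} {a : α}
    (h : a ∈ l) {x y : β} (hxy : [x, y].Sublist (f a)) : [x, y].Sublist (l.flatMap f) := by
  induction l with
  | nil => simp at h
  | cons c l ih =>
    rw [List.flatMap_cons, Plain.pair_sublist_append]
    rcases List.mem_cons.1 h with rfl | h
    · exact .inl hxy
    · exact .inr (.inl (ih h))

theorem pair_sublist_map {α β : Type*} {f : α → β} {l : List α} {x y : β}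
    (h : [x, y].Sublist (l.map f)) : ∃ a b, [a, b].Sublist l ∧ f a = x ∧ f b = y := by
  obtain ⟨l', hl', h⟩ := List.sublist_map_iff.1 h
  rcases l' with _ | ⟨a, _ | ⟨b, _ | ⟨c, l'⟩⟩⟩ <;> simp at h
  exact ⟨a, b, hl', h.1.symm, h.2.symm⟩

theorem RdmaCall.sloc_subset {Val Loc Node Wid : Type*}
    (c : RdmaCall Val Loc Node Wid) (a : Stamp Node) :
    c.sloc a ⊆ c.loc := by
  cases c <;> cases a <;> simp [RdmaCall.sloc, RdmaCall.loc]

theorem Call.sloc_subset {Val Loc Node Wid : Type*}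
    (c : Call Val Loc Node Wid) (a : Stamp Node) :
    c.sloc a ⊆ c.loc := by
  cases c with
  | rdma c => exact c.sloc_subset a
  | _ => exact subset_rfl

/-! ### Consistent executions made of blocks -/

section Refinement

variable {Val Loc Tid Node Wid : Type*} [Zero Val] [One Val] [Add Val]

/-- A consistent execution of the RDMA library whose threads run sequences of blocks. -/
structure Refines (K : Config Val Loc Tid Node) (A : NLockLayout Loc Tid Wid) (Lk : Set Loc)
    (G : Exe Val Loc Tid Node Wid) (W : Witness Val Loc Tid Node Wid)
    (l : Tid → List (Block Val Loc Tid Node Wid)) : Prop where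
  valid : A.Valid K Lk
  isExecution : G.IsExecution
  rdma : ∀ e ∈ G.E, ∃ c, e.call = .rdma c ∧ c.WellAddressed K e.tid ∧ c.WellTyped K e.out ∧
    G.stmp e ∈ c.stamps K e.out
  wf : W.WellFormed K G
  ib_irrefl : ∀ s, ¬ W.ib G s s
  so_iff : ∀ s s', G.so s s' ↔ W.rdmaSo G s s'
  mem_E : ∀ e, e ∈ G.E ↔ ∃ t, ∃ b ∈ l t, e ∈ b.conc K A
  po_iff : ∀ e e', G.po e e' ↔ ∃ t, [e, e'].Sublist ((l t).flatMap (Block.conc K A))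
  ok : ∀ t, ∀ b ∈ l t, b.Ok A Lk t
  fresh : ∀ t e, .client e ∈ l t → ∀ x ∈ Lk, ∀ c, A.cell x c ∉ e.call.loc

namespace Refines

variable {K : Config Val Loc Tid Node} {A : NLockLayout Loc Tid Wid} {Lk : Set Loc}
  {G : Exe Val Loc Tid Node Wid} {W : Witness Val Loc Tid Node Wid}
  {l : Tid → List (Block Val Loc Tid Node Wid)} (h : Refines K A Lk G W l)
include h

theorem po_irrefl (e : Ev Val Loc Tid Node Wid) : ¬ G.po e e := fun he =>
  (h.isExecution.po_total e.tid).irrefl e ⟨rfl, rfl, he⟩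

theorem po_trans {e₁ e₂ e₃ : Ev Val Loc Tid Node Wid} (h₁ : G.po e₁ e₂) (h₂ : G.po e₂ e₃) :
    G.po e₁ e₃ := by
  have t₁ := h.isExecution.po_thread _ _ h₁
  have t₂ := h.isExecution.po_thread _ _ h₂
  exact ((h.isExecution.po_total e₂.tid).trans e₁ e₂ e₃ ⟨t₁, rfl, h₁⟩ ⟨rfl, t₂.symm, h₂⟩).2.2

theorem po_of_pair {t : Tid} {b b' : Block Val Loc Tid Node Wid} (hb : [b, b'].Sublist (l t))
    {e e' : Ev Val Loc Tid Node Wid} (he : e ∈ b.conc K A) (he' : e' ∈ b'.conc K A) :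
    G.po e e' := (h.po_iff _ _).2 ⟨t, pair_sublist_flatMap hb he he'⟩

theorem po_of_mem {t : Tid} {b : Block Val Loc Tid Node Wid} (hb : b ∈ l t)
    {e e' : Ev Val Loc Tid Node Wid} (he : [e, e'].Sublist (b.conc K A)) : G.po e e' :=
  (h.po_iff _ _).2 ⟨t, pair_sublist_flatMap_of_mem hb he⟩

/-- An event shared by two blocks at different positions would be program-order before itself. -/
theorem eq_of_mem_conc {t t' : Tid} {b b' : Block Val Loc Tid Node Wid} (hb : b ∈ l t)
    (hb' : b' ∈ l t') {e : Ev Val Loc Tid Node Wid} (he : e ∈ b.conc K A)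
    (he' : e ∈ b'.conc K A) : b = b' := by
  obtain rfl : t = t' :=
    (Block.tid_of_mem (h.ok t b hb) he).symm.trans (Block.tid_of_mem (h.ok t' b' hb') he')
  rcases pair_sublist_trichotomy hb hb' with hp | hp | hp
  · exact hp
  · exact absurd (h.po_of_pair hp he he') (h.po_irrefl e)
  · exact absurd (h.po_of_pair hp he' he) (h.po_irrefl e)

theorem eq_of_abs_eq {t t' : Tid} {b b' : Block Val Loc Tid Node Wid} (hb : b ∈ l t)
    (hb' : b' ∈ l t') (e : b.abs K = b'.abs K) : b = b' :=
  h.eq_of_mem_conc hb hb' (Block.rep_abs_mem (h.ok t b hb))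
    (e ▸ Block.rep_abs_mem (h.ok t' b' hb'))

theorem not_pair_self {t : Tid} {b : Block Val Loc Tid Node Wid} : ¬ [b, b].Sublist (l t) := by
  intro hb
  have := Block.rep_abs_mem (K := K) (h.ok t b (hb.subset List.mem_cons_self))
  exact h.po_irrefl _ (h.po_of_pair hb this this)

/-- Being a two-element sublist is not transitive for lists with repetitions. The missing uniqueness
is imported from program order, which is irreflexive and transitive. -/
theorem pair_trans {t t' : Tid} {b₁ b₂ b₃ : Block Val Loc Tid Node Wid}
    (h₁ : [b₁, b₂].Sublist (l t)) (h₂ : [b₂, b₃].Sublist (l t')) : [b₁, b₃].Sublist (l t) := by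
  have ok₁ := h.ok t b₁ (h₁.subset (by simp))
  have ok₂ := h.ok t b₂ (h₁.subset (by simp))
  have ok₂' := h.ok t' b₂ (h₂.subset (by simp))
  obtain rfl : t = t' := (Block.abs_tid (K := K) ok₂).symm.trans (Block.abs_tid ok₂')
  have ok₃ := h.ok t b₃ (h₂.subset (by simp))
  have m₁ := Block.rep_abs_mem (K := K) ok₁
  have m₂ := Block.rep_abs_mem (K := K) ok₂
  have m₃ := Block.rep_abs_mem (K := K) ok₃
  have hp := h.po_trans (h.po_of_pair h₁ m₁ m₂) (h.po_of_pair h₂ m₂ m₃)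
  rcases pair_sublist_trichotomy (h₁.subset (by simp) : b₁ ∈ l t)
    (h₂.subset (by simp) : b₃ ∈ l t) with e | e | e
  · subst e
    exact absurd (h.po_of_pair h₂ m₂ m₃)
      fun hq => h.po_irrefl _ (h.po_trans hq (h.po_of_pair h₁ m₁ m₂))
  · exact e
  · exact absurd (h.po_of_pair e m₃ m₁) fun hq => h.po_irrefl _ (h.po_trans hq hp)

theorem mem_sEvent {e : Ev Val Loc Tid Node Wid} (he : e ∈ G.E) {c : RdmaCall Val Loc Node Wid}
    (hc : e.call = .rdma c) {S : Set (Stamp Node)} (hS : c.stamps K e.out = {S}) {a : Stamp Node} :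
    (e, a) ∈ G.SEvent ↔ a ∈ S := by
  obtain ⟨c', hc', -, -, hs⟩ := h.rdma e he
  obtain rfl : c = c' := by simpa using hc.symm.trans hc'
  rw [hS, Set.mem_singleton_iff] at hs
  simp [Exec.SEvent, he, hs]

theorem hb_of_po {s s' : SEv Val Loc Tid Node Wid} (hs : s ∈ G.SEvent) (hs' : s' ∈ G.SEvent)
    (hp : G.po s.1 s'.1) (ha : s.2.sto s'.2) : G.hb s s' :=
  h.isExecution.ppo_hb _ _ ⟨hs, hs', hp, ha⟩

theorem hb_of_so {s s' : SEv Val Loc Tid Node Wid} (hs : W.rdmaSo G s s') : G.hb s s' :=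
  h.isExecution.so_hb _ _ ((h.so_iff _ _).2 hs)

theorem hb_asymm {s s' : SEv Val Loc Tid Node Wid} (h₁ : G.hb s s') (h₂ : G.hb s' s) : False :=
  h.isExecution.hb_irrefl s (h.isExecution.hb_trans _ _ _ h₁ h₂)

theorem hb_trans {s s' s'' : SEv Val Loc Tid Node Wid} (h₁ : G.hb s s') (h₂ : G.hb s' s'') :
    G.hb s s'' := h.isExecution.hb_trans _ _ _ h₁ h₂

theorem hb_of_rfe {s s' : SEv Val Loc Tid Node Wid} (hs : W.rfe G s s') : G.hb s s' :=
  h.hb_of_so (.inr (.inl hs))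

theorem hb_of_pfg {s s' : SEv Val Loc Tid Node Wid} (hs : G.pfg s s') : G.hb s s' :=
  h.hb_of_so (.inr (.inr (.inl hs)))

theorem hb_of_rb {s s' : SEv Val Loc Tid Node Wid} (hs : W.rb G s s') : G.hb s s' :=
  h.hb_of_so (.inr (.inr (.inr (.inr (.inl hs)))))

theorem hb_of_mo {s s' : SEv Val Loc Tid Node Wid} (hs : W.moAll s s') : G.hb s s' :=
  h.hb_of_so (.inr (.inr (.inr (.inr (.inr (.inl hs))))))

/-- A read sees a write that happens before it, if every other write to the same location is
either before that write or program-order after the read. -/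
theorem rf_of_local {p : Loc} {L r : SEv Val Loc Tid Node Wid} (hL : L ∈ G.Writes)
    (hr : r ∈ G.Reads) (pL : SubEvent.loc L = {p}) (pr : SubEvent.loc r = {p}) (hLr : G.hb L r)
    (hw : ∀ w ∈ G.Writes, SubEvent.loc w = {p} → w ≠ L →
      G.hb w L ∨ G.hb r w ∧ G.po r.1 w.1) : W.rf L r := by
  have hne : r ≠ L := fun e => h.isExecution.hb_irrefl L (by rwa [e] at hLr)
  by_cases hex : ∃ w, W.rf w r
  · obtain ⟨w, hwr⟩ := hex
    by_cases hwL : w = L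
    · rwa [← hwL]
    exfalso
    have hwW := (h.wf.rf_sub _ _ hwr).1
    have pw : SubEvent.loc w = {p} := (h.wf.rf_loc _ _ hwr).trans pr
    have hmo := (h.wf.mo_total p).total w ⟨hwW, pw⟩ L ⟨hL, pL⟩ hwL
    rcases hw w hwW pw hwL with h' | ⟨h', h''⟩
    · rcases hmo with hmo | hmo
      -- The actual source is `mo`-before `L`, so `r` reads before `L`, against `hLr`.
      · exact h.hb_asymm hLr (h.hb_of_rb
          ⟨hr, hL, .inl ⟨w, hwr, p, hmo⟩, pr.trans pL.symm, hne⟩)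
      · exact h.hb_asymm h' (h.hb_of_mo ⟨p, hmo⟩)
    -- Only external reads-from is exported to `so`; an internal edge would put `w` program-order
    -- before `r`, which `h''` excludes.
    · refine h.hb_asymm h' (h.hb_of_rfe ⟨hwr, fun hi => ?_⟩)
      exact h.po_irrefl _ (h.po_trans h'' hi.2.2.1)
  -- A read without source reads before every write to its location, in particular before `L`.
  · exact absurd (h.hb_of_rb ⟨hr, hL, .inr hex, pr.trans pL.symm, hne⟩) fun hb =>
      h.hb_asymm hb hLr

theorem mem_E_of_mem {t : Tid} {b : Block Val Loc Tid Node Wid} (hb : b ∈ l t)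
    {e : Ev Val Loc Tid Node Wid} (he : e ∈ b.conc K A) : e ∈ G.E := (h.mem_E e).2 ⟨t, b, hb, he⟩

/-- The subevents on the locations of the implementation. -/
theorem cell_cases {s : SEv Val Loc Tid Node Wid} (hs : s ∈ G.SEvent) {x : Loc} (hx : x ∈ Lk)
    {c : Cell Tid} (hc : A.cell x c ∈ SubEvent.loc s) :
    (∃ d, .acq d ∈ l d.tid ∧ d.lock = x ∧
      ((c = .ticket ∧ s.1 = d.faa K A ∧ (s.2 = .nARR (K.nodeL x) ∨ s.2 = .nRW (K.nodeL x))) ∨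
       (c = .release ∧ (s.1 = d.get K A ∨ s.1 ∈ d.polling) ∧ s.2 = .nRR (K.nodeL x)) ∨
       (c = .temp d.tid ∧ (s.1 = d.faa K A ∨ s.1 = d.get K A ∨ s.1 ∈ d.polling) ∧
        s.2 = .nLW (K.nodeL x)) ∨
       (c = .temp d.tid ∧ s.2 = .aCR) ∨
       (c = .temp d.tid ∧ s.1 = d.write K A ∧ s.2 = .aCW))) ∨
    ∃ d, .rel d ∈ l d.tid ∧ d.lock = x ∧
      ((c = .temp d.tid ∧ s.2 = .nLR (K.nodeL x)) ∨
       (c = .release ∧ s.1 = d.put K A ∧ s.2 = .nRW (K.nodeL x))) := by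
  obtain ⟨e, a⟩ := s
  have he := hs.1
  obtain ⟨t, b, hb, heb⟩ := (h.mem_E e).1 he
  have hok := h.ok t b hb
  have st := fun {c} (hc : e.call = .rdma c) {S} (hS : c.stamps K e.out = {S}) =>
    (h.mem_sEvent he hc hS (a := a)).1 hs
  cases b with
  | client e' =>
    obtain rfl : e = e' := by simpa [Block.conc] using heb
    exact absurd (Call.sloc_subset _ _ hc) (h.fresh t e hb x hx c)
  | acq d =>
    left
    obtain ⟨rfl, hlk, hpoll⟩ := hok
    have hcell := h.valid.distinct x hx d.lock hlk c
    have hget : ∀ i o, e = ⟨d.tid, i, .rdma (.get (d.temp A) (A.cell d.lock .release)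
        (A.wid d.tid d.lock)), o⟩ → d.lock = x ∧
          (c = .release ∧ a = .nRR (K.nodeL x) ∨ c = .temp d.tid ∧ a = .nLW (K.nodeL x)) := by
      rintro i o rfl
      have := st rfl rfl
      simp only [h.valid.release_node _ hlk, Set.mem_insert_iff, Set.mem_singleton_iff] at this
      rcases this with rfl | rfl
      · obtain ⟨rfl, rfl⟩ := hcell _ hc
        simp
      · obtain ⟨rfl, rfl⟩ := hcell _ hc
        simp
    have hread : ∀ i o, e = ⟨d.tid, i, .rdma (.read (d.temp A)), o⟩ → d.lock = x ∧
        c = .temp d.tid ∧ a = .aCR := by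
      rintro i o rfl
      obtain rfl : a = .aCR := st rfl rfl
      obtain ⟨rfl, rfl⟩ := hcell _ hc
      simp
    refine ⟨d, hb, ?_⟩
    simp only [Block.conc, AcqRun.events, List.cons_append, List.nil_append, List.mem_cons,
      List.mem_append, List.not_mem_nil, or_false] at heb
    rcases heb with rfl | rfl | rfl | hp | rfl | rfl | rfl | rfl
    · have := st rfl rfl
      simp only [h.valid.ticket_node _ hlk, Set.mem_insert_iff, Set.mem_singleton_iff] at this
      rcases this with rfl | rfl | rfl
      · obtain ⟨rfl, rfl⟩ := hcell _ hc
        simp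
      · obtain ⟨rfl, rfl⟩ := hcell _ hc
        simp
      · obtain ⟨rfl, rfl⟩ := hcell _ hc
        simp
    · exact absurd (Call.sloc_subset _ _ hc) (by simp [AcqRun.wait, Call.loc, RdmaCall.loc])
    · obtain ⟨rfl, rfl, rfl⟩ := hread _ _ rfl
      simp
    · obtain ⟨ht, hp'⟩ := hpoll e hp
      obtain ⟨t, i, c', o⟩ := e
      obtain rfl : t = d.tid := ht
      rcases hp' with hc' | hc' | hc'
      · obtain rfl : c' = _ := hc'
        obtain ⟨rfl, ⟨rfl, rfl⟩ | ⟨rfl, rfl⟩⟩ := hget _ _ rfl <;> simp [hp]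
      · obtain rfl : c' = _ := hc'
        exact absurd (Call.sloc_subset _ _ hc) (by simp [Call.loc, RdmaCall.loc])
      · obtain rfl : c' = _ := hc'
        obtain ⟨rfl, rfl, rfl⟩ := hread _ _ rfl
        simp
    · obtain ⟨rfl, ⟨rfl, rfl⟩ | ⟨rfl, rfl⟩⟩ := hget _ _ rfl <;> simp
    · exact absurd (Call.sloc_subset _ _ hc) (by simp [AcqRun.wait', Call.loc, RdmaCall.loc])
    · obtain ⟨rfl, rfl, rfl⟩ := hread _ _ rfl
      simp
    · obtain rfl : a = .aCW := st rfl rfl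
      obtain ⟨rfl, rfl⟩ := hcell _ hc
      simp
  | rel d =>
    right
    obtain ⟨rfl, hlk⟩ := hok
    have hcell := h.valid.distinct x hx d.lock hlk c
    refine ⟨d, hb, ?_⟩
    simp only [Block.conc, List.mem_cons, List.not_mem_nil, or_false] at heb
    rcases heb with rfl | rfl
    · exact absurd (Call.sloc_subset _ _ hc) (by simp [RelRun.fence, Call.loc, RdmaCall.loc])
    · have := st rfl rfl
      simp only [h.valid.release_node _ hlk, Set.mem_insert_iff, Set.mem_singleton_iff] at this
      rcases this with rfl | rfl
      · obtain ⟨rfl, rfl⟩ := hcell _ hc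
        simp
      · obtain ⟨rfl, rfl⟩ := hcell _ hc
        simp

end Refines

end Refinement

/-! ### Values passed through the temporary locations -/

section Refinement

variable {Val Loc Tid Node Wid : Type*} [Zero Val] [One Val] [Add Val]

namespace Refines

variable {K : Config Val Loc Tid Node} {A : NLockLayout Loc Tid Wid} {Lk : Set Loc}
  {G : Exe Val Loc Tid Node Wid} {W : Witness Val Loc Tid Node Wid}
  {l : Tid → List (Block Val Loc Tid Node Wid)} (h : Refines K A Lk G W l)
include h

section Acq

variable {d : AcqRun Val Loc Tid Node Wid} (hd : .acq d ∈ l d.tid)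
include hd

theorem acq_lock : d.lock ∈ Lk := (h.ok _ _ hd).2.1

theorem acq_mem_E {e : Ev Val Loc Tid Node Wid} (he : e ∈ d.events K A) : e ∈ G.E :=
  h.mem_E_of_mem hd he

theorem acq_po {e e' : Ev Val Loc Tid Node Wid} (he : [e, e'].Sublist (d.events K A)) :
    G.po e e' := h.po_of_mem hd he

theorem faa_mem {a : Stamp Node} : (d.faa K A, a) ∈ G.SEvent ↔
    a ∈ ({.nARR (K.nodeL d.lock), .nRW (K.nodeL d.lock), .nLW (K.nodeL d.lock)} :
      Set (Stamp Node)) :=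
  h.mem_sEvent (h.acq_mem_E hd (by simp [AcqRun.events])) rfl
    (by rw [← h.valid.ticket_node _ (h.acq_lock hd)]; rfl)

theorem wait_mem : (d.wait K A, .aWT) ∈ G.SEvent :=
  (h.mem_sEvent (h.acq_mem_E hd (by simp [AcqRun.events])) (S := {_}) rfl rfl).2 rfl

theorem read_mem : (d.read A, .aCR) ∈ G.SEvent :=
  (h.mem_sEvent (h.acq_mem_E hd (by simp [AcqRun.events])) (S := {_}) rfl rfl).2 rfl

theorem get_mem {a : Stamp Node} : (d.get K A, a) ∈ G.SEvent ↔
    a ∈ ({.nRR (K.nodeL d.lock), .nLW (K.nodeL d.lock)} : Set (Stamp Node)) :=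
  h.mem_sEvent (h.acq_mem_E hd (by simp [AcqRun.events])) rfl
    (by rw [← h.valid.release_node _ (h.acq_lock hd)]; rfl)

theorem wait'_mem : (d.wait' K A, .aWT) ∈ G.SEvent :=
  (h.mem_sEvent (h.acq_mem_E hd (by simp [AcqRun.events])) (S := {_}) rfl rfl).2 rfl

theorem read'_mem : (d.read' A, .aCR) ∈ G.SEvent :=
  (h.mem_sEvent (h.acq_mem_E hd (by simp [AcqRun.events])) (S := {_}) rfl rfl).2 rfl

theorem write_mem : (d.write K A, .aCW) ∈ G.SEvent :=
  (h.mem_sEvent (h.acq_mem_E hd (by simp [AcqRun.events])) (S := {_}) rfl rfl).2 rfl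

theorem poll_call {e : Ev Val Loc Tid Node Wid} (he : e ∈ d.polling) {n : Node}
    (hs : (e, .nLW n) ∈ G.SEvent) : e.call = .rdma (.get (d.temp A) (A.cell d.lock .release)
      (A.wid d.tid d.lock)) := by
  have hE := hs.1
  rcases ((h.ok _ _ hd).2.2 e he).2 with hc | hc | hc
  · exact hc
  · simpa using (h.mem_sEvent hE hc rfl).1 hs
  · simpa using (h.mem_sEvent hE hc rfl).1 hs

/-- NIC local writes of an acquire complete before its last wait. -/
theorem lw_hb_wait' {e : Ev Val Loc Tid Node Wid} {n : Node}
    (he : e = d.faa K A ∨ e = d.get K A ∨ e ∈ d.polling) (hs : (e, .nLW n) ∈ G.SEvent) :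
    G.hb (e, .nLW n) (d.wait' K A, .aWT) := by
  refine h.hb_of_pfg ⟨⟨hs, h.wait'_mem hd, rfl, h.acq_po hd ?_, A.wid d.tid d.lock, ?_, rfl⟩, n, rfl⟩
  · rcases he with rfl | rfl | he <;>
      simp [AcqRun.events, pair_sublist_cons, Plain.pair_sublist_append, *]
  · rcases he with rfl | rfl | he
    · rfl
    · rfl
    · change e.call.wid = _
      rw [h.poll_call hd he hs]
      rfl

theorem faa_lw_hb_wait : G.hb (d.faa K A, .nLW (K.nodeL d.lock)) (d.wait K A, .aWT) := by
  refine h.hb_of_pfg ⟨⟨(h.faa_mem hd).2 (by simp), h.wait_mem hd, rfl, h.acq_po hd ?_,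
    A.wid d.tid d.lock, rfl, rfl⟩, _, rfl⟩
  simp [AcqRun.events]

theorem faa_lw_hb_read : G.hb (d.faa K A, .nLW (K.nodeL d.lock)) (d.read A, .aCR) :=
  h.hb_trans (h.faa_lw_hb_wait hd) <| h.hb_of_po (h.wait_mem hd) (h.read_mem hd)
    (h.acq_po hd (by simp [AcqRun.events])) trivial

theorem wait'_hb_read' : G.hb (d.wait' K A, .aWT) (d.read' A, .aCR) :=
  h.hb_of_po (h.wait'_mem hd) (h.read'_mem hd)
    (h.acq_po hd (by simp [AcqRun.events, pair_sublist_cons, Plain.pair_sublist_append])) trivial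

theorem get_lw_hb_read' : G.hb (d.get K A, .nLW (K.nodeL d.lock)) (d.read' A, .aCR) :=
  h.hb_trans (h.lw_hb_wait' hd (.inr (.inl rfl)) ((h.get_mem hd).2 (by simp)))
    (h.wait'_hb_read' hd)

/-- The chain is `iso` to the local write, `pfg` to the wait, then preserved program order. It
places the entry of an acquire before its exit. -/
theorem get_rr_hb_read' : G.hb (d.get K A, .nRR (K.nodeL d.lock)) (d.read' A, .aCR) :=
  h.hb_trans (s' := (d.get K A, .nLW _)) (h.hb_of_so (.inl ⟨(h.get_mem hd).2 (by simp), (h.get_mem hd).2 (by simp), rfl,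
    .inr (.inl ⟨_, _, _, _, rfl, rfl, rfl⟩)⟩)) (h.get_lw_hb_read' hd)

theorem faa_iso {a : Stamp Node} (ha : a = .nLW (K.nodeL d.lock) ∨ a = .nRW (K.nodeL d.lock)) :
    G.iso (d.faa K A, .nARR (K.nodeL d.lock)) (d.faa K A, a) :=
  ⟨(h.faa_mem hd).2 (by simp), (h.faa_mem hd).2 (by rcases ha with rfl | rfl <;> simp), rfl,
    .inr (.inr (.inr ⟨.inr ⟨_, _, _, _, rfl⟩, _, rfl, ha⟩))⟩

/-- The local read of a `put` is not stamp-ordered before a later CPU write. It is ordered before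
the atomic remote read of the next acquire, and from there this lemma leads to the CPU write of that
acquire. -/
theorem faa_arr_hb_write : G.hb (d.faa K A, .nARR (K.nodeL d.lock)) (d.write K A, .aCW) :=
  h.hb_trans (h.hb_of_so (.inl (h.faa_iso hd (.inl rfl)))) <| h.hb_trans (h.faa_lw_hb_read hd) <|
    h.hb_of_po (h.read_mem hd) (h.write_mem hd)
    (h.acq_po hd (by simp [AcqRun.events])) trivial

end Acq

section Rel

variable {d : RelRun Loc Tid} (hd : .rel d ∈ l d.tid)
include hd

theorem rel_lock : d.lock ∈ Lk := (h.ok _ _ hd).2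

theorem fence_mem : (d.fence K, .nF (K.nodeL d.lock)) ∈ G.SEvent :=
  (h.mem_sEvent (h.mem_E_of_mem hd (by simp [Block.conc])) (S := {_}) rfl rfl).2 rfl

theorem put_mem {a : Stamp Node} : (d.put K A, a) ∈ G.SEvent ↔
    a ∈ ({.nLR (K.nodeL d.lock), .nRW (K.nodeL d.lock)} : Set (Stamp Node)) :=
  h.mem_sEvent (h.mem_E_of_mem hd (by simp [Block.conc])) rfl
    (by rw [← h.valid.release_node _ (h.rel_lock hd)]; rfl)

end Rel

/-- The writes to a temporary location. -/
theorem temp_write {x : Loc} (hx : x ∈ Lk) {t : Tid} {w : SEv Val Loc Tid Node Wid}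
    (hw : w ∈ G.Writes) (hl : SubEvent.loc w = {A.cell x (.temp t)}) :
    ∃ d, .acq d ∈ l d.tid ∧ d.lock = x ∧ d.tid = t ∧
      ((w.1 = d.faa K A ∨ w.1 = d.get K A ∨ w.1 ∈ d.polling) ∧ w.2 = .nLW (K.nodeL x) ∨
        w = (d.write K A, .aCW)) := by
  have hl' : A.cell x (.temp t) ∈ SubEvent.loc w := by simp [hl]
  have hw' : w.2.IsWrite := hw.2
  rcases h.cell_cases hw.1 hx hl' with ⟨d, hd, hdx, hc⟩ | ⟨d, hd, hdx, hc⟩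
  · refine ⟨d, hd, hdx, ?_⟩
    rcases hc with ⟨hc, -⟩ | ⟨hc, -⟩ | ⟨hc, he, ha⟩ | ⟨hc, ha⟩ | ⟨hc, he, ha⟩
    · simp at hc
    · simp at hc
    · exact ⟨by simpa using hc.symm, .inl ⟨he, ha⟩⟩
    · simp [ha, Stamp.IsWrite] at hw'
    · exact ⟨by simpa using hc.symm, .inr (Prod.ext he ha)⟩
  · rcases hc with ⟨hc, ha⟩ | ⟨hc, -⟩
    · simp [ha, Stamp.IsWrite] at hw'
    · simp at hc

/-- A read by an acquire sees the last NIC local write of this acquire. -/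
theorem rf_of_acq {d : AcqRun Val Loc Tid Node Wid} (hd : .acq d ∈ l d.tid)
    {L r : Ev Val Loc Tid Node Wid} (mL : L ∈ d.events K A) (mr : r ∈ d.events K A)
    (sL : (L, .nLW (K.nodeL d.lock)) ∈ G.SEvent) (sr : (r, .aCR) ∈ G.SEvent)
    (pL : L.call.sloc (.nLW (K.nodeL d.lock)) = {d.temp A}) (pr : r.call.sloc .aCR = {d.temp A})
    (hLr : G.hb (L, .nLW (K.nodeL d.lock)) (r, .aCR))
    (hw : ∀ w : SEv Val Loc Tid Node Wid, w ≠ (L, .nLW (K.nodeL d.lock)) →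
      ((w.1 = d.faa K A ∨ w.1 = d.get K A ∨ w.1 ∈ d.polling) ∧ w.2 = .nLW (K.nodeL d.lock) ∨
        w = (d.write K A, .aCW)) →
      [w.1, L].Sublist (d.events K A) ∨ [r, w.1].Sublist (d.events K A)) :
    W.rf (L, .nLW (K.nodeL d.lock)) (r, .aCR) := by
  refine h.rf_of_local ⟨sL, trivial⟩ ⟨sr, trivial⟩ pL pr hLr fun w hwW hwp hwL => ?_
  obtain ⟨d', hd', hx, ht, hcase⟩ := h.temp_write (h.acq_lock hd) hwW hwp
  have hmem : w.1 ∈ d'.events K A := by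
    rcases hcase with ⟨h1 | h1 | h1, -⟩ | h1 <;> simp [AcqRun.events, h1]
  -- Another run on the same thread lies entirely before or entirely after this one; only writes of
  -- the run itself need `hw`.
  have hpo : G.po w.1 L ∨ G.po r w.1 := by
    rw [ht] at hd'
    rcases pair_sublist_trichotomy hd hd' with e | e | e
    · obtain rfl : d = d' := by simpa using e
      exact (hw w hwL hcase).imp (h.acq_po hd) (h.acq_po hd)
    · exact .inr (h.po_of_pair e mr hmem)
    · exact .inl (h.po_of_pair e hmem mL)
  refine hpo.imp (fun hpo => h.hb_of_po hwW.1 sL hpo ?_) fun hpo => ⟨h.hb_of_po sr hwW.1 hpo ?_, hpo⟩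
  · rcases hcase with ⟨-, h2⟩ | h2 <;> rw [h2]
    · rfl
    · trivial
  · trivial

/-- The first CPU read of the run can only see the local write of the fetch-and-add, which copies
the value read remotely. -/
theorem vR_faa {d : AcqRun Val Loc Tid Node Wid} (hd : .acq d ∈ l d.tid) :
    W.vR (d.faa K A, .nARR (K.nodeL d.lock)) = d.ticket := by
  have sL : (d.faa K A, .nLW (K.nodeL d.lock)) ∈ G.SEvent := (h.faa_mem hd).2 (by simp)
  have hrf := h.rf_of_acq hd (by simp [AcqRun.events]) (by simp [AcqRun.events]) sL (h.read_mem hd)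
    rfl rfl (h.faa_lw_hb_read hd) (by
      rintro w hw (⟨h1 | h1 | h1, h2⟩ | rfl)
      · exact absurd (Prod.ext h1 h2) hw
      all_goals simp [AcqRun.events, pair_sublist_cons, Plain.pair_sublist_append, *])
  rw [h.wf.copy _ _ _ (.rmw _) ((h.faa_mem hd).2 (by simp)) sL, h.wf.rf_val _ _ hrf,
    h.wf.vR_read _ ⟨h.read_mem hd, trivial⟩ _ rfl]
  rfl

/-- The last CPU read sees the local write of the last `get`, and it returned the ticket because the
loop was left. -/
theorem vR_get {d : AcqRun Val Loc Tid Node Wid} (hd : .acq d ∈ l d.tid) :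
    W.vR (d.get K A, .nRR (K.nodeL d.lock)) = d.ticket := by
  have sL : (d.get K A, .nLW (K.nodeL d.lock)) ∈ G.SEvent := (h.get_mem hd).2 (by simp)
  have hrf := h.rf_of_acq hd (by simp [AcqRun.events]) (by simp [AcqRun.events]) sL (h.read'_mem hd)
    rfl rfl (h.get_lw_hb_read' hd) (by
      rintro w hw (⟨h1 | h1 | h1, h2⟩ | rfl)
      · simp [AcqRun.events, pair_sublist_cons, Plain.pair_sublist_append, *]
      · exact absurd (Prod.ext h1 h2) hw
      all_goals simp [AcqRun.events, pair_sublist_cons, Plain.pair_sublist_append, *])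
  rw [h.wf.copy _ _ _ (.get _) ((h.get_mem hd).2 (by simp)) sL, h.wf.rf_val _ _ hrf,
    h.wf.vR_read _ ⟨h.read'_mem hd, trivial⟩ _ rfl]
  rfl

/-- A release of a lock that immediately follows an acquire stores the next ticket. -/
theorem vW_put {d : AcqRun Val Loc Tid Node Wid} {q : RelRun Loc Tid} (hq : .rel q ∈ l q.tid)
    (hlock : q.lock = d.lock) (hdq : [.acq d, .rel q].Sublist (l q.tid))
    (him : ∀ d', d'.lock = d.lock → [.acq d, .acq d'].Sublist (l q.tid) →
      ¬ [.acq d', .rel q].Sublist (l q.tid)) :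
    W.vW (q.put K A, .nRW (K.nodeL d.lock)) = d.ticket + 1 := by
  have hd' : .acq d ∈ l q.tid := hdq.subset (by simp)
  have ht : d.tid = q.tid := (h.ok _ _ hd').1
  have hd : .acq d ∈ l d.tid := ht ▸ hd'
  have sLR : (q.put K A, .nLR (K.nodeL d.lock)) ∈ G.SEvent :=
    (h.put_mem hq).2 (by simp [hlock])
  have sRW : (q.put K A, .nRW (K.nodeL d.lock)) ∈ G.SEvent :=
    (h.put_mem hq).2 (by simp [hlock])
  have mput : q.put K A ∈ (Block.rel q : Block Val Loc Tid Node Wid).conc K A := by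
    simp [Block.conc]
  have mw : ∀ d : AcqRun Val Loc Tid Node Wid, d.write K A ∈ d.events K A := by
    simp [AcqRun.events]
  have mw' : ∀ d : AcqRun Val Loc Tid Node Wid, d.wait' K A ∈ d.events K A := by
    simp [AcqRun.events]
  have hrf : W.rf (d.write K A, .aCW) (q.put K A, .nLR (K.nodeL d.lock)) := by
    refine h.rf_of_local (p := d.temp A) ⟨h.write_mem hd, trivial⟩ ⟨sLR, trivial⟩ rfl ?_
      (h.hb_of_po (h.write_mem hd) sLR (h.po_of_pair hdq (mw d) mput) trivial) ?_
    · change {A.cell q.lock (.temp q.tid)} = _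
      rw [hlock, ← ht]
    intro w hwW hwp hwL
    obtain ⟨d', hd₁, hx, ht', hcase⟩ := h.temp_write (h.acq_lock hd) hwW hwp
    have hmem : w.1 ∈ d'.events K A := by
      rcases hcase with ⟨h1 | h1 | h1, -⟩ | h1 <;> simp [AcqRun.events, h1]
    have hd₂ : .acq d' ∈ l q.tid := by rwa [← ht, ← ht']
    have before : G.po (d'.wait' K A) (d.write K A) →
        G.po w.1 (d.write K A) → G.hb w (d.write K A, .aCW) := by
      intro h₁ h₂
      rcases hcase with ⟨hc, hs⟩ | rfl
      · obtain ⟨e, a⟩ := w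
        obtain rfl : a = _ := hs
        exact h.hb_trans (h.lw_hb_wait' hd₁ hc hwW.1)
          (h.hb_of_po (h.wait'_mem hd₁) (h.write_mem hd) h₁ trivial)
      · exact h.hb_of_po hwW.1 (h.write_mem hd) h₂ trivial
    rcases pair_sublist_trichotomy hd' hd₂ with e | e | e
    · obtain rfl : d = d' := by simpa using e
      left
      refine before (h.acq_po hd ?_) (h.acq_po hd ?_)
      · simp [AcqRun.events, pair_sublist_cons, Plain.pair_sublist_append]
      · rcases hcase with ⟨h1 | h1 | h1, -⟩ | h1
        · simp [AcqRun.events, h1]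
        · simp [AcqRun.events, pair_sublist_cons, Plain.pair_sublist_append, h1]
        · simp [AcqRun.events, pair_sublist_cons, Plain.pair_sublist_append, h1]
        · exact absurd h1 hwL
    -- By `him` no acquire of this lock lies between `d` and `q`, so a later one comes after `q`.
    · have hlt : [.rel q, .acq d'].Sublist (l q.tid) := by
        rcases pair_sublist_trichotomy hq hd₂ with e' | e' | e'
        · simp at e'
        · exact e'
        · exact absurd e' (him d' hx e)
      right
      refine ⟨?_, h.po_of_pair hlt mput hmem⟩
      rcases hcase with ⟨hc, hs⟩ | rfl
      · refine h.hb_of_po sLR hwW.1 (h.po_of_pair hlt mput hmem) ?_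
        rw [hs]
        rfl
      -- A CPU write after the `put` is reached through the fetch-and-add that starts its run.
      · refine h.hb_trans (h.hb_of_po sLR ((h.faa_mem hd₁ (a := .nARR (K.nodeL d'.lock))).2
          (by simp)) (h.po_of_pair hlt mput (b' := .acq d') ?_) ?_) (h.faa_arr_hb_write hd₁)
        · simp [Block.conc, AcqRun.events]
        · rw [hx]
          rfl
    · exact .inl (before (h.po_of_pair e (mw' d') (mw d)) (h.po_of_pair e hmem (mw d)))
  rw [← h.wf.copy _ _ _ (.put _) sLR sRW, ← h.wf.rf_val _ _ hrf,
    h.wf.vW_write _ ⟨h.write_mem hd, trivial⟩ _ _ rfl]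

end Refines

end Refinement

/-! ### Ticket numbers and the hand-over of the lock -/

/-- In a finite strict total order where each value is the successor of the preceding one, values
are iterated successors of zero, strictly increasing in the order. -/
theorem exists_rank {α V : Type*} [Zero V] [One V] [Add V] {S : Set α} (hS : S.Finite)
    {r : α → α → Prop} (hr : StrictTotalOn S r) {v : α → V}
    (hv : ∀ e ∈ S, (v e = 0 ∧ ∀ e', ¬ r e' e) ∨
      ∃ e', r e' e ∧ (∀ e'', r e' e'' → ¬ r e'' e) ∧ v e = v e' + 1) :
    ∃ T : α → ℕ, (∀ e ∈ S, v e = (fun a : V => a + 1)^[T e] 0) ∧ ∀ e e', r e e' → T e < T e' := by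
  have fin : ∀ e, {e' | r e' e}.Finite := fun e => hS.subset fun e' he' => (hr.sub _ _ he').1
  have mono : ∀ e e', r e e' → {e'' | r e'' e}.ncard < {e'' | r e'' e'}.ncard := fun e e' h =>
    Set.ncard_lt_ncard ⟨fun e'' h' => hr.trans _ _ _ h' h, fun hs => hr.irrefl e (hs h)⟩ (fin e')
  -- The rank of an element is the number of its predecessors.
  refine ⟨fun e => {e' | r e' e}.ncard, fun e he => ?_, mono⟩
  induction hn : {e' | r e' e}.ncard using Nat.strong_induction_on generalizing e with
  | _ n ih =>
    rcases hv e he with ⟨h0, hno⟩ | ⟨e', he', hbt, hve⟩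
    · have : {e' | r e' e} = ∅ := Set.eq_empty_of_forall_notMem hno
      dsimp only
      rw [h0, this, Set.ncard_empty]
      rfl
    -- By totality, nothing lying between `e'` and `e` means that every other predecessor of `e`
    -- precedes `e'`.
    · have : {a | r a e} = insert e' {a | r a e'} := by
        ext a
        simp only [Set.mem_ofPred_eq, Set.mem_insert_iff]
        constructor
        · intro ha
          by_contra! hne
          rcases hr.total a (hr.sub _ _ ha).1 e' (hr.sub _ _ he').1 hne.1 with h | h
          · exact hne.2 h
          · exact hbt a h ha
        · rintro (rfl | ha)
          · exact he'
          · exact hr.trans _ _ _ ha he'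
      have hc := Set.ncard_insert_of_notMem (s := {a | r a e'}) (hr.irrefl e') (fin e')
      rw [← this] at hc
      dsimp only at ih ⊢
      rw [hve, ih _ (by omega) e' (hr.sub _ _ he').1 rfl, hc, Function.iterate_succ_apply']

section Refinement

variable {Val Loc Tid Node Wid : Type*} [Zero Val] [One Val] [Add Val]

/-- The acquires of a lock. -/
def runsOf (l : Tid → List (Block Val Loc Tid Node Wid)) (x : Loc) :
    Set (AcqRun Val Loc Tid Node Wid) := {d | .acq d ∈ l d.tid ∧ d.lock = x}

/-- The order in which the tickets of a lock are fetched. -/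
def ticketOrder (K : Config Val Loc Tid Node) (A : NLockLayout Loc Tid Wid)
    (W : Witness Val Loc Tid Node Wid) (l : Tid → List (Block Val Loc Tid Node Wid)) (x : Loc)
    (d d' : AcqRun Val Loc Tid Node Wid) : Prop :=
  d ∈ runsOf l x ∧ d' ∈ runsOf l x ∧
    W.rao (K.nodeL x) (d.faa K A, .nARR (K.nodeL x)) (d'.faa K A, .nARR (K.nodeL x))

/-- The release `q` immediately follows the acquire `d` among the operations on their lock. -/
structure Paired (l : Tid → List (Block Val Loc Tid Node Wid)) (d : AcqRun Val Loc Tid Node Wid)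
    (q : RelRun Loc Tid) : Prop where
  lock : q.lock = d.lock
  lt : [.acq d, .rel q].Sublist (l q.tid)
  acq : ∀ d', d'.lock = d.lock → [.acq d, .acq d'].Sublist (l q.tid) →
    ¬ [.acq d', .rel q].Sublist (l q.tid)
  rel : ∀ q', q'.lock = d.lock → [.acq d, .rel q'].Sublist (l q.tid) →
    ¬ [.rel q', .rel q].Sublist (l q.tid)

namespace Refines

variable {K : Config Val Loc Tid Node} {A : NLockLayout Loc Tid Wid} {Lk : Set Loc}
  {G : Exe Val Loc Tid Node Wid} {W : Witness Val Loc Tid Node Wid}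
  {l : Tid → List (Block Val Loc Tid Node Wid)} (h : Refines K A Lk G W l)

omit [Zero Val] [One Val] [Add Val] in
theorem _root_.finite_runsOf [Finite Tid] (x : Loc) : (runsOf l x).Finite := by
  refine (Set.finite_iUnion fun t => ((l t).finite_toSet.preimage
    (f := Block.acq) fun a _ b _ e => by simpa using e)).subset ?_
  intro d hd
  exact Set.mem_iUnion.2 ⟨d.tid, hd.1⟩

include h

theorem faa_inj {d d' : AcqRun Val Loc Tid Node Wid} (hd : .acq d ∈ l d.tid)
    (hd' : .acq d' ∈ l d'.tid) (e : d.faa K A = d'.faa K A) : d = d' := by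
  simpa using h.eq_of_mem_conc hd hd' (e := d.faa K A) (by simp [Block.conc, AcqRun.events])
    (by simp [Block.conc, AcqRun.events, e])

theorem ticketOrder_strictTotalOn (x : Loc) :
    StrictTotalOn (runsOf l x) (ticketOrder K A W l x) where
  sub a b hab := ⟨hab.1, hab.2.1⟩
  irrefl a ha := (h.wf.rao_total _).irrefl _ ha.2.2
  trans a b c hab hbc := ⟨hab.1, hbc.2.1, (h.wf.rao_total _).trans _ _ _ hab.2.2 hbc.2.2⟩
  total a ha b hb hne := by
    have mem : ∀ d ∈ runsOf l x, (d.faa K A, Stamp.nARR (K.nodeL x)) ∈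
        {s ∈ G.SEvent | s.2 = .nARR (K.nodeL x) ∧
          ∃ c, s.1.call = .rdma c ∧ c.IsRmwTo K (K.nodeL x)} := by
      rintro d ⟨hd, rfl⟩
      exact ⟨(h.faa_mem hd).2 (by simp), rfl, _, rfl, h.valid.ticket_node _ (h.acq_lock hd)⟩
    rcases (h.wf.rao_total (K.nodeL x)).total _ (mem a ha) _ (mem b hb)
      (fun e => hne (h.faa_inj ha.1 hb.1 (Prod.ext_iff.1 e).1)) with hab | hab
    · exact .inl ⟨ha, hb, hab⟩
    · exact .inr ⟨hb, ha, hab⟩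

/-- This is the `[nRW]; iso⁻¹; rao` part of `so`, the atomicity of remote read-modify-writes: the
earlier one has written before the later one reads. -/
theorem rw_hb_arr {x : Loc} {d d' : AcqRun Val Loc Tid Node Wid}
    (hd : ticketOrder K A W l x d d') :
    G.hb (d.faa K A, .nRW (K.nodeL x)) (d'.faa K A, .nARR (K.nodeL x)) := by
  obtain ⟨⟨hd, rfl⟩, -, hr⟩ := hd
  exact h.hb_of_so (.inr (.inr (.inr (.inr (.inr (.inr (.inr (.inl
    ⟨⟨_, rfl⟩, _, h.faa_iso hd (.inr rfl), _, hr⟩))))))))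

theorem arr_hb_rw {x : Loc} {d : AcqRun Val Loc Tid Node Wid} (hd : d ∈ runsOf l x) :
    G.hb (d.faa K A, .nARR (K.nodeL x)) (d.faa K A, .nRW (K.nodeL x)) := by
  obtain ⟨hd, rfl⟩ := hd
  exact h.hb_of_so (.inl (h.faa_iso hd (.inr rfl)))

/-- The tickets of a lock are numbered in the order in which they are fetched. -/
theorem exists_ticket_number [Finite Tid] (x : Loc) :
    ∃ T : AcqRun Val Loc Tid Node Wid → ℕ,
      (∀ d ∈ runsOf l x, d.ticket = (fun a : Val => a + 1)^[T d] 0) ∧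
      ∀ d d', ticketOrder K A W l x d d' → T d < T d' := by
  have ord := h.ticketOrder_strictTotalOn x
  refine exists_rank (finite_runsOf x) ord fun d hd => ?_
  have locR : ∀ d ∈ runsOf l x, SubEvent.loc (d.faa K A, .nARR (K.nodeL x)) =
      {A.cell x .ticket} := by
    rintro d ⟨-, rfl⟩
    rfl
  have locW : ∀ d ∈ runsOf l x, SubEvent.loc (d.faa K A, .nRW (K.nodeL x)) =
      {A.cell x .ticket} := by
    rintro d ⟨-, rfl⟩
    rfl
  have memR : ∀ d ∈ runsOf l x, (d.faa K A, Stamp.nARR (K.nodeL x)) ∈ G.Reads := by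
    rintro d ⟨hd₁, rfl⟩
    exact ⟨(h.faa_mem hd₁).2 (by simp), trivial⟩
  have memW : ∀ d ∈ runsOf l x, (d.faa K A, Stamp.nRW (K.nodeL x)) ∈ G.Writes := by
    rintro d ⟨hd₁, rfl⟩
    exact ⟨(h.faa_mem hd₁).2 (by simp), trivial⟩
  have tick : ∀ d ∈ runsOf l x, W.vR (d.faa K A, .nARR (K.nodeL x)) = d.ticket := by
    rintro d ⟨hd₁, rfl⟩
    exact h.vR_faa hd₁
  have hx : x ∈ Lk := hd.2 ▸ h.acq_lock hd.1
  by_cases hex : ∃ w, W.rf w (d.faa K A, .nARR (K.nodeL x))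
  · right
    obtain ⟨w, hw⟩ := hex
    have hwW := (h.wf.rf_sub _ _ hw).1
    have hwW' : w.2.IsWrite := hwW.2
    have hl : A.cell x .ticket ∈ SubEvent.loc w := by
      rw [h.wf.rf_loc _ _ hw, locR d hd]
      rfl
    -- Only the fetch-and-adds of this lock write to its ticket dispenser.
    obtain ⟨d', hd', rfl⟩ : ∃ d' ∈ runsOf l x, w = (d'.faa K A, .nRW (K.nodeL x)) := by
      rcases h.cell_cases hwW.1 hx hl with ⟨d', hd', hdx, hc⟩ | ⟨d', hd', hdx, hc⟩
      · rcases hc with ⟨-, he, ha | ha⟩ | ⟨hc, -⟩ | ⟨hc, -⟩ | ⟨hc, -⟩ | ⟨hc, -⟩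
        · simp [ha, Stamp.IsWrite] at hwW'
        · exact ⟨d', ⟨hd', hdx⟩, Prod.ext he ha⟩
        all_goals simp at hc
      · rcases hc with ⟨hc, -⟩ | ⟨hc, -⟩ <;> simp at hc
    have hhb : G.hb (d'.faa K A, .nRW (K.nodeL x)) (d.faa K A, .nARR (K.nodeL x)) :=
      h.hb_of_rfe ⟨hw, fun hi => by simpa using hi.1⟩
    have hne : d' ≠ d := by
      rintro rfl
      exact h.hb_asymm hhb (h.arr_hb_rw hd)
    have hlt : ticketOrder K A W l x d' d := by
      rcases ord.total d' hd' d hd hne with hlt | hlt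
      · exact hlt
      · exact (h.hb_asymm (h.hb_trans (h.arr_hb_rw hd) (h.rw_hb_arr hlt))
          (h.hb_trans (h.arr_hb_rw hd') hhb)).elim
    refine ⟨d', hlt, fun d'' h₁ h₂ => ?_, ?_⟩
    · have hd'' := h₁.2.1
      have hb₁ := h.hb_trans (h.rw_hb_arr h₁) (h.arr_hb_rw hd'')
      have hb₂ := h.rw_hb_arr h₂
      -- If `d''` came between source and reader, its write would be `mo`-after the source. The
      -- reader would then read before a write that happens before it.
      have hmo : W.mo (A.cell x .ticket) (d'.faa K A, .nRW (K.nodeL x))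
          (d''.faa K A, .nRW (K.nodeL x)) := by
        rcases (h.wf.mo_total (A.cell x .ticket)).total _ ⟨memW d' hd', locW d' hd'⟩ _
          ⟨memW d'' hd'', locW d'' hd''⟩
          (fun e => h.isExecution.hb_irrefl (d'.faa K A, .nRW (K.nodeL x))
            (by nth_rewrite 2 [e]; exact hb₁)) with hm | hm
        · exact hm
        · exact (h.hb_asymm hb₁ (h.hb_of_mo ⟨_, hm⟩)).elim
      exact h.hb_asymm hb₂ (h.hb_of_rb ⟨memR d hd, memW d'' hd'', .inl ⟨_, hw, _, hmo⟩,
        (locR d hd).trans (locW d'' hd'').symm, fun e => by simpa using (Prod.ext_iff.1 e).2⟩)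
    · rw [← tick d hd, ← h.wf.rf_val _ _ hw, ← tick d' hd']
      have := h.wf.rfaa_add (d'.faa K A) hwW.1.1 _ _ _ _ rfl
      rwa [h.valid.ticket_node _ (hd'.2 ▸ hx), hd'.2] at this
  -- Without a source the value is the initial 0. A predecessor is impossible, since its write
  -- happens before the read and would also be read-before it.
  · refine .inl ⟨?_, fun d' hlt => ?_⟩
    · rw [← tick d hd]
      exact h.wf.rf_init _ (memR d hd) hex
    · exact h.hb_asymm (h.rw_hb_arr hlt) (h.hb_of_rb ⟨memR d hd, memW d' hlt.1, .inr hex,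
        (locR d hd).trans (locW d' hlt.1).symm, fun e => by simpa using (Prod.ext_iff.1 e).2⟩)

theorem paired_unique {d : AcqRun Val Loc Tid Node Wid} {q q' : RelRun Loc Tid}
    (hq : Paired l d q) (hq' : Paired l d q') : q = q' := by
  have ht : q.tid = q'.tid := (h.ok _ (.acq d) (hq.lt.subset (by simp))).1.symm.trans
    (h.ok _ (.acq d) (hq'.lt.subset (by simp))).1
  have m : .rel q ∈ l q.tid := hq.lt.subset (by simp)
  have m' : .rel q' ∈ l q.tid := ht ▸ hq'.lt.subset (by simp)
  rcases pair_sublist_trichotomy m m' with e | e | e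
  · simpa using e
  · exact absurd (ht ▸ e) (hq'.rel q hq.lock (ht ▸ hq.lt))
  · exact absurd e (hq.rel q' hq'.lock (ht ▸ hq'.lt))

/-- A release happens before the successful polls of all later ticket holders. -/
theorem put_hb_get [Finite Tid]
    (hVal : Function.Injective fun k : ℕ => (fun v : Val => v + 1)^[k] 0) {x : Loc}
    (hrel : ∀ q, .rel q ∈ l q.tid → q.lock = x → ∃ d, Paired l d q)
    {d d' : AcqRun Val Loc Tid Node Wid} (hdd : ticketOrder K A W l x d d')
    {q : RelRun Loc Tid} (hq : Paired l d q) :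
    G.hb (q.put K A, .nRW (K.nodeL x)) (d'.get K A, .nRR (K.nodeL x)) := by
  obtain ⟨T, hT, hmono⟩ := h.exists_ticket_number x
  have ord := h.ticketOrder_strictTotalOn x
  -- The release `q` and its acquire `d` stay fixed; the induction is on the ticket number of the
  -- later holder.
  induction hk : T d' using Nat.strong_induction_on generalizing d' with
  | _ k ih =>
    obtain ⟨hd, hd', -⟩ := id hdd
    have hx : x ∈ Lk := hd.2 ▸ h.acq_lock hd.1
    have hget : W.vR (d'.get K A, .nRR (K.nodeL x)) = (fun a : Val => a + 1)^[T d'] 0 := by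
      rw [← hT d' hd', ← h.vR_get hd'.1, hd'.2]
    have hRd : (d'.get K A, Stamp.nRR (K.nodeL x)) ∈ G.Reads :=
      ⟨(h.get_mem hd'.1).2 (by simp [hd'.2]), trivial⟩
    -- A read without source returns 0, but the ticket number of `d'` exceeds that of `d` and so is
    -- positive.
    obtain ⟨w, hw⟩ : ∃ w, W.rf w (d'.get K A, .nRR (K.nodeL x)) := by
      by_contra hno
      have h0 := h.wf.rf_init _ hRd hno
      rw [hget] at h0
      have := @hVal (T d') 0 h0
      have := hmono _ _ hdd
      omega
    have hwW := (h.wf.rf_sub _ _ hw).1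
    have hwW' : w.2.IsWrite := hwW.2
    have hl : A.cell x .release ∈ SubEvent.loc w := by
      rw [h.wf.rf_loc _ _ hw, ← hd'.2]
      rfl
    obtain ⟨q', hq', hqx, rfl⟩ : ∃ q', .rel q' ∈ l q'.tid ∧ q'.lock = x ∧
        w = (q'.put K A, .nRW (K.nodeL x)) := by
      rcases h.cell_cases hwW.1 hx hl with ⟨d', hd', hdx, hc⟩ | ⟨d', hd', hdx, hc⟩
      · rcases hc with ⟨hc, -⟩ | ⟨-, -, ha⟩ | ⟨hc, -⟩ | ⟨hc, -⟩ | ⟨hc, -⟩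
        · simp at hc
        · simp [ha, Stamp.IsWrite] at hwW'
        all_goals simp at hc
      · rcases hc with ⟨hc, -⟩ | ⟨-, he, ha⟩
        · simp at hc
        · exact ⟨d', hd', hdx, Prod.ext he ha⟩
    obtain ⟨d'', hp⟩ := hrel q' hq' hqx
    have hd₁ : .acq d'' ∈ l q'.tid := hp.lt.subset (by simp)
    have hd'' : d'' ∈ runsOf l x := ⟨(h.ok _ _ hd₁).1 ▸ hd₁, hp.lock.symm.trans hqx⟩
    have hhb : G.hb (q'.put K A, .nRW (K.nodeL x)) (d'.get K A, .nRR (K.nodeL x)) :=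
      h.hb_of_rfe ⟨hw, fun hi => by simpa using hi.1⟩
    have hval := h.vW_put hq' hp.lock hp.lt hp.acq
    rw [hd''.2, h.wf.rf_val _ _ hw, hget, hT d'' hd'',
      ← Function.iterate_succ_apply' (fun a : Val => a + 1)] at hval
    -- The counter value read is one more than the ticket of the releasing run, so `d''` is numbered
    -- just below `d'`.
    have hTT : T d' = T d'' + 1 := hVal hval
    by_cases hdd'' : d = d''
    · subst hdd''
      obtain rfl := h.paired_unique hq hp
      exact hhb
    rcases ord.total d hd d'' hd'' hdd'' with hlt | hlt
    -- From the poll of `d''` the chain continues to its last CPU read, its own release `q'`, and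
    -- then by reads-from to the poll of `d'`.
    · refine h.hb_trans (ih _ (by omega) hlt rfl) (h.hb_trans ?_ hhb)
      have hread := h.get_rr_hb_read' hd''.1
      rw [hd''.2] at hread
      refine h.hb_trans hread (h.hb_of_po (h.read'_mem hd''.1) hwW.1 (h.po_of_pair hp.lt ?_ ?_)
        trivial)
      · simp [Block.conc, AcqRun.events]
      · simp [Block.conc]
    -- Otherwise the number of `d` would lie strictly between two consecutive integers.
    · have h₁ := hmono _ _ hlt
      have h₂ := hmono _ _ hdd
      omega

end Refines

end Refinement

/-! ### Restricting RDMA consistency to a closed part -/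

section Restriction

variable {Val Loc Tid Node Wid : Type*}

/-- The restriction of the relations of a witness to a set of subevents. -/
def Witness.restrict (W : Witness Val Loc Tid Node Wid) (S : Set (SEv Val Loc Tid Node Wid)) :
    Witness Val Loc Tid Node Wid where
  vR := W.vR
  vW := W.vW
  rf := relOn S W.rf
  mo x := relOn S (W.mo x)
  nfo := relOn S W.nfo
  rao n := relOn S (W.rao n)

theorem StrictTotalOn.relOn {α : Type*} {S S' T : Set α} {r : α → α → Prop}
    (hr : StrictTotalOn S r) (hS : ∀ a, a ∈ S' ↔ a ∈ S ∧ a ∈ T) : StrictTotalOn S' (relOn T r) where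
  sub a b h := ⟨(hS a).2 ⟨(hr.sub _ _ h.2.2).1, h.1⟩, (hS b).2 ⟨(hr.sub _ _ h.2.2).2, h.2.1⟩⟩
  irrefl a h := hr.irrefl a h.2.2
  trans a b c h h' := ⟨h.1, h'.2.1, hr.trans _ _ _ h.2.2 h'.2.2⟩
  total a ha b hb hne := by
    obtain ⟨ha, ha'⟩ := (hS a).1 ha
    obtain ⟨hb, hb'⟩ := (hS b).1 hb
    exact (hr.total a ha b hb hne).imp (⟨ha', hb', ·⟩) (⟨hb', ha', ·⟩)

/-- `H` is a part of `G` whose reads can only see writes of `H`. -/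
structure Exec.IsPart (H G : Exe Val Loc Tid Node Wid) : Prop where
  E : H.E ⊆ G.E
  po : ∀ a b, H.po a b ↔ a ∈ H.E ∧ b ∈ H.E ∧ G.po a b
  stmp : ∀ e ∈ H.E, H.stmp e = G.stmp e
  closed : ∀ w ∈ G.Writes, ∀ r ∈ H.Reads, SubEvent.loc w = SubEvent.loc r → w.1 ∈ H.E

namespace Exec.IsPart

variable {H G : Exe Val Loc Tid Node Wid} (hp : H.IsPart G)
include hp

theorem mem_sEvent {s : SEv Val Loc Tid Node Wid} :
    s ∈ H.SEvent ↔ s ∈ G.SEvent ∧ s.1 ∈ H.E := by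
  constructor
  · intro h
    exact ⟨⟨hp.E h.1, hp.stmp _ h.1 ▸ h.2⟩, h.1⟩
  · intro h
    exact ⟨h.2, (hp.stmp _ h.2).symm ▸ h.1.2⟩

theorem mem_sEvent_of {s : SEv Val Loc Tid Node Wid} (h : s ∈ H.SEvent) : s ∈ G.SEvent :=
  (hp.mem_sEvent.1 h).1

theorem mem_reads {s : SEv Val Loc Tid Node Wid} (h : s ∈ H.Reads) : s ∈ G.Reads :=
  ⟨hp.mem_sEvent_of h.1, h.2⟩

theorem mem_writes {s : SEv Val Loc Tid Node Wid} (h : s ∈ H.Writes) : s ∈ G.Writes :=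
  ⟨hp.mem_sEvent_of h.1, h.2⟩

section

variable [Zero Val] [Add Val] {K : Config Val Loc Tid Node} {W : Witness Val Loc Tid Node Wid}
  (hW : W.WellFormed K G)
include hW

/-- Closedness keeps every source of a surviving read. So no read becomes initial through the
restriction, which the initial-value condition and reads-before both depend on. -/
theorem rf_mem {w r : SEv Val Loc Tid Node Wid} (hr : r ∈ H.Reads) (h : W.rf w r) :
    (W.restrict H.SEvent).rf w r := by
  have hw := (hW.rf_sub _ _ h).1
  exact ⟨hp.mem_sEvent.2 ⟨hw.1, hp.closed w hw r hr (hW.rf_loc _ _ h)⟩, hr.1, h⟩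

theorem wellFormed : (W.restrict H.SEvent).WellFormed K H where
  vR_read s hs := hW.vR_read s (hp.mem_reads hs)
  vR_cas s hs := hW.vR_cas s (hp.mem_reads hs)
  vW_write s hs := hW.vW_write s (hp.mem_writes hs)
  vW_cas s hs := hW.vW_cas s (hp.mem_writes hs)
  copy e a b hab ha hb := hW.copy e a b hab (hp.mem_sEvent_of ha) (hp.mem_sEvent_of hb)
  rf_sub _ _ h := ⟨⟨h.1, (hW.rf_sub _ _ h.2.2).1.2⟩, h.2.1, (hW.rf_sub _ _ h.2.2).2.2⟩
  rf_loc s s' h := hW.rf_loc s s' h.2.2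
  rf_val s s' h := hW.rf_val s s' h.2.2
  rf_fun s₁ s₂ s' h h' := hW.rf_fun s₁ s₂ s' h.2.2 h'.2.2
  rf_init s hs h := hW.rf_init s (hp.mem_reads hs) fun ⟨w, hw⟩ => h ⟨w, hp.rf_mem hW hs hw⟩
  mo_total x := (hW.mo_total x).relOn fun _ =>
    ⟨fun h => ⟨⟨hp.mem_writes h.1, h.2⟩, h.1.1⟩, fun h => ⟨⟨h.2, h.1.1.2⟩, h.1.2⟩⟩
  nfo_sub _ _ h := ⟨h.1, h.2.1⟩
  nfo_total s hs s' hs' hf ht :=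
    (hW.nfo_total s (hp.mem_sEvent_of hs) s' (hp.mem_sEvent_of hs') hf ht).imp
      (⟨hs, hs', ·⟩) (⟨hs', hs, ·⟩)
  rcas_fail e he x y v₁ v₂ d hc hs :=
    hW.rcas_fail e (hp.E he) x y v₁ v₂ d hc ((hp.stmp e he).symm.trans hs)
  rcas_succ e he x y v₁ v₂ d hc hs :=
    hW.rcas_succ e (hp.E he) x y v₁ v₂ d hc ((hp.stmp e he).symm.trans hs)
  rfaa_add e he := hW.rfaa_add e (hp.E he)
  rao_total n := (hW.rao_total n).relOn fun _ =>
    ⟨fun h => ⟨⟨hp.mem_sEvent_of h.1, h.2⟩, h.1⟩, fun h => ⟨h.2, h.1.2⟩⟩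

/-- The delicate case is a read with no source in `H`: by `rf_mem` it has none in `G` either. -/
theorem rb_of {s s' : SEv Val Loc Tid Node Wid} (h : (W.restrict H.SEvent).rb H s s') :
    W.rb G s s' := by
  obtain ⟨hs, hs', h, hl, hne⟩ := h
  refine ⟨hp.mem_reads hs, hp.mem_writes hs', ?_, hl, hne⟩
  rcases h with ⟨w, hw, x, hx⟩ | h
  · exact .inl ⟨w, hw.2.2, x, hx.2.2⟩
  · exact .inr fun ⟨w, hw⟩ => h ⟨w, hp.rf_mem hW hs hw⟩

omit hW [Zero Val] [Add Val] in
theorem iso_of {s s' : SEv Val Loc Tid Node Wid} (h : H.iso s s') : G.iso s s' :=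
  ⟨hp.mem_sEvent_of h.1, hp.mem_sEvent_of h.2.1, h.2.2⟩

omit hW [Zero Val] [Add Val] in
theorem po_of {e e' : Ev Val Loc Tid Node Wid} (h : H.po e e') : G.po e e' :=
  ((hp.po _ _).1 h).2.2

omit hW [Zero Val] [Add Val] in
theorem polls_of {s s' : SEv Val Loc Tid Node Wid} (h : H.polls s s') : G.polls s s' :=
  ⟨hp.mem_sEvent_of h.1, hp.mem_sEvent_of h.2.1, h.2.2.1, hp.po_of h.2.2.2.1, h.2.2.2.2⟩

omit hW [Zero Val] [Add Val] in
theorem ippo_of {s s' : SEv Val Loc Tid Node Wid} (h : H.ippo s s') : G.ippo s s' := by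
  rcases h with h | h
  · exact .inl ⟨hp.mem_sEvent_of h.1, hp.mem_sEvent_of h.2.1, hp.po_of h.2.2.1, h.2.2.2⟩
  · exact .inr ⟨hp.mem_sEvent_of h.1, hp.mem_sEvent_of h.2.1, hp.po_of h.2.2.1, h.2.2.2⟩

theorem ib_of {s s' : SEv Val Loc Tid Node Wid} (h : (W.restrict H.SEvent).ib H s s') :
    W.ib G s s' := by
  refine Relation.TransGen.mono (fun s s' h => ?_) _ _ h
  rcases h with h | h | h | h | h | h | h
  · exact .inl (hp.ippo_of h)
  · exact .inr (.inl (hp.iso_of h))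
  · exact .inr (.inr (.inl h.2.2))
  · exact .inr (.inr (.inr (.inl ⟨hp.polls_of h.1, h.2⟩)))
  · exact .inr (.inr (.inr (.inr (.inl ⟨hp.polls_of h.1, h.2⟩))))
  · exact .inr (.inr (.inr (.inr (.inr (.inl h.2.2)))))
  · exact .inr (.inr (.inr (.inr (.inr (.inr
      ⟨h.1, h.2.1, h.2.2.1.imp hp.po_of hp.po_of, hp.rb_of hW h.2.2.2⟩)))))

omit hp [Add Val] in
omit hW [Zero Val] in
theorem ib_sub {s s' : SEv Val Loc Tid Node Wid} (h : (W.restrict H.SEvent).ib H s s') :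
    s ∈ H.SEvent ∧ s' ∈ H.SEvent := by
  have step : ∀ {s s'}, (H.ippo s s' ∨ H.iso s s' ∨ (W.restrict H.SEvent).rf s s' ∨ H.pfg s s' ∨
      H.pfp s s' ∨ (W.restrict H.SEvent).nfo s s' ∨ (W.restrict H.SEvent).rbi H s s') →
      s ∈ H.SEvent ∧ s' ∈ H.SEvent := by
    rintro s s' ((h | h) | h | h | h | h | h | h)
    · exact ⟨h.1, h.2.1⟩
    · exact ⟨h.1, h.2.1⟩
    · exact ⟨h.1, h.2.1⟩
    · exact ⟨h.1, h.2.1⟩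
    · exact ⟨h.1.1, h.1.2.1⟩
    · exact ⟨h.1.1, h.1.2.1⟩
    · exact ⟨h.1, h.2.1⟩
    · exact ⟨h.2.2.2.1.1, h.2.2.2.2.1.1⟩
  induction h with
  | single h => exact step h
  | tail _ h ih => exact ⟨ih.1, (step h).2⟩

omit hp [Add Val] in
omit hW [Zero Val] in
theorem rdmaSo_sub {s s' : SEv Val Loc Tid Node Wid} (h : (W.restrict H.SEvent).rdmaSo H s s') :
    s ∈ H.SEvent ∧ s' ∈ H.SEvent := by
  rcases h with h | h | h | h | h | ⟨x, h⟩ | ⟨n, h⟩ | ⟨-, r, h, n, h'⟩ | h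
  · exact ⟨h.1, h.2.1⟩
  · exact ⟨h.1.1, h.1.2.1⟩
  · exact ⟨h.1.1, h.1.2.1⟩
  · exact ⟨h.1, h.2.1⟩
  · exact ⟨h.1.1, h.2.1.1⟩
  · exact ⟨h.1, h.2.1⟩
  · exact ⟨h.1, h.2.1⟩
  · exact ⟨h.2.1, h'.2.1⟩
  · exact ib_sub h.2

/-- One inclusion suffices: the smaller execution takes the restricted relation as its `so`, and
only its containment in happens-before has to be transferred. -/
theorem rdmaSo_of {s s' : SEv Val Loc Tid Node Wid} (h : (W.restrict H.SEvent).rdmaSo H s s') :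
    W.rdmaSo G s s' := by
  have hs := rdmaSo_sub h
  rcases h with h | h | h | h | h | ⟨x, h⟩ | ⟨n, h⟩ | ⟨hn, r, h, n, h'⟩ | h
  · exact .inl (hp.iso_of h)
  -- `rfe` excludes internal edges, so this case needs the converse for program order: an edge
  -- internal in `G` with both ends in `H` is internal in `H`.
  · refine .inr (.inl ⟨h.1.2.2, fun hi => h.2 ⟨hi.1, hi.2.1, ?_, h.1⟩⟩)
    exact (hp.po _ _).2 ⟨hs.1.1, hs.2.1, hi.2.2.1⟩
  · exact .inr (.inr (.inl ⟨hp.polls_of h.1, h.2⟩))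
  · exact .inr (.inr (.inr (.inl h.2.2)))
  · exact .inr (.inr (.inr (.inr (.inl (hp.rb_of hW h)))))
  · exact .inr (.inr (.inr (.inr (.inr (.inl ⟨x, h.2.2⟩)))))
  · exact .inr (.inr (.inr (.inr (.inr (.inr (.inl ⟨n, h.2.2⟩))))))
  · exact .inr (.inr (.inr (.inr (.inr (.inr (.inr (.inl ⟨hn, r, hp.iso_of h, n, h'.2.2⟩)))))))
  · exact .inr (.inr (.inr (.inr (.inr (.inr (.inr (.inr ⟨h.1, hp.ib_of hW h.2⟩)))))))

end

end Exec.IsPart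

end Restriction

/-! ### The client execution -/

section Abstraction

variable {Val Loc Tid Node Wid : Type*} [Zero Val] [One Val] [Add Val]

/-- The set of all blocks. -/
def blocksOf (l : Tid → List (Block Val Loc Tid Node Wid)) : Set (Block Val Loc Tid Node Wid) :=
  {b | ∃ t, b ∈ l t}

namespace Block

variable (K : Config Val Loc Tid Node) (A : NLockLayout Loc Tid Wid)

/-- The subevent of a block that stands for the subevent of its client event with stamp `a` at the
end of incoming edges. -/
def entry : Block Val Loc Tid Node Wid → Stamp Node → SEv Val Loc Tid Node Wid
  | client e, a => (e, a)
  | acq d, _ => (d.get K A, .nRR (K.nodeL d.lock))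
  | rel d, .nF n => (d.fence K, .nF n)
  | rel d, a => (d.put K A, a)

/-- The subevent of a block that stands for the subevent of its client event with stamp `a` at the
start of outgoing edges. -/
def exit : Block Val Loc Tid Node Wid → Stamp Node → SEv Val Loc Tid Node Wid
  | client e, a => (e, a)
  | acq d, _ => (d.read' A, .aCR)
  | rel d, .nF n => (d.fence K, .nF n)
  | rel d, a => (d.put K A, a)

end Block

/-- The stamps of the events of the client. -/
def clientStmp (K : Config Val Loc Tid Node) (G : Exe Val Loc Tid Node Wid)
    (e : Ev Val Loc Tid Node Wid) : Set (Stamp Node) :=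
  match e.call with
  | .rdma _ => G.stmp e
  | .acq x => stmpNL K (.acq x : Call Val Loc Node Wid)
  | .rel x => stmpNL K (.rel x : Call Val Loc Node Wid)

/-- The execution of the client implemented by a sequence of blocks, with synchronisation order
`R`. -/
def clientExec (K : Config Val Loc Tid Node) (A : NLockLayout Loc Tid Wid)
    (G : Exe Val Loc Tid Node Wid) (l : Tid → List (Block Val Loc Tid Node Wid))
    (R : SEv Val Loc Tid Node Wid → SEv Val Loc Tid Node Wid → Prop) :
    Exe Val Loc Tid Node Wid where
  E := {e | ∃ b ∈ blocksOf l, b.abs K = e}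
  po e e' := ∃ t, [e, e'].Sublist ((l t).map (Block.abs K))
  stmp := clientStmp K G
  so := R
  hb s s' := ∃ b ∈ blocksOf l, ∃ b' ∈ blocksOf l, b.abs K = s.1 ∧ b'.abs K = s'.1 ∧
    s.2 ∈ clientStmp K G s.1 ∧ s'.2 ∈ clientStmp K G s'.1 ∧ G.hb (b.exit K A s.2) (b'.entry K A s'.2)

omit [Zero Val] [One Val] [Add Val] in
theorem exists_of_client_po {K : Config Val Loc Tid Node} {A : NLockLayout Loc Tid Wid}
    {G : Exe Val Loc Tid Node Wid} {l : Tid → List (Block Val Loc Tid Node Wid)} {R}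
    {e e' : Ev Val Loc Tid Node Wid}
    (he : (clientExec K A G l R).po e e') : ∃ t b b', b.abs K = e ∧ b'.abs K = e' ∧
      [b, b'].Sublist (l t) := by
  obtain ⟨t, hp⟩ := he
  obtain ⟨b₁, b₂, hp, e₁, e₂⟩ := pair_sublist_map hp
  exact ⟨t, b₁, b₂, e₁, e₂, hp⟩

omit [Zero Val] [One Val] [Add Val] in
theorem mem_blocksOf_of_pair {l : Tid → List (Block Val Loc Tid Node Wid)} {t : Tid}
    {b b' : Block Val Loc Tid Node Wid}
    (hp : [b, b'].Sublist (l t)) : b ∈ blocksOf l ∧ b' ∈ blocksOf l :=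
  ⟨⟨t, hp.subset (by simp)⟩, t, hp.subset (by simp)⟩

namespace Refines

variable {K : Config Val Loc Tid Node} {A : NLockLayout Loc Tid Wid} {Lk : Set Loc}
  {G : Exe Val Loc Tid Node Wid} {W : Witness Val Loc Tid Node Wid}
  {l : Tid → List (Block Val Loc Tid Node Wid)} (h : Refines K A Lk G W l)
include h

theorem mem_of_mem_blocksOf {b : Block Val Loc Tid Node Wid} (hb : b ∈ blocksOf l) :
    b ∈ l (b.abs K).tid := by
  obtain ⟨t, hb⟩ := hb
  rwa [Block.abs_tid (h.ok t b hb)]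

theorem ok_of_mem {b : Block Val Loc Tid Node Wid} (hb : b ∈ blocksOf l) :
    b.Ok A Lk (b.abs K).tid := h.ok _ b (h.mem_of_mem_blocksOf hb)

theorem client_stmp {e : Ev Val Loc Tid Node Wid} (hb : .client e ∈ blocksOf l) :
    clientStmp K G e = G.stmp e := by
  obtain ⟨-, c, hc⟩ := h.ok_of_mem hb
  simp [clientStmp, hc]

theorem abs_inj {b b' : Block Val Loc Tid Node Wid} (hb : b ∈ blocksOf l) (hb' : b' ∈ blocksOf l)
    (e : b.abs K = b'.abs K) : b = b' :=
  h.eq_of_abs_eq (h.mem_of_mem_blocksOf hb) (h.mem_of_mem_blocksOf hb') e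

theorem client_mem_E {e : Ev Val Loc Tid Node Wid} (hb : .client e ∈ blocksOf l) : e ∈ G.E :=
  h.mem_E_of_mem (h.mem_of_mem_blocksOf hb) (by simp [Block.conc])

/-- Entering an acquire at `nRR` instead of `aMF` loses no preserved program order: the stamps
ordered before `aMF` are CPU stamps and `GF`, and these are also ordered before `nRR`. -/
theorem entry_mem {b : Block Val Loc Tid Node Wid} (hb : b ∈ blocksOf l) {a : Stamp Node}
    (ha : a ∈ clientStmp K G (b.abs K)) :
    b.entry K A a ∈ G.SEvent ∧ (b.entry K A a).1 ∈ b.conc K A ∧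
      ∀ a' : Stamp Node, a'.sto a → a'.sto (b.entry K A a).2 := by
  have hb' := h.mem_of_mem_blocksOf hb
  cases b with
  | client e =>
    exact ⟨⟨h.client_mem_E hb, h.client_stmp hb ▸ ha⟩, by simp [Block.entry, Block.conc],
      fun _ => id⟩
  | acq d =>
    obtain rfl : a = .aMF := ha
    refine ⟨(h.get_mem hb').2 (by simp), by simp [Block.entry, Block.conc, AcqRun.events], ?_⟩
    intro a' ha'
    cases a' <;> trivial
  | rel d =>
    have ha' : a = .nF (K.nodeL d.lock) ∨ a = .nRW (K.nodeL d.lock) := ha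
    rcases ha' with rfl | rfl
    · exact ⟨h.fence_mem hb', by simp [Block.entry, Block.conc], fun _ => id⟩
    · exact ⟨(h.put_mem hb').2 (by simp), by simp [Block.entry, Block.conc], fun _ => id⟩

/-- The exit stamp `aCR` of an acquire is ordered before every stamp. The comparison of entry with
exit allows happens-before to be composed through a block. -/
theorem exit_mem {b : Block Val Loc Tid Node Wid} (hb : b ∈ blocksOf l) {a : Stamp Node}
    (ha : a ∈ clientStmp K G (b.abs K)) :
    b.exit K A a ∈ G.SEvent ∧ (b.exit K A a).1 ∈ b.conc K A ∧
      (∀ a' : Stamp Node, a.sto a' → (b.exit K A a).2.sto a') ∧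
      (b.entry K A a = b.exit K A a ∨ G.hb (b.entry K A a) (b.exit K A a)) := by
  have hb' := h.mem_of_mem_blocksOf hb
  cases b with
  | client e =>
    exact ⟨⟨h.client_mem_E hb, h.client_stmp hb ▸ ha⟩, by simp [Block.exit, Block.conc],
      fun _ => id, .inl rfl⟩
  | acq d =>
    exact ⟨h.read'_mem hb', by simp [Block.exit, Block.conc, AcqRun.events], fun _ _ => trivial,
      .inr (h.get_rr_hb_read' hb')⟩
  | rel d =>
    have ha' : a = .nF (K.nodeL d.lock) ∨ a = .nRW (K.nodeL d.lock) := ha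
    rcases ha' with rfl | rfl
    · exact ⟨h.fence_mem hb', by simp [Block.exit, Block.conc], fun _ => id, .inl rfl⟩
    · exact ⟨(h.put_mem hb').2 (by simp), by simp [Block.exit, Block.conc], fun _ => id, .inl rfl⟩

/-- Program order of the client execution, in terms of blocks. -/
theorem client_po_iff {R} {b b' : Block Val Loc Tid Node Wid} (hb : b ∈ blocksOf l)
    (hb' : b' ∈ blocksOf l) : (clientExec K A G l R).po (b.abs K) (b'.abs K) ↔
      ∃ t, [b, b'].Sublist (l t) := by
  constructor
  · intro hp
    obtain ⟨t, b₁, b₂, e₁, e₂, hlt⟩ := exists_of_client_po hp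
    have hm := mem_blocksOf_of_pair hlt
    exact ⟨t, h.abs_inj hm.1 hb e₁ ▸ h.abs_inj hm.2 hb' e₂ ▸ hlt⟩
  · rintro ⟨t, hp⟩
    exact ⟨t, hp.map (Block.abs K)⟩

/-- Every requirement on the pulled-back happens-before follows from the entry and exit points,
apart from containing `so`, which is left as the hypothesis `hR`. -/
theorem client_isExecution {R}
    (hR : ∀ s s', R s s' → (clientExec K A G l R).hb s s') :
    (clientExec K A G l R).IsExecution := by
  have hb_sub : ∀ s s', (clientExec K A G l R).hb s s' →
      s ∈ (clientExec K A G l R).SEvent ∧ s' ∈ (clientExec K A G l R).SEvent := by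
    rintro s s' ⟨b, hb, b', hb', e, e', hs, hs', -⟩
    exact ⟨⟨⟨b, hb, e⟩, hs⟩, ⟨b', hb', e'⟩, hs'⟩
  have po_thread : ∀ a b, (clientExec K A G l R).po a b → a.tid = b.tid := by
    intro e e' he
    obtain ⟨t, b, b', rfl, rfl, hp⟩ := exists_of_client_po he
    rw [Block.abs_tid (h.ok t b (hp.subset (by simp))),
      Block.abs_tid (h.ok t b' (hp.subset (by simp)))]
  have po_sub : ∀ a b, (clientExec K A G l R).po a b →
      a ∈ (clientExec K A G l R).E ∧ b ∈ (clientExec K A G l R).E := by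
    intro e e' he
    obtain ⟨t, b, b', rfl, rfl, hp⟩ := exists_of_client_po he
    exact ⟨⟨b, (mem_blocksOf_of_pair hp).1, rfl⟩, b', (mem_blocksOf_of_pair hp).2, rfl⟩
  refine ⟨po_thread, po_sub, fun t => ⟨?_, ?_, ?_, ?_⟩, ?_, fun s s' hs => hb_sub _ _ (hR _ _ hs),
    hb_sub, ?_, ?_, hR, ?_⟩
  · rintro e e' ⟨he, he', hp⟩
    exact ⟨⟨(po_sub _ _ hp).1, he⟩, (po_sub _ _ hp).2, he'⟩
  · rintro e ⟨-, -, hp⟩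
    obtain ⟨t, b, b', rfl, e, hp⟩ := exists_of_client_po hp
    obtain rfl := h.abs_inj (mem_blocksOf_of_pair hp).2 (mem_blocksOf_of_pair hp).1 e
    exact h.not_pair_self hp
  · rintro e₁ e₂ e₃ ⟨he₁, -, hp⟩ ⟨-, he₃, hp'⟩
    refine ⟨he₁, he₃, ?_⟩
    obtain ⟨t, b₁, b₂, rfl, rfl, hlt⟩ := exists_of_client_po hp
    obtain ⟨t', b₂', b₃, e, rfl, hlt'⟩ := exists_of_client_po hp'
    obtain rfl := h.abs_inj (mem_blocksOf_of_pair hlt').1 (mem_blocksOf_of_pair hlt).2 e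
    exact ⟨t, (h.pair_trans hlt hlt').map (Block.abs K)⟩
  · rintro e ⟨⟨b, hb, rfl⟩, ht⟩ e' ⟨⟨b', hb', rfl⟩, ht'⟩ hne
    have m := h.mem_of_mem_blocksOf hb
    have m' := h.mem_of_mem_blocksOf hb'
    obtain rfl : (b.abs K).tid = t := ht
    have ht' : (b'.abs K).tid = (b.abs K).tid := ht'
    rw [ht'] at m'
    rcases pair_sublist_trichotomy m m' with e | e | e
    · exact absurd (congrArg _ e) hne
    · exact .inl ⟨rfl, ht', _, e.map (Block.abs K)⟩
    · exact .inr ⟨ht', rfl, _, e.map (Block.abs K)⟩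
  · rintro e ⟨b, hb, rfl⟩
    cases b with
    | client e =>
      change (clientStmp K G e).Nonempty
      rw [h.client_stmp hb]
      exact h.isExecution.stmp_nonempty _ (h.client_mem_E hb)
    | acq d => exact ⟨.aMF, rfl⟩
    | rel d => exact ⟨.nF (K.nodeL d.lock), .inl rfl⟩
  · rintro s ⟨b, hb, b', hb', e, e', hs, -, hh⟩
    -- A reflexive edge would lead from the exit of a subevent back to its own entry.
    obtain rfl := h.abs_inj hb hb' (e.trans e'.symm)
    rcases (h.exit_mem hb (e.symm ▸ hs)).2.2.2 with e | e
    · rw [e] at hh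
      exact h.isExecution.hb_irrefl _ hh
    · exact h.hb_asymm e hh
  · rintro s₁ s₂ s₃ ⟨b₁, hb₁, b₂, hb₂, e₁, e₂, hs₁, hs₂, hh⟩ ⟨b₂', hb₂', b₃, hb₃, e₂', e₃, -, hs₃, hh'⟩
    obtain rfl := h.abs_inj hb₂ hb₂' (e₂.trans e₂'.symm)
    refine ⟨b₁, hb₁, b₃, hb₃, e₁, e₃, hs₁, hs₃, ?_⟩
    rcases (h.exit_mem hb₂ (e₂.symm ▸ hs₂)).2.2.2 with e | e
    · rw [e] at hh
      exact h.hb_trans hh hh'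
    · exact h.hb_trans hh (h.hb_trans e hh')
  · rintro ⟨-, a⟩ ⟨-, a'⟩ ⟨⟨⟨b, hb, rfl⟩, hs⟩, ⟨⟨b', hb', rfl⟩, hs'⟩, hp, hsto⟩
    refine ⟨b, hb, b', hb', rfl, rfl, hs, hs', ?_⟩
    obtain ⟨t, hp⟩ := (h.client_po_iff hb hb').1 hp
    obtain ⟨m, c, st, -⟩ := h.exit_mem hb hs
    obtain ⟨m', c', st'⟩ := h.entry_mem hb' hs'
    exact h.hb_of_po m m' (h.po_of_pair hp c c') (st' _ (st _ hsto))

end Refines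

end Abstraction

/-! ### Consistency of the client execution -/

/-- Closedness compares sets of locations. A read must have an actual location for a write with the
same set to share one with it. -/
theorem RdmaCall.sloc_nonempty {Val Loc Tid Node Wid : Type*} {K : Config Val Loc Tid Node}
    {w : Val} {c : RdmaCall Val Loc Node Wid} {S : Set (Stamp Node)} (hS : S ∈ c.stamps K w)
    {a : Stamp Node} (ha : a ∈ S) (hr : a.IsRead) : (c.sloc a).Nonempty := by
  cases c with
  | mfence =>
    obtain rfl : S = {.aMF} := hS
    obtain rfl : a = .aMF := ha
    exact hr.elim
  | wait d =>
    obtain rfl : S = {.aWT} := hS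
    obtain rfl : a = .aWT := ha
    exact hr.elim
  | rfence n =>
    obtain rfl : S = {.nF n} := hS
    obtain rfl : a = .nF n := ha
    exact hr.elim
  | _ => cases a <;> simp [RdmaCall.sloc, RdmaCall.loc]

section Abstraction

variable {Val Loc Tid Node Wid : Type*} [Zero Val] [One Val] [Add Val]

/-- The synchronisation between the operations of node locks. -/
def lockSo (K : Config Val Loc Tid Node) (A : NLockLayout Loc Tid Wid)
    (W : Witness Val Loc Tid Node Wid) (l : Tid → List (Block Val Loc Tid Node Wid))
    (s s' : SEv Val Loc Tid Node Wid) : Prop :=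
  (∃ q, .rel q ∈ blocksOf l ∧ s = ((Block.rel q).abs K, .nF (K.nodeL q.lock)) ∧
    s' = ((Block.rel q).abs K, .nRW (K.nodeL q.lock))) ∨
  ∃ d d' q, ticketOrder K A W l q.lock d d' ∧ Paired l d q ∧
    s = ((Block.rel q).abs K, .nRW (K.nodeL q.lock)) ∧ s' = ((Block.acq d').abs K, .aMF)

/-- The part of the client execution that belongs to the node lock library. -/
abbrev lockPart (K : Config Val Loc Tid Node) (A : NLockLayout Loc Tid Wid) (Lk : Set Loc)
    (G : Exe Val Loc Tid Node Wid) (l : Tid → List (Block Val Loc Tid Node Wid))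
    (R : SEv Val Loc Tid Node Wid → SEv Val Loc Tid Node Wid → Prop) : Exe Val Loc Tid Node Wid :=
  (clientExec K A G l R).restrict (nlockLib (Tid := Tid) K Lk).M

/-- The part of the client execution that belongs to the RDMA library. -/
abbrev rdmaPart (K : Config Val Loc Tid Node) (A : NLockLayout Loc Tid Wid)
    (G : Exe Val Loc Tid Node Wid) (l : Tid → List (Block Val Loc Tid Node Wid))
    (R : SEv Val Loc Tid Node Wid → SEv Val Loc Tid Node Wid → Prop) : Exe Val Loc Tid Node Wid :=
  (clientExec K A G l R).restrict (rdmaLib (Tid := Tid) K).M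

namespace Refines

variable {K : Config Val Loc Tid Node} {A : NLockLayout Loc Tid Wid} {Lk : Set Loc}
  {G : Exe Val Loc Tid Node Wid} {W : Witness Val Loc Tid Node Wid}
  {l : Tid → List (Block Val Loc Tid Node Wid)}
  {R : SEv Val Loc Tid Node Wid → SEv Val Loc Tid Node Wid → Prop}
  (h : Refines K A Lk G W l)
include h

omit h [One Val] in
theorem mem_rdmaPart {e : Ev Val Loc Tid Node Wid} :
    e ∈ (rdmaPart K A G l R).E ↔ .client e ∈ blocksOf l ∧ ∃ c, e.call = .rdma c := by
  constructor
  · rintro ⟨⟨b, hb, rfl⟩, c, hc⟩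
    cases b with
    | client e => exact ⟨hb, c, hc.symm⟩
    | acq d => simp [Block.abs] at hc
    | rel d => simp [Block.abs] at hc
  · rintro ⟨hb, c, hc⟩
    exact ⟨⟨_, hb, rfl⟩, c, hc.symm⟩

theorem client_call {e : Ev Val Loc Tid Node Wid} (hb : .client e ∈ blocksOf l) :
    ∃ c, e.call = .rdma c := (h.ok_of_mem hb).2

/-- Events of lock runs access only cells of the implementation, so any event touching another
location belongs to the client. -/
theorem cell_of_loc {b : Block Val Loc Tid Node Wid} (hb : b ∈ blocksOf l)
    {e : Ev Val Loc Tid Node Wid} (he : e ∈ b.conc K A) {y : Loc} (hy : y ∈ e.call.loc) :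
    b = .client e ∨ ∃ x ∈ Lk, ∃ c, y = A.cell x c := by
  have hok := h.ok_of_mem hb
  cases b with
  | client e' =>
    left
    simpa [Block.conc, eq_comm] using he
  | acq d =>
    right
    obtain ⟨-, hlk, hpoll⟩ := hok
    have htemp : ∀ y, y = d.temp A → ∃ x ∈ Lk, ∃ c, y = A.cell x c := fun y hy => ⟨_, hlk, _, hy⟩
    have hrel : ∀ y, y = A.cell d.lock .release → ∃ x ∈ Lk, ∃ c, y = A.cell x c :=
      fun y hy => ⟨_, hlk, _, hy⟩
    simp only [Block.conc, AcqRun.events, List.cons_append, List.nil_append, List.mem_cons,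
      List.mem_append, List.not_mem_nil, or_false] at he
    rcases he with rfl | rfl | rfl | hp | rfl | rfl | rfl | rfl
    · rcases hy with hy | hy
      · exact htemp y hy
      · exact ⟨_, hlk, _, hy⟩
    · exact hy.elim
    · exact htemp y hy
    · rcases (hpoll e hp).2 with hc | hc | hc <;> rw [hc] at hy
      · exact hy.elim (htemp y) (hrel y)
      · exact hy.elim
      · exact ⟨_, hlk, _, hy⟩
    · exact hy.elim (htemp y) (hrel y)
    · exact hy.elim
    · exact htemp y hy
    · exact htemp y hy
  | rel d =>
    right
    simp only [Block.conc, List.mem_cons, List.not_mem_nil, or_false] at he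
    rcases he with rfl | rfl
    · exact hy.elim
    · rcases hy with hy | hy
      · exact ⟨_, hok.2, _, hy⟩
      · exact ⟨_, hok.2, _, hy⟩

/-- Closedness is where freshness of the cells enters: a write sharing a location with a client read
cannot belong to a lock run. -/
theorem rdmaPart_isPart : (rdmaPart K A G l R).IsPart G where
  E e he := h.client_mem_E (mem_rdmaPart.1 he).1
  po e e' := by
    constructor
    · rintro ⟨he, he', hp⟩
      have m := (mem_rdmaPart.1 he).1
      have m' := (mem_rdmaPart.1 he').1
      obtain ⟨t, hlt⟩ := (h.client_po_iff m m').1 hp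
      exact ⟨he, he', h.po_of_pair hlt (by simp [Block.conc]) (by simp [Block.conc])⟩
    · rintro ⟨he, he', hp⟩
      refine ⟨he, he', ?_⟩
      have m := (mem_rdmaPart.1 he).1
      have m' := (mem_rdmaPart.1 he').1
      refine (h.client_po_iff m m').2 ⟨e.tid, ?_⟩
      have hm : .client e ∈ l e.tid := h.mem_of_mem_blocksOf m
      have hm' : .client e' ∈ l e.tid := by
        rw [h.isExecution.po_thread _ _ hp]
        exact h.mem_of_mem_blocksOf m'
      rcases pair_sublist_trichotomy hm hm' with hlt | hlt | hlt
      · simp only [Block.client.injEq] at hlt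
        subst hlt
        exact absurd hp (h.po_irrefl e)
      · exact hlt
      · have := h.po_of_pair hlt (e := e') (e' := e) (by simp [Block.conc]) (by simp [Block.conc])
        exact absurd (h.po_trans hp this) (h.po_irrefl e)
  stmp e he := h.client_stmp (mem_rdmaPart.1 he).1
  closed w hw r hr hl := by
    obtain ⟨m, c, hc⟩ := mem_rdmaPart.1 hr.1.1
    have hr' : r.1 ∈ G.E := h.client_mem_E m
    obtain ⟨c', hc', -, -, hst⟩ := h.rdma _ hr'
    obtain rfl : c = c' := by simpa using hc.symm.trans hc'
    have hst' : r.2 ∈ G.stmp r.1 := h.client_stmp m ▸ hr.1.2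
    obtain ⟨y, hy⟩ := RdmaCall.sloc_nonempty hst hst' hr.2
    have hyr : y ∈ SubEvent.loc r := by
      change y ∈ r.1.call.sloc r.2
      rw [hc]
      exact hy
    obtain ⟨t, b, hb, hwb⟩ := (h.mem_E w.1).1 hw.1.1
    rcases h.cell_of_loc ⟨t, hb⟩ hwb (Call.sloc_subset _ _ (hl ▸ hyr : y ∈ SubEvent.loc w)) with
      rfl | ⟨x, hx, c, rfl⟩
    · exact mem_rdmaPart.2 ⟨⟨t, hb⟩, h.client_call ⟨t, hb⟩⟩
    · exact absurd (Call.sloc_subset _ _ hyr) (h.fresh _ _ (h.mem_of_mem_blocksOf m) x hx c)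

theorem mem_evAt {x : Loc} {e : Ev Val Loc Tid Node Wid} :
    e ∈ (lockPart K A Lk G l R).EvAt x ↔
      (∃ d, .acq d ∈ blocksOf l ∧ d.lock = x ∧ (Block.acq d).abs K = e) ∨
      ∃ q, .rel q ∈ blocksOf l ∧ q.lock = x ∧ (Block.rel q).abs K = e := by
  constructor
  · rintro ⟨⟨⟨b, hb, rfl⟩, y, -, hc⟩, hx⟩
    cases b with
    | client e =>
      obtain ⟨c, hc'⟩ := h.client_call hb
      simp [Block.abs, hc'] at hc
    | acq d => exact .inl ⟨d, hb, hx.symm, rfl⟩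
    | rel q => exact .inr ⟨q, hb, hx.symm, rfl⟩
  · rintro (⟨d, hb, rfl, rfl⟩ | ⟨q, hb, rfl, rfl⟩)
    · exact ⟨⟨⟨_, hb, rfl⟩, d.lock, (h.ok_of_mem hb).2.1, .inl rfl⟩, rfl⟩
    · exact ⟨⟨⟨_, hb, rfl⟩, q.lock, (h.ok_of_mem hb).2, .inr rfl⟩, rfl⟩

theorem poAt_iff {x : Loc} {b b' : Block Val Loc Tid Node Wid} (hb : b ∈ blocksOf l)
    (hb' : b' ∈ blocksOf l) (hx : b.abs K ∈ (lockPart K A Lk G l R).EvAt x)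
    (hx' : b'.abs K ∈ (lockPart K A Lk G l R).EvAt x) :
    relOn ((lockPart K A Lk G l R).EvAt x) (lockPart K A Lk G l R).po (b.abs K) (b'.abs K) ↔
      ∃ t, [b, b'].Sublist (l t) := by
  rw [← h.client_po_iff (R := R) hb hb']
  exact ⟨fun hp => hp.2.2.2.2, fun hp => ⟨hx, hx', hx.1, hx'.1, hp⟩⟩

/-- The lock part has only acquires and releases at `x`, so immediacy amounts to excluding these two
kinds in between, as `Paired` does. -/
theorem paired_iff {d : AcqRun Val Loc Tid Node Wid} {q : RelRun Loc Tid} {x : Loc}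
    (hd : .acq d ∈ blocksOf l) (hq : .rel q ∈ blocksOf l) (hdx : d.lock = x) (hqx : q.lock = x) :
    (lockPart K A Lk G l R).immPoAt x ((Block.acq d).abs K) ((Block.rel q).abs K) ↔
      Paired l d q := by
  have mem_acq : ∀ d, .acq d ∈ blocksOf l → d.lock = x →
      (Block.acq d).abs K ∈ (lockPart K A Lk G l R).EvAt x :=
    fun d hd hx => h.mem_evAt.2 (.inl ⟨d, hd, hx, rfl⟩)
  have mem_rel : ∀ q, .rel q ∈ blocksOf l → q.lock = x →
      (Block.rel q).abs K ∈ (lockPart K A Lk G l R).EvAt x :=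
    fun q hq hx => h.mem_evAt.2 (.inr ⟨q, hq, hx, rfl⟩)
  have md := mem_acq d hd hdx
  have mq := mem_rel q hq hqx
  constructor
  · rintro ⟨hp, him⟩
    obtain ⟨t, hlt⟩ := (h.poAt_iff hd hq md mq).1 hp
    obtain rfl : q.tid = t := (h.ok t (.rel q) (hlt.subset (by simp))).1
    refine ⟨hqx.trans hdx.symm, hlt, fun d' hd' h₁ h₂ => ?_, fun q' hq' h₁ h₂ => ?_⟩
    · have m' := (mem_blocksOf_of_pair h₁).2
      have mm := mem_acq d' m' (hd'.trans hdx)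
      exact him ⟨_, (h.poAt_iff hd m' md mm).2 ⟨_, h₁⟩, (h.poAt_iff m' hq mm mq).2 ⟨_, h₂⟩⟩
    · have m' := (mem_blocksOf_of_pair h₁).2
      have mm := mem_rel q' m' (hq'.trans hdx)
      exact him ⟨_, (h.poAt_iff hd m' md mm).2 ⟨_, h₁⟩, (h.poAt_iff m' hq mm mq).2 ⟨_, h₂⟩⟩
  · intro hp
    refine ⟨(h.poAt_iff hd hq md mq).2 ⟨_, hp.lt⟩, ?_⟩
    rintro ⟨e, h₁, h₂⟩
    have thr : ∀ {t} {b : Block Val Loc Tid Node Wid}, [b, .rel q].Sublist (l t) →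
        [b, .rel q].Sublist (l q.tid) := by
      intro t b hb
      rwa [show q.tid = t from (h.ok t (.rel q) (hb.subset (by simp))).1]
    have thr' : ∀ {t} {b : Block Val Loc Tid Node Wid}, [.acq d, b].Sublist (l t) →
        [.acq d, b].Sublist (l q.tid) := by
      intro t b hb
      rwa [← (h.ok q.tid (.acq d) (hp.lt.subset (by simp))).1,
        show d.tid = t from (h.ok t (.acq d) (hb.subset (by simp))).1]
    rcases h.mem_evAt.1 h₁.2.1 with ⟨d', m', hx, rfl⟩ | ⟨q', m', hx, rfl⟩
    · obtain ⟨t, hlt⟩ := (h.poAt_iff hd m' md h₁.2.1).1 h₁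
      obtain ⟨t', hlt'⟩ := (h.poAt_iff m' hq h₁.2.1 mq).1 h₂
      exact hp.acq d' (hx.trans hdx.symm) (thr' hlt) (thr hlt')
    · obtain ⟨t, hlt⟩ := (h.poAt_iff hd m' md h₁.2.1).1 h₁
      obtain ⟨t', hlt'⟩ := (h.poAt_iff m' hq h₁.2.1 mq).1 h₂
      exact hp.rel q' (hx.trans hdx.symm) (thr' hlt) (thr hlt')

/-- In a lock-well-formed execution every release is paired with an acquire. -/
theorem exists_paired (hwf : (lockPart K A Lk G l R).LockWellFormed) {q : RelRun Loc Tid}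
    (hq : .rel q ∈ blocksOf l) : ∃ d, .acq d ∈ blocksOf l ∧ d.lock = q.lock ∧ Paired l d q := by
  obtain ⟨a, ha, hc, him⟩ := (hwf q.lock).2 _ (h.mem_evAt.2 (.inr ⟨q, hq, rfl, rfl⟩)) rfl
  rcases h.mem_evAt.1 ha with ⟨d, hd, hx, rfl⟩ | ⟨q', hq', hx, rfl⟩
  · exact ⟨d, hd, hx, (h.paired_iff hd hq hx rfl).1 him⟩
  · simp [Block.abs] at hc

/-- In a lock-well-formed execution, the operation that immediately follows an acquire is a
release. -/
theorem eq_rel_of_immPoAt (hwf : (lockPart K A Lk G l R).LockWellFormed)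
    {d : AcqRun Val Loc Tid Node Wid} (hd : .acq d ∈ blocksOf l) {x : Loc} (hx : d.lock = x)
    {e : Ev Val Loc Tid Node Wid}
    (he : (lockPart K A Lk G l R).immPoAt x ((Block.acq d).abs K) e) :
    ∃ q, .rel q ∈ blocksOf l ∧ q.lock = x ∧ (Block.rel q).abs K = e := by
  obtain ⟨hp, him⟩ := he
  rcases h.mem_evAt.1 hp.2.1 with ⟨d', hd', hx', rfl⟩ | hq
  · obtain ⟨t, hlt⟩ := (h.poAt_iff hd hd' hp.1 hp.2.1).1 hp
    obtain ⟨r, hr, hc, hp', him'⟩ := (hwf x).1 _ hp.1 (congrArg Call.acq hx)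
    rcases h.mem_evAt.1 hr with ⟨d₁, -, -, rfl⟩ | ⟨q, hq, hqx, rfl⟩
    · simp [Block.abs] at hc
    obtain ⟨t', hlt'⟩ := (h.poAt_iff hd hq hp.1 hr).1 hp'
    obtain rfl : t = t' := (h.ok t (.acq d) (hlt.subset (by simp))).1.symm.trans
      (h.ok t' (.acq d) (hlt'.subset (by simp))).1
    -- Both `d'` and the release `q` are immediate successors of `d`; whichever comes first
    -- contradicts immediacy of the other.
    rcases pair_sublist_trichotomy (hlt.subset (by simp) : Block.acq d' ∈ l t)
      (hlt'.subset (by simp) : Block.rel q ∈ l t) with e | e | e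
    · simp at e
    · exact absurd ⟨_, hp, (h.poAt_iff hd' hq hp.2.1 hr).2 ⟨t, e⟩⟩ him'
    · exact absurd ⟨_, hp', (h.poAt_iff hq hd' hr hp.2.1).2 ⟨t, e⟩⟩ him
  · exact hq

/-- Inside a release the fence is stamp-ordered before the remote write; between runs the edge is
`put_hb_get`. Lock-well-formedness supplies an acquire for every release, as that induction
requires. -/
theorem lockSo_hb [Finite Tid] (hVal : Function.Injective fun k : ℕ => (fun v : Val => v + 1)^[k] 0)
    (hwf : (lockPart K A Lk G l R).LockWellFormed) {s s' : SEv Val Loc Tid Node Wid}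
    (hs : lockSo K A W l s s') : (clientExec K A G l R).hb s s' := by
  rcases hs with ⟨q, hq, rfl, rfl⟩ | ⟨d, d', q, hdd, hp, rfl, rfl⟩
  · have hq' := h.mem_of_mem_blocksOf hq
    refine ⟨_, hq, _, hq, rfl, rfl, .inl rfl, .inr rfl, ?_⟩
    exact h.hb_of_po (h.fence_mem hq') ((h.put_mem hq').2 (by simp))
      (h.po_of_mem hq' (by simp [Block.conc, Block.exit, Block.entry])) rfl
  · have hq : .rel q ∈ blocksOf l := (mem_blocksOf_of_pair hp.lt).2
    have hd' := hdd.2.1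
    refine ⟨_, hq, _, ⟨_, hd'.1⟩, rfl, rfl, .inr rfl, rfl, ?_⟩
    have := h.put_hb_get hVal (x := q.lock) (fun q' hq' _ => by
      obtain ⟨d, -, -, hp⟩ := h.exists_paired hwf ⟨_, hq'⟩
      exact ⟨d, hp⟩) hdd hp
    change G.hb (q.put K A, .nRW (K.nodeL q.lock)) (d'.get K A, .nRR (K.nodeL d'.lock))
    rwa [hd'.2]

/-- The lock order is the image of the ticket order under the collapsing of blocks, which is
injective on runs. -/
theorem lockPart_consistent (hR : ∀ s s', (lockPart K A Lk G l R).LockWellFormed →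
      ((lockPart K A Lk G l R).so s s' ↔ lockSo K A W l s s')) :
    (lockPart K A Lk G l R).NLockConsistent K := by
  intro hwf
  refine ⟨?_, fun x e e' => ∃ d d', ticketOrder K A W l x d d' ∧ (Block.acq d).abs K = e ∧
    (Block.acq d').abs K = e', fun x => ?_, fun s s' => (hR s s' hwf).trans ?_⟩
  · rintro e ⟨⟨b, hb, rfl⟩, y, -, hc⟩
    cases b with
    | client e =>
      obtain ⟨c, hc'⟩ := h.client_call hb
      simp [Block.abs, hc'] at hc
    | acq d => exact ⟨rfl, rfl⟩
    | rel q => exact ⟨rfl, rfl⟩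
  · have ord := h.ticketOrder_strictTotalOn x
    have mem : ∀ d ∈ runsOf l x, (Block.acq d).abs K ∈
        {e ∈ (lockPart K A Lk G l R).EvAt x | e.call = .acq x} := fun d hd =>
      ⟨h.mem_evAt.2 (.inl ⟨d, ⟨_, hd.1⟩, hd.2, rfl⟩), congrArg Call.acq hd.2⟩
    have mem' : ∀ e ∈ {e ∈ (lockPart K A Lk G l R).EvAt x | e.call = .acq x},
        ∃ d ∈ runsOf l x, (Block.acq d).abs K = e := by
      rintro e ⟨he, hc⟩
      rcases h.mem_evAt.1 he with ⟨d, hd, hx, rfl⟩ | ⟨q, hq, hx, rfl⟩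
      · exact ⟨d, ⟨h.mem_of_mem_blocksOf hd, hx⟩, rfl⟩
      · simp [Block.abs] at hc
    have inj : ∀ d ∈ runsOf l x, ∀ d' ∈ runsOf l x,
        (Block.acq d).abs K = (Block.acq d').abs K → d = d' := fun d hd d' hd' e => by
      simpa using h.abs_inj ⟨_, hd.1⟩ ⟨_, hd'.1⟩ e
    refine ⟨?_, ?_, ?_, ?_⟩
    · rintro _ _ ⟨d, d', hdd, rfl, rfl⟩
      exact ⟨mem d hdd.1, mem d' hdd.2.1⟩
    · rintro _ ⟨d, d', hdd, rfl, e⟩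
      obtain rfl := inj d' hdd.2.1 d hdd.1 e
      exact ord.irrefl _ hdd
    · rintro _ _ _ ⟨d₁, d₂, h₁, rfl, rfl⟩ ⟨d₂', d₃, h₂, e, rfl⟩
      obtain rfl := inj d₂' h₂.1 d₂ h₁.2.1 e
      exact ⟨d₁, d₃, ord.trans _ _ _ h₁ h₂, rfl, rfl⟩
    · intro e he e' he' hne
      obtain ⟨d, hd, rfl⟩ := mem' e he
      obtain ⟨d', hd', rfl⟩ := mem' e' he'
      rcases ord.total d hd d' hd' (fun e => hne (by rw [e])) with hlt | hlt
      · exact .inl ⟨d, d', hlt, rfl, rfl⟩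
      · exact .inr ⟨d', d, hlt, rfl, rfl⟩
  · constructor
    · rintro (⟨q, hq, rfl, rfl⟩ | ⟨d, d', q, hdd, hp, rfl, rfl⟩)
      · exact .inl ⟨_, (h.mem_evAt.2 (.inr ⟨q, hq, rfl, rfl⟩)).1, q.lock, rfl, rfl, rfl⟩
      · refine .inr ⟨q.lock, _, _, rfl, rfl, _, ?_, d, d', hdd, rfl, rfl⟩
        exact (h.paired_iff ⟨_, hdd.1.1⟩ (mem_blocksOf_of_pair hp.lt).2 hdd.1.2 rfl).2 hp
    · rintro (⟨e, he, x, hc, rfl, rfl⟩ | ⟨x, e₁, e₂, rfl, rfl, e₀, him, d, d', hdd, rfl, rfl⟩)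
      · have hx : x ∈ e.call.loc := by rw [hc]; rfl
        rcases h.mem_evAt.1 ⟨he, hx⟩ with ⟨d, hd, hx, rfl⟩ | ⟨q, hq, rfl, rfl⟩
        · simp [Block.abs] at hc
        · exact .inl ⟨q, hq, rfl, rfl⟩
      · have hd : .acq d ∈ blocksOf l := ⟨_, hdd.1.1⟩
        obtain ⟨q, hq, rfl, rfl⟩ := h.eq_rel_of_immPoAt hwf hd hdd.1.2 him
        exact .inr ⟨d, d', q, hdd, (h.paired_iff hd hq hdd.1.2 rfl).1 him, rfl, rfl⟩

/-- The client execution of a refinement is consistent, for a suitable synchronisation order. -/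
theorem exists_consistent [Finite Tid]
    (hVal : Function.Injective fun k : ℕ => (fun v : Val => v + 1)^[k] 0) :
    ∃ R, Consistent {nlockLib K Lk, rdmaLib K} (clientExec K A G l R) := by
  let W' := W.restrict (rdmaPart K A G l fun _ _ => False).SEvent
  let R : SEv Val Loc Tid Node Wid → SEv Val Loc Tid Node Wid → Prop := fun s s' =>
    W'.rdmaSo (rdmaPart K A G l fun _ _ => False) s s' ∨
      (lockPart K A Lk G l fun _ _ => False).LockWellFormed ∧ lockSo K A W l s s'
  have part : (rdmaPart K A G l R).IsPart G := h.rdmaPart_isPart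
  have hrdma : ∀ {s s'}, W'.rdmaSo (rdmaPart K A G l R) s s' →
      s.1 ∈ (rdmaPart K A G l R).E ∧ s'.1 ∈ (rdmaPart K A G l R).E := fun hs =>
    have := Exec.IsPart.rdmaSo_sub (H := rdmaPart K A G l R) hs
    ⟨this.1.1, this.2.1⟩
  have hlock : ∀ {s s'}, lockSo K A W l s s' →
      s.1 ∈ (lockPart K A Lk G l R).E ∧ s'.1 ∈ (lockPart K A Lk G l R).E := by
    rintro s s' (⟨q, hq, rfl, rfl⟩ | ⟨d, d', q, hdd, hp, rfl, rfl⟩)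
    · have := (h.mem_evAt (R := R).2 (.inr ⟨q, hq, rfl, rfl⟩)).1
      exact ⟨this, this⟩
    · exact ⟨(h.mem_evAt (R := R).2 (.inr ⟨q, (mem_blocksOf_of_pair hp.lt).2, rfl, rfl⟩)).1,
        (h.mem_evAt (R := R).2 (.inl ⟨d', ⟨_, hdd.2.1.1⟩, rfl, rfl⟩)).1⟩
  have hdisj : ∀ e, e ∈ (rdmaPart K A G l R).E → e ∈ (lockPart K A Lk G l R).E → False := by
    rintro e ⟨-, c, hc⟩ ⟨-, x, -, hc'⟩
    rw [← hc] at hc'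
    simp at hc'
  have rdma_so : ∀ s s', (rdmaPart K A G l R).so s s' ↔ W'.rdmaSo (rdmaPart K A G l R) s s' := by
    intro s s'
    constructor
    · rintro ⟨h₁, h₂, hs | ⟨-, hs⟩⟩
      · exact hs
      · exact (hdisj _ h₁ (hlock hs).1).elim
    · intro hs
      exact ⟨(hrdma hs).1, (hrdma hs).2, .inl hs⟩
  have lock_so : ∀ s s', (lockPart K A Lk G l R).so s s' ↔
      (lockPart K A Lk G l R).LockWellFormed ∧ lockSo K A W l s s' := by
    intro s s'
    constructor
    · rintro ⟨h₁, h₂, hs | hs⟩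
      · exact (hdisj _ (hrdma hs).1 h₁).elim
      · exact hs
    · intro hs
      exact ⟨(hlock hs.2).1, (hlock hs.2).2, .inr hs⟩
  refine ⟨R, h.client_isExecution ?_, ?_, ?_, ?_⟩
  · rintro s s' (hs | ⟨hwf, hs⟩)
    · obtain ⟨h₁, h₂⟩ := hrdma hs
      have hss := Exec.IsPart.rdmaSo_sub (H := rdmaPart K A G l R) hs
      exact ⟨_, (mem_rdmaPart.1 h₁).1, _, (mem_rdmaPart.1 h₂).1, rfl, rfl, hss.1.2, hss.2.2,
        h.hb_of_so (part.rdmaSo_of h.wf hs)⟩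
    · exact h.lockSo_hb hVal hwf hs
  · rintro L (rfl | rfl)
    · exact h.lockPart_consistent fun s s' hwf => (lock_so s s').trans ⟨And.right, And.intro hwf⟩
    · refine ⟨fun e he => ?_, W', part.wellFormed h.wf, fun s hs => ?_, rdma_so⟩
      · obtain ⟨c, h₁, h₂, h₃, h₄⟩ := h.rdma e (part.E he)
        exact ⟨c, h₁, h₂, h₃, (part.stmp e he).symm ▸ h₄⟩
      · exact h.ib_irrefl s (part.ib_of h.wf hs)
  · rintro e ⟨b, hb, rfl⟩
    cases b with
    | client e =>
      obtain ⟨c, hc⟩ := h.client_call hb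
      exact ⟨_, .inr rfl, c, hc.symm⟩
    | acq d => exact ⟨_, .inl rfl, d.lock, (h.ok_of_mem hb).2.1, .inl rfl⟩
    | rel q => exact ⟨_, .inl rfl, q.lock, (h.ok_of_mem hb).2, .inr rfl⟩
  · intro s s'
    constructor
    · rintro (hs | hs)
      · exact ⟨_, .inr rfl, (rdma_so s s').2 hs⟩
      · exact ⟨_, .inl rfl, (lock_so s s').2 hs⟩
    · rintro ⟨L, -, hs⟩
      exact hs.2.2

end Refines

end Abstraction

/-! ### Soundness -/

section Soundness

variable {Val Loc Tid Node Wid : Type*} [Zero Val] [One Val] [Add Val]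

theorem Exec.IsExecution.restrict_eq_self {Tid Call Val Node : Type*} {G : Exec Tid Call Val Node}
    (h : G.IsExecution) {M : Set Call} (hM : ∀ e ∈ G.E, e.call ∈ M) : G.restrict M = G := by
  obtain ⟨E, po, stmp, so, hb⟩ := G
  simp only [Exec.restrict, Exec.mk.injEq, true_and]
  refine ⟨?_, ?_, ?_, ?_⟩
  · ext e
    exact ⟨And.left, fun he => ⟨he, hM e he⟩⟩
  · funext a b
    refine propext ⟨fun hp => hp.2.2, fun hp => ?_⟩
    obtain ⟨ha, hb⟩ := h.po_sub a b hp
    exact ⟨⟨ha, hM a ha⟩, ⟨hb, hM b hb⟩, hp⟩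
  · funext a b
    refine propext ⟨fun hp => hp.2.2, fun hp => ?_⟩
    obtain ⟨ha, hb⟩ := h.so_sub a b hp
    exact ⟨⟨ha.1, hM _ ha.1⟩, ⟨hb.1, hM _ hb.1⟩, hp⟩
  · funext a b
    refine propext ⟨fun hp => hp.2.2, fun hp => ?_⟩
    obtain ⟨ha, hb⟩ := h.hb_sub a b hp
    exact ⟨⟨ha.1, hM _ ha.1⟩, ⟨hb.1, hM _ hb.1⟩, hp⟩

theorem nlock_sound [Finite Tid]
    (hVal : Function.Injective fun k : ℕ => (fun v : Val => v + 1)^[k] 0)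
    (K : Config Val Loc Tid Node) (Lk : Set Loc) (A : NLockLayout Loc Tid Wid)
    (hA : A.Valid K Lk) : SoundImpl (nlockLib K Lk) {rdmaLib K} (nlockImpl K A) := by
  rintro P hdisj v ⟨G, hG, H, hH, hGH⟩
  have hcall : ∀ e ∈ G.E, e.call ∈ (rdmaLib (Tid := Tid) K).M := by
    intro e he
    obtain ⟨L, rfl, hc⟩ := hG.events e he
    exact hc
  have hcons : G.RdmaConsistent K := by
    have := hG.lib _ rfl
    rwa [hG.isExecution.restrict_eq_self hcall] at this
  obtain ⟨hrdma, W, hwf, hib, hso⟩ := hcons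
  have hE : G.E = ⋃ t, (H t).E := congrArg Plain.E hGH
  have hpo : ∀ e e', G.po e e' ↔ ∃ t, (H t).po e e' := fun e e' =>
    iff_of_eq (congrFun (congrFun (congrArg Plain.po hGH) e) e')
  have hblocks := fun t => exists_blocks (hH t) fun e he => by
    obtain ⟨c, hc, -, ht, -⟩ := hrdma e (hE ▸ Set.mem_iUnion.2 ⟨t, he⟩)
    exact ⟨c, hc, ht⟩
  choose l hl hP hok using hblocks
  -- The plain execution of the client does not depend on `R`, so this is available before the
  -- synchronisation order is chosen.
  have hPl : ∀ R, ProgUnfolds P v (clientExec K A G l R).plain := by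
    refine fun R => ⟨_, hP, ?_⟩
    simp only [Exec.plain, clientExec, Plain.par, Plain.ofList, Plain.mk.injEq, and_true]
    ext e
    simp only [blocksOf, Set.mem_ofPred_eq, Set.mem_iUnion, List.mem_map]
    exact ⟨fun ⟨b, ⟨t, hb⟩, he⟩ => ⟨t, b, hb, he⟩, fun ⟨t, b, hb, he⟩ => ⟨b, ⟨t, hb⟩, he⟩⟩
  have href : Refines K A Lk G W l :=
    { valid := hA
      isExecution := hG.isExecution
      rdma := hrdma
      wf := hwf
      ib_irrefl := hib
      so_iff := hso
      mem_E := fun e => by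
        simp only [hE, Set.mem_iUnion, hl, Plain.mem_ofList, List.mem_flatMap]
      po_iff := fun e e' => by
        rw [hpo]
        simp only [hl]
        rfl
      ok := hok
      fresh := fun t e he x hx c hc => by
        -- A temporary cell is exhibited by its own thread `t'`, which need not be the thread of the
        -- client event; for the other two cells any thread serves.
        obtain ⟨t', hc'⟩ : ∃ t', c = .ticket ∨ c = .release ∨ c = .temp t' := by
          cases c with
          | ticket => exact ⟨t, .inl rfl⟩
          | release => exact ⟨t, .inr (.inl rfl)⟩
          | temp t' => exact ⟨t', .inr (.inr rfl)⟩
        refine Set.disjoint_left.1 hdisj (cell_mem_implLocs K A hx t' hc')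
          ⟨v, _, hPl fun _ _ => False, e, ⟨_, ⟨t, he⟩, rfl⟩, rdmaLib K, .inr rfl, ?_, hc⟩
        obtain ⟨-, c', hc'⟩ := hok t _ he
        exact ⟨c', hc'.symm⟩ }
  obtain ⟨R, hR⟩ := href.exists_consistent hVal
  exact ⟨_, hR, hPl R⟩

end Soundness

theorem mainTheorem2 {Val Tid Node Wid : Type*} [Finite Tid] [Zero Val] [One Val] [Add Val]
    (hVal : Function.Injective fun k : ℕ => (fun v : Val => v + 1)^[k] 0)
    (Loc : Set Val) (K : Config Val Loc Tid Node) (Lk : Set Loc)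
    (A : NLockLayout Loc Tid Wid) (hA : A.Valid K Lk) :
    WellDefinedImpl (nlockLib K Lk) {rdmaLib K} (nlockImpl K A) ∧
      SoundImpl (nlockLib K Lk) {rdmaLib K} (nlockImpl K A) :=
  ⟨nlock_wellDefined K Lk A, nlock_sound hVal K Lk A hA⟩
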